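/- **Setting.** The Fourier transform is $\widehat f(\xi)=\int_{\mathbb R^d} f(x)e^{-2\pi i x\cdot\xi}\,dx$. Let $\mathcal O\subset\mathbb R^d$ be an open set of full Lebesgue measure. Let $\mathcal Q=(Q_i)_{i\in I}$ be a family of non-empty subsets of $\mathcal O$ with $\mathcal O=\bigcup_i Q_i$ and $\sup_i|\{\ell: Q_\ell\cap Q_i\ne\emptyset\}|<\infty$, which admits a fixed bounded admissible partition of unity $(\varphi_i)_{i\in I}$, that is: $\varphi_i\in C_c^\infty(\mathcal O)$, $\sum_i\varphi_i=1$ on $\mathcal O$, $\varphi_i=0$ on $\mathcal O\setminus Q_i$ and $\sup_i\|\mathcal F^{-1}\varphi_i\|_{L^1}<\infty$. Let $w=(w_i)_{i\in I}\subset(0,\infty)$ be $\mathcal Q$-moderate, i.e. $\sup\{w_i/w_\ell: Q_i\cap Q_\ell\neq\emptyset\}<\infty$. Let $Z(\mathcal O)=\mathcal F(C_c^\infty(\mathcal O))$ with the topology transported from $C_c^\infty(\mathcal O)$ by $\mathcal F$, let $Z'(\mathcal O)$ be its topological dual, and for $f\in Z'(\mathcal O)$ let $\widehat f:=f\circ\mathcal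 F\in\mathcal D'(\mathcal O)$. The space $\mathcal D(\mathcal Q,L^2,\ell^2_w)$ consists of all $f\in Z'(\mathcal O)$ with $\|f\|_{\mathcal D(\mathcal Q,L^2,\ell_w^2)}=\big(\sum_i w_i^2\|\mathcal F^{-1}(\varphi_i\widehat f\,)\|_{L^2}^2\big)^{1/2}<\infty$. Let $\mathcal S_{\mathcal O}=\mathcal F^{-1}(C_c^\infty(\mathcal O))$; functions in $L^2(\mathbb R^d)$ are regarded as elements of $Z'(\mathcal O)$ via $\phi\mapsto\int f\phi\,dx$. Let $J$ be countable and, for $j\in J$, let $C_j\in \mathrm{GL}(d,\mathbb R)$ and $g_j\in L^1(\mathbb R^d)\cap L^2(\mathbb R^d)$ with $\widehat{g_j}\in C^\infty$. Assume that there are $0<A\le B<\infty$ with $A\le\sum_{j}|\det C_j|^{-1}|\widehat{g_j}(\xi)|^2\le B$ for a.e. $\xi$. Put $T_yf=f(\cdot-y)$, $\Lambda=\bigcup_j C_j^{-t}\mathbb Z^d$, and for $\alpha\in\Lambda$ $$t_\alpha(\xi)=\sum_{j:\,\alpha\in C_j^{-t}\mathbb Z^d}|\det C_j|^{-1}\,\overline{\widehat{g_j}(\xi)}\,\widehat{g_j}(\xi+\alpha).$$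 Assume the $\alpha$-local integrability condition relative to $\mathcal O^c$: for every $f\in L^2(\mathbb R^d)$ such that $\widehat f\in L^\infty$ vanishes almost everywhere outside a compact subset of $\mathcal O$, $$\sum_{j\in J}\frac1{|\det C_j|}\sum_{\alpha\in C_j^{-t}\mathbb Z^d}\int_{\mathbb R^d}|\widehat f(\xi)\widehat f(\xi+\alpha)\widehat{g_j}(\xi)\widehat{g_j}(\xi+\alpha)|\,d\xi<\infty .$$ **Proposition.** Let $v:\mathbb R^d\to(0,\infty)$ be measurable with $v(\xi)\asymp w_i$ for $\xi\in Q_i$, with constants independent of $i$ and $\xi$. Let $v_0:\mathbb R^d\to(0,\infty)$ satisfy $v_0(-\xi)=v_0(\xi)$ and, for some constant $C_v>0$, $v(\xi+\eta)\le C_v\,v(\xi)\,v_0(\eta)$ for all $\xi,\eta\in\mathbb R^d$. If $$C_v\cdot\operatorname*{ess\,sup}_{\xi\in\mathcal O}\sum_{\alpha\in\Lambda\setminus\{0\}}|t_\alpha(\xi)|\,v_0(\alpha)<A,$$ then: 1. For each $f\in\mathcal S_{\mathcal O}$ the series $Sf=\sum_{j\in J}\sum_{k\in\mathbb Z^d}\langle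 f\mid T_{C_jk}g_j\rangle_{L^2}\,T_{C_jk}g_j$ converges unconditionally in $L^2(\mathbb R^d)$. 2. $\mathcal S_{\mathcal O}\subset\mathcal D(\mathcal Q,L^2,\ell^2_w)$, and $\mathcal D(\mathcal Q,L^2,\ell^2_w)=\{f\in Z'(\mathcal O):\widehat f\in L^2_v(\mathcal O)\}$ with $\|f\|_{\mathcal D(\mathcal Q,L^2,\ell^2_w)}\asymp\|v\widehat f\,\|_{L^2(\mathcal O)}$. 3. The frame operator $S:\mathcal S_{\mathcal O}\to L^2(\mathbb R^d)$ extends uniquely to a bounded linear operator $S_0:\mathcal D(\mathcal Q,L^2,\ell^2_w)\to\mathcal D(\mathcal Q,L^2,\ell^2_w)$, and $S_0$ is boundedly invertible. -/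

import Mathlib

open MeasureTheory TopologicalSpace FourierTransform SchwartzMap
open scoped ENNReal NNReal ContDiff Distributions

noncomputable section

namespace GSI

/-- The Euclidean space `ℝ^d`; it also serves as the Fourier domain. -/
abbrev E (d : ℕ) : Type := EuclideanSpace ℝ (Fin d)

variable {d : ℕ} {Ω : Opens (E d)} {I J : Type*}

/-! ### Test functions, distributions, Fourier distributions -/

section TestFunctions

/-- Smooth functions supported in a fixed compact set are Schwartz functions, continuously. -/
def supportedInToSchwartz (K : Compacts (E d)) : 𝓓_{K}(E d, ℂ) →L[ℂ] 𝓢(E d, ℂ) :=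
  letI A : 𝓓_{K}(E d, ℂ) →ₗ[ℂ] 𝓢(E d, ℂ) :=
    { toFun := fun f => f.hasCompactSupport.toSchwartzMap f.contDiff
      map_add' := fun _ _ => SchwartzMap.ext fun _ => rfl
      map_smul' := fun _ _ => SchwartzMap.ext fun _ => rfl }
  { toLinearMap := A
    cont := by
      change Continuous A
      refine WithSeminorms.continuous_of_isBounded
        (ContDiffMapSupportedIn.withSeminorms ℂ (E d) ℂ ⊤ K)
        (schwartz_withSeminorms ℂ (E d) ℂ) _ (fun n => ?_)
      obtain ⟨r, hr0, hr⟩ : ∃ r : ℝ, 0 ≤ r ∧ ∀ x ∈ (K : Set (E d)), ‖x‖ ≤ r := by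
        obtain ⟨r, hr⟩ := K.isCompact.isBounded.exists_norm_le
        exact ⟨max r 0, le_max_right _ _, fun x hx => (hr x hx).trans (le_max_left _ _)⟩
      refine ⟨{n.2}, ⟨r ^ n.1, pow_nonneg hr0 _⟩, fun f => ?_⟩
      refine (A f).seminorm_le_bound ℂ n.1 n.2
        (mul_nonneg (pow_nonneg hr0 _) (apply_nonneg _ _)) (fun x => ?_)
      have hA : ((A f : 𝓢(E d, ℂ)) : E d → ℂ) = f := rfl
      rw [hA]
      have hle : ‖iteratedFDeriv ℝ n.2 f x‖ ≤ N[ℂ]_{K, n.2} f :=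
        ContDiffMapSupportedIn.norm_iteratedFDeriv_apply_le_seminorm_top ℂ
      simp only [Finset.sup_singleton]
      by_cases hx : x ∈ (K : Set (E d))
      · exact mul_le_mul (pow_le_pow_left₀ (norm_nonneg _) (hr x hx) _) hle
          (norm_nonneg _) (pow_nonneg hr0 _)
      · have h0 : iteratedFDeriv ℝ n.2 f x = 0 := f.iteratedFDeriv_zero_on_compl hx
        rw [h0, norm_zero, mul_zero]
        exact mul_nonneg (pow_nonneg hr0 _) (apply_nonneg _ _) }

/-- The inclusion `C_c^∞(Ω) → 𝓢(ℝ^d)`. -/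
def testToSchwartz (Ω : Opens (E d)) : 𝓓(Ω, ℂ) →L[ℂ] 𝓢(E d, ℂ) :=
  TestFunction.limitCLM ℂ
    (fun f => f.hasCompactSupport.toSchwartzMap f.contDiff)
    (fun K _ => supportedInToSchwartz K)
    (fun _ _ _ => rfl)

@[simp]
theorem testToSchwartz_apply (f : 𝓓(Ω, ℂ)) (x : E d) : testToSchwartz Ω f x = f x := rfl

/-- Multiplication by a test function `φ ∈ C_c^∞(Ω)`, as a map `𝓢(ℝ^d) → C_c^∞(Ω)`. -/
def mulTest (φ : 𝓓(Ω, ℂ)) : 𝓢(E d, ℂ) →L[ℂ] 𝓓(Ω, ℂ) :=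
  letI K : Compacts (E d) := ⟨tsupport φ, φ.hasCompactSupport⟩
  letI A : 𝓢(E d, ℂ) →ₗ[ℂ] 𝓓_{K}(E d, ℂ) :=
    { toFun := fun ψ => ContDiffMapSupportedIn.of_support_subset (f := fun x => φ x * ψ x)
        (φ.contDiff.mul (ψ.smooth ⊤))
        ((Function.support_mul_subset_left _ _).trans subset_closure)
      map_add' := fun _ _ => ContDiffMapSupportedIn.ext fun _ => mul_add _ _ _
      map_smul' := fun _ _ => ContDiffMapSupportedIn.ext fun _ => mul_left_comm _ _ _ }
  TestFunction.ofSupportedInCLM ℂ (K := K) φ.tsupport_subset ∘L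
    { toLinearMap := A
      cont := by
        change Continuous A
        let M : 𝓢(E d, ℂ) →L[ℂ] 𝓢(E d, ℂ) := SchwartzMap.smulLeftCLM ℂ (φ : E d → ℂ)
        have hM : ∀ ψ : 𝓢(E d, ℂ), ((M ψ : 𝓢(E d, ℂ)) : E d → ℂ) = A ψ := by
          intro ψ
          have ht : Function.HasTemperateGrowth (φ : E d → ℂ) :=
            (testToSchwartz Ω φ).hasTemperateGrowth
          exact SchwartzMap.smulLeftCLM_apply ht ψ
        refine (ContDiffMapSupportedIn.withSeminorms ℂ (E d) ℂ ⊤ K).continuous_of_continuous_comp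
          A (fun i => ?_)
        have hq : Continuous ((SchwartzMap.seminorm ℂ 0 i).comp M.toLinearMap) :=
          ((schwartz_withSeminorms ℂ (E d) ℂ).continuous_seminorm (0, i)).comp M.continuous
        refine Seminorm.continuous_of_le hq (fun ψ => ?_)
        refine (ContDiffMapSupportedIn.seminorm_top_le_iff ℂ (apply_nonneg _ _) i (A ψ)).2
          (fun x _ => ?_)
        rw [← hM ψ]
        simpa using SchwartzMap.le_seminorm ℂ 0 i (M ψ) x }

@[simp]
theorem mulTest_apply (φ : 𝓓(Ω, ℂ)) (ψ : 𝓢(E d, ℂ)) (x : E d) :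
    mulTest φ ψ x = φ x * ψ x := rfl

end TestFunctions

section FourierDistributions

/-- Complex distributions on `Ω`: the topological dual `𝓓'(Ω)` of `C_c^∞(Ω)`. -/
abbrev Distr (Ω : Opens (E d)) : Type := 𝓓(Ω, ℂ) →L[ℂ] ℂ

/-- The Fourier transform on test functions, with values in the Schwartz functions. -/
def fourierTest (Ω : Opens (E d)) : 𝓓(Ω, ℂ) →L[ℂ] 𝓢(E d, ℂ) :=
  fourierCLM ℂ 𝓢(E d, ℂ) ∘L testToSchwartz Ω

/-- The Fourier test function space `Z(Ω) = 𝓕 (C_c^∞(Ω))`. -/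
def ZSpace (Ω : Opens (E d)) : Type := LinearMap.range (fourierTest Ω).toLinearMap

instance : AddCommGroup (ZSpace Ω) :=
  inferInstanceAs (AddCommGroup (LinearMap.range (fourierTest Ω).toLinearMap))

instance : Module ℂ (ZSpace Ω) :=
  inferInstanceAs (Module ℂ (LinearMap.range (fourierTest Ω).toLinearMap))

/-- The inclusion `Z(Ω) ⊆ 𝓢(ℝ^d)`. -/
def ZSpace.toSchwartz (Ω : Opens (E d)) : ZSpace Ω →ₗ[ℂ] 𝓢(E d, ℂ) :=
  (LinearMap.range (fourierTest Ω).toLinearMap).subtype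

/-- The Fourier transform `C_c^∞(Ω) → Z(Ω)`, a linear bijection. -/
def fourierTestLM (Ω : Opens (E d)) : 𝓓(Ω, ℂ) →ₗ[ℂ] ZSpace Ω :=
  (fourierTest Ω).toLinearMap.rangeRestrict

/-- The topology of `Z(Ω)` is transported from `C_c^∞(Ω)` by the Fourier transform (not the
one induced by `𝓢(ℝ^d)`). -/
instance : TopologicalSpace (ZSpace Ω) :=
  TopologicalSpace.coinduced (fourierTestLM Ω) inferInstance

@[simp]
theorem toSchwartz_fourierTestLM (ψ : 𝓓(Ω, ℂ)) :
    ZSpace.toSchwartz Ω (fourierTestLM Ω ψ) = 𝓕 (testToSchwartz Ω ψ) := rfl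

theorem fourierTestLM_bijective (Ω : Opens (E d)) : Function.Bijective (fourierTestLM Ω) := by
  refine ⟨fun f g h => ?_, LinearMap.surjective_rangeRestrict _⟩
  have h1 : 𝓕 (testToSchwartz Ω f) = 𝓕 (testToSchwartz Ω g) := by
    rw [← toSchwartz_fourierTestLM, ← toSchwartz_fourierTestLM, h]
  have h2 : testToSchwartz Ω f = testToSchwartz Ω g := by
    have := congrArg (fun u : 𝓢(E d, ℂ) => 𝓕⁻ u) h1
    simpa using this
  exact TestFunction.ext fun x => congrArg (fun u : 𝓢(E d, ℂ) => u x) h2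

/-- The Fourier transform `C_c^∞(Ω) → Z(Ω)` is a homeomorphism. -/
theorem fourierTestLM_isHomeomorph (Ω : Opens (E d)) : IsHomeomorph (fourierTestLM Ω) :=
  { continuous := continuous_coinduced_rng
    isOpenMap := fun s hs => by
      rw [isOpen_coinduced, Set.preimage_image_eq s (fourierTestLM_bijective Ω).1]
      exact hs
    bijective := fourierTestLM_bijective Ω }

/-- The Fourier transform `C_c^∞(Ω) → Z(Ω)` as a continuous linear map. -/
def fourierTestCLM (Ω : Opens (E d)) : 𝓓(Ω, ℂ) →L[ℂ] ZSpace Ω :=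
  { toLinearMap := fourierTestLM Ω
    cont := continuous_coinduced_rng }

/-- The space `Z'(Ω)` of Fourier distributions: the topological dual of `Z(Ω)`. -/
abbrev FourierDistr (Ω : Opens (E d)) : Type := ZSpace Ω →L[ℂ] ℂ

/-- The Fourier transform `Z'(Ω) → 𝓓'(Ω)`, `f ↦ f ∘ 𝓕`. -/
def FourierDistr.fourier (f : FourierDistr Ω) : Distr Ω := f ∘L fourierTestCLM Ω

/-- The restriction of tempered distributions to `Z(Ω) ⊆ 𝓢(ℝ^d)`. -/
def restrictZ (Ω : Opens (E d)) (u : 𝓢'(E d, ℂ)) : FourierDistr Ω :=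
  { toLinearMap := (u : 𝓢(E d, ℂ) →ₗ[ℂ] ℂ) ∘ₗ ZSpace.toSchwartz Ω
    cont := continuous_coinduced_dom.2 (u.continuous.comp (fourierTest Ω).continuous) }

/-- An `L^2` function as a Fourier distribution: `φ ↦ ∫ f φ` for `φ ∈ Z(Ω)`. -/
def ofL2 (Ω : Opens (E d)) (f : Lp ℂ 2 (volume : Measure (E d))) : FourierDistr Ω :=
  restrictZ Ω (Lp.toTemperedDistribution f)

theorem ofL2_apply (f : Lp ℂ 2 (volume : Measure (E d))) (φ : ZSpace Ω) :
    ofL2 Ω f φ = ∫ x, ZSpace.toSchwartz Ω φ x * f x := by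
  change Lp.toTemperedDistribution f (ZSpace.toSchwartz Ω φ) = _
  rw [Lp.toTemperedDistribution_apply]
  rfl

/-- The subspace `𝓢_Ω(ℝ^d) = 𝓕⁻¹ (C_c^∞(Ω))` of the Schwartz space. -/
def SchwartzOn (Ω : Opens (E d)) : Submodule ℂ 𝓢(E d, ℂ) :=
  LinearMap.range (fourierInvCLM ℂ 𝓢(E d, ℂ) ∘L testToSchwartz Ω).toLinearMap

end FourierDistributions

/-! ### Covers, weights, partitions of unity -/

section Covers

/-- `Q` is an admissible cover of `Ω`. -/
structure IsAdmissibleCover (Ω : Opens (E d)) (Q : I → Set (E d)) : Prop where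
  iUnion_eq : ⋃ i, Q i = (Ω : Set (E d))
  nonempty : ∀ i, (Q i).Nonempty
  overlap : ∃ N : ℕ, ∀ i, {l | (Q l ∩ Q i).Nonempty}.encard ≤ N

/-- `w` is a `Q`-moderate weight. -/
structure IsModerateWeight (Q : I → Set (E d)) (w : I → ℝ) : Prop where
  pos : ∀ i, 0 < w i
  moderate : ∃ C : ℝ, ∀ i l, (Q l ∩ Q i).Nonempty → w i / w l ≤ C

/-- `φ` is a bounded admissible partition of unity (BAPU) subordinate to `Q`; an admissible cover
with a BAPU is called a decomposition cover. -/
structure IsBAPU (Ω : Opens (E d)) (Q : I → Set (E d)) (φ : I → 𝓓(Ω, ℂ)) : Prop where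
  sum_eq_one : ∀ ξ ∈ Ω, HasSum (fun i => φ i ξ) 1
  eq_zero : ∀ i, ∀ ξ ∈ Ω, ξ ∉ Q i → φ i ξ = 0
  bounded : ∃ C : ℝ≥0, ∀ i, eLpNorm (𝓕⁻ (φ i : E d → ℂ)) 1 volume ≤ C

end Covers

/-! ### The decomposition space `D(Q, L^2, ℓ^2_w)` -/

section DecompositionSpace

/-- The `L^2` norm of a tempered distribution (`∞` if it is not an `L^2` function). -/
def l2Norm (u : 𝓢'(E d, ℂ)) : ℝ≥0∞ :=
  ⨅ (h : Lp ℂ 2 (volume : Measure (E d))) (_ : Lp.toTemperedDistribution h = u), ‖h‖ₑ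

/-- The tempered distribution `φ · u`, for a test function `φ` and a distribution `u` on `Ω`. -/
def mulDistr (φ : 𝓓(Ω, ℂ)) (u : Distr Ω) : 𝓢'(E d, ℂ) :=
  ContinuousLinearMap.toPointwiseConvergenceCLM _ _ _ _ (u ∘L mulTest φ)

/-- The frequency-localized piece `𝓕⁻¹ (φ · f̂)` of a Fourier distribution `f`. -/
def piece (φ : 𝓓(Ω, ℂ)) (f : FourierDistr Ω) : 𝓢'(E d, ℂ) :=
  𝓕⁻ (mulDistr φ f.fourier)

/-- The norm of `D(Q, L^2, ℓ^2_w)` with respect to the BAPU `φ`,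
`(∑ i, (w i * ‖𝓕⁻¹ (φ i · f̂)‖_{L^2})^2)^{1/2}`. -/
def decompNorm (φ : I → 𝓓(Ω, ℂ)) (w : I → ℝ) (f : FourierDistr Ω) : ℝ≥0∞ :=
  (∑' i, (ENNReal.ofReal (w i) * l2Norm (piece (φ i) f)) ^ 2) ^ (1 / 2 : ℝ)

theorem piece_add (φ : 𝓓(Ω, ℂ)) (f g : FourierDistr Ω) :
    piece φ (f + g) = piece φ f + piece φ g := rfl

theorem piece_smul (φ : 𝓓(Ω, ℂ)) (c : ℂ) (f : FourierDistr Ω) :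
    piece φ (c • f) = c • piece φ f := rfl

theorem l2Norm_zero : l2Norm (0 : 𝓢'(E d, ℂ)) = 0 := by
  refine le_antisymm ?_ zero_le
  refine (iInf₂_le 0 ?_).trans (by simp)
  exact map_zero (Lp.toTemperedDistributionCLM ℂ (volume : Measure (E d)) 2)

theorem l2Norm_add_le (u v : 𝓢'(E d, ℂ)) : l2Norm (u + v) ≤ l2Norm u + l2Norm v := by
  unfold l2Norm
  simp only [ENNReal.iInf_add, ENNReal.add_iInf]
  refine le_iInf fun k => le_iInf fun hk => le_iInf fun h => le_iInf fun hh => ?_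
  refine (iInf₂_le (h + k) ?_).trans (enorm_add_le _ _)
  rw [← hh, ← hk]
  exact map_add (Lp.toTemperedDistributionCLM ℂ volume 2) h k

theorem l2Norm_smul_le (c : ℂ) (u : 𝓢'(E d, ℂ)) : l2Norm (c • u) ≤ ‖c‖ₑ * l2Norm u := by
  rcases eq_or_ne c 0 with rfl | hc
  · rw [show (0 : ℂ) • u = 0 from zero_smul ℂ u, l2Norm_zero]
    exact zero_le
  unfold l2Norm
  rw [ENNReal.mul_iInf_of_ne (by simpa using hc) enorm_ne_top]
  refine le_iInf fun h => ?_
  rw [ENNReal.mul_iInf_of_ne (by simpa using hc) enorm_ne_top]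
  refine le_iInf fun hh => ?_
  refine (iInf₂_le (c • h) ?_).trans (enorm_smul c h).le
  rw [← hh]
  exact map_smul (Lp.toTemperedDistributionCLM ℂ volume 2) c h

theorem decompNorm_lt_top_iff (φ : I → 𝓓(Ω, ℂ)) (w : I → ℝ) (f : FourierDistr Ω) :
    decompNorm φ w f < ⊤ ↔
      ∑' i, (ENNReal.ofReal (w i) * l2Norm (piece (φ i) f)) ^ 2 < ⊤ := by
  unfold decompNorm
  exact ENNReal.rpow_lt_top_iff_of_pos (by norm_num)

/-- The decomposition space `D(Q, L^2, ℓ^2_w)`, where the norm is computed with the BAPU `φ`. -/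
def DecompSpace (φ : I → 𝓓(Ω, ℂ)) (w : I → ℝ) : Submodule ℂ (FourierDistr Ω) where
  carrier := {f | decompNorm φ w f < ⊤}
  zero_mem' := by
    rw [Set.mem_ofPred_eq, decompNorm_lt_top_iff]
    have h0 : ∀ i, piece (φ i) (0 : FourierDistr Ω) = 0 := fun _ => rfl
    simp [h0, l2Norm_zero]
  add_mem' := by
    intro f g hf hg
    rw [Set.mem_ofPred_eq, decompNorm_lt_top_iff] at *
    have key : ∀ a b : ℝ≥0∞, (a + b) ^ 2 ≤ 2 * (a ^ 2 + b ^ 2) := fun a b => by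
      have := ENNReal.rpow_add_le_mul_rpow_add_rpow a b (p := 2) (by norm_num)
      norm_num at this
      exact_mod_cast this
    refine lt_of_le_of_lt (ENNReal.tsum_le_tsum fun i => ?_)
      (b := ∑' i, 2 * ((ENNReal.ofReal (w i) * l2Norm (piece (φ i) f)) ^ 2 +
        (ENNReal.ofReal (w i) * l2Norm (piece (φ i) g)) ^ 2)) ?_
    · refine le_trans (pow_le_pow_left₀ zero_le ?_ 2) (key _ _)
      rw [← mul_add, piece_add]
      exact mul_le_mul_right (l2Norm_add_le _ _) _
    · rw [ENNReal.tsum_mul_left, ENNReal.tsum_add]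
      exact ENNReal.mul_lt_top (by norm_num) (ENNReal.add_lt_top.2 ⟨hf, hg⟩)
  smul_mem' := by
    intro c f hf
    rw [Set.mem_ofPred_eq, decompNorm_lt_top_iff] at *
    refine lt_of_le_of_lt (ENNReal.tsum_le_tsum fun i => ?_)
      (b := ∑' i, ‖c‖ₑ ^ 2 * (ENNReal.ofReal (w i) * l2Norm (piece (φ i) f)) ^ 2) ?_
    · rw [← mul_pow, piece_smul, mul_left_comm]
      exact pow_le_pow_left₀ zero_le (mul_le_mul_right (l2Norm_smul_le _ _) _) 2
    · rw [ENNReal.tsum_mul_left]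
      exact ENNReal.mul_lt_top (ENNReal.pow_lt_top enorm_lt_top) hf

/-- A linear operator on `D(Q, L^2, ℓ^2_w)` is bounded. -/
def IsBoundedOp (φ : I → 𝓓(Ω, ℂ)) (w : I → ℝ)
    (S : DecompSpace φ w →ₗ[ℂ] DecompSpace φ w) : Prop :=
  ∃ C : ℝ≥0, ∀ f : DecompSpace φ w, decompNorm φ w (S f) ≤ C * decompNorm φ w f

/-- The norm of `L^2_v(Ω)` of a distribution `u` on `Ω`, namely `‖v · h‖_{L^2(Ω)}` if `u` is
given by the locally integrable function `h`, and `∞` if there is no such `h`. -/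
def weightedL2Norm (v : E d → ℝ) (u : Distr Ω) : ℝ≥0∞ :=
  ⨅ (h : E d → ℂ) (_ : LocallyIntegrableOn h Ω volume ∧
      ∀ ψ : 𝓓(Ω, ℂ), u ψ = ∫ ξ in (Ω : Set (E d)), ψ ξ * h ξ),
    eLpNorm (fun ξ => (v ξ : ℂ) * h ξ) 2 (volume.restrict Ω)

end DecompositionSpace

/-! ### Generalized shift-invariant systems -/

/-- The generators `g j` and the matrices `C j ∈ GL(d, ℝ)` of a generalized shift-invariant system
`(g j (· - C j k))_{j, k}`, with `g j ∈ L^1 ∩ L^2` and smooth Fourier transforms. -/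
structure System (d : ℕ) (J : Type*) where
  C : J → GL (Fin d) ℝ
  g : J → E d → ℂ
  integrable : ∀ j, Integrable (g j) volume
  memLp : ∀ j, MemLp (g j) 2 volume
  contDiff_fourier : ∀ j, ContDiff ℝ ∞ (𝓕 (g j))

namespace System

variable (G : System d J)

/-- The modulus of `det (C j)`. -/
def absDet (j : J) : ℝ := |(G.C j : Matrix (Fin d) (Fin d) ℝ).det|

/-- The point `C j k` of the translation lattice `C j ℤ^d`. -/
def latticePt (j : J) (k : Fin d → ℤ) : E d :=
  WithLp.toLp 2 ((G.C j : Matrix (Fin d) (Fin d) ℝ).mulVec fun i => (k i : ℝ))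

/-- The point `C j^{-t} k` of the dual lattice `C j^{-t} ℤ^d`. -/
def dualPt (j : J) (k : Fin d → ℤ) : E d :=
  WithLp.toLp 2 (((G.C j)⁻¹ : GL (Fin d) ℝ).val.transpose.mulVec fun i => (k i : ℝ))

/-- The dual lattice `C j^{-t} ℤ^d`. -/
def dualLattice (j : J) : Set (E d) := Set.range (G.dualPt j)

/-- The union `Λ` of all dual lattices. -/
def Lam : Set (E d) := ⋃ j, G.dualLattice j

/-- The index set `κ(α)` of those `j` with `α ∈ C j^{-t} ℤ^d`. -/
def kappa (α : E d) : Set J := {j | α ∈ G.dualLattice j}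

/-- The function `t_α(ξ) = ∑_{j ∈ κ(α)} |det C j|⁻¹ conj (ĝ j ξ) ĝ j (ξ + α)`. -/
def t (α ξ : E d) : ℂ :=
  ∑' j : G.kappa α,
    ((G.absDet j)⁻¹ : ℂ) * (starRingEnd ℂ (𝓕 (G.g j) ξ) * 𝓕 (G.g j) (ξ + α))

/-- The sum `∑_j |det C j|⁻¹ |ĝ j ξ|^2`, with values in `[0, ∞]`. -/
def calderonSum (ξ : E d) : ℝ≥0∞ :=
  ∑' j, ENNReal.ofReal ((G.absDet j)⁻¹ * ‖𝓕 (G.g j) ξ‖ ^ 2)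

/-- The Fourier-Plancherel transform of `f ∈ L^2`. -/
def fourierL2 (f : Lp ℂ 2 (volume : Measure (E d))) : E d → ℂ :=
  ((𝓕 f : Lp ℂ 2 (volume : Measure (E d))) : E d → ℂ)

/-- The space of all `f ∈ L^2` such that `f̂` is essentially bounded and vanishes a.e. outside
a compact subset of `Ω`. -/
def BSpace (Ω : Opens (E d)) : Set (Lp ℂ 2 (volume : Measure (E d))) :=
  {f | MemLp (fourierL2 f) ⊤ volume ∧
    ∃ K : Set (E d), IsCompact K ∧ K ⊆ Ω ∧ ∀ᵐ ξ, ξ ∉ K → fourierL2 f ξ = 0}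

/-- The `α`-local integrability condition relative to the complement of `Ω`. -/
def AlphaLIC (Ω : Opens (E d)) : Prop :=
  ∀ f ∈ BSpace Ω,
    ∑' j, ENNReal.ofReal (G.absDet j)⁻¹ * ∑' α : G.dualLattice j,
      ∫⁻ ξ, ‖fourierL2 f ξ * fourierL2 f (ξ + α) * 𝓕 (G.g j) ξ * 𝓕 (G.g j) (ξ + α)‖ₑ < ⊤

/-- The translate `g j (· - C j k)`, as an element of `L^2`. -/
def atom (j : J) (k : Fin d → ℤ) : Lp ℂ 2 (volume : Measure (E d)) :=
  ((G.memLp j).comp_measurePreserving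
    (measurePreserving_sub_right volume (G.latticePt j k))).toLp _

/-- The terms `⟨f | T_{C j k} g j⟩ T_{C j k} g j` of the frame operator. -/
def frameTerm (f : Lp ℂ 2 (volume : Measure (E d))) (p : J × (Fin d → ℤ)) :
    Lp ℂ 2 (volume : Measure (E d)) :=
  inner ℂ (G.atom p.1 p.2) f • G.atom p.1 p.2

/-- The frame operator `S f = ∑_{j, k} ⟨f | T_{C j k} g j⟩ T_{C j k} g j`. -/
def frameOperator (f : Lp ℂ 2 (volume : Measure (E d))) : Lp ℂ 2 (volume : Measure (E d)) :=
  ∑' p : J × (Fin d → ℤ), G.frameTerm f p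

end System

/-- The operator `S₀` on `D(Q, L^2, ℓ^2_w)` extends the frame operator `S : 𝓢_Ω(ℝ^d) → L^2`, where
`𝓢_Ω(ℝ^d)` and `L^2` are regarded as subsets of `Z'(Ω)`. -/
def Extends {φ : I → 𝓓(Ω, ℂ)} {w : I → ℝ} (G : System d J)
    (S₀ : DecompSpace φ w →ₗ[ℂ] DecompSpace φ w) : Prop :=
  ∀ f ∈ SchwartzOn Ω, ∀ F : DecompSpace φ w, (F : FourierDistr Ω) = ofL2 Ω (f.toLp 2) →
    (S₀ F : FourierDistr Ω) = ofL2 Ω (G.frameOperator (f.toLp 2))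

end GSI

end

/-!
The whole statement is transported to the Fourier side, where the decomposition space becomes a
weighted `L^2` space and the frame operator becomes a small perturbation of a multiple of the
identity.

*The decomposition space.* Since at most `N` of the functions `φ i` are nonzero at any point and
all of them are bounded, `∑ i, |w i φ i h|^2` is pointwise comparable to `|v h|^2`. With Plancherel
this gives `‖f‖ ≍ ‖v f̂‖_{L^2}`; conversely, if the norm is finite then the local pieces `φ i f̂`
are `L^2` functions that glue to a locally integrable function `f̂` (`exists_norm_equivalence`).
As `Ω` has full measure, `F ↦ 𝓕⁻¹ (F / v)` is an isomorphism `Ψ` of the unweighted space `L^2`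
onto the decomposition space (`exists_equiv_decompSpace`). It maps `v ψ`, with `ψ` a test function,
to `𝓕⁻¹ ψ`, and the functions `v ψ` are dense in `L^2` (`dense_range_weightedTest`).

*The frame operator.* For `f₁ = 𝓕⁻¹ ψ₁` and `f₂ = 𝓕⁻¹ ψ₂`, the coefficients of one generator `g j`
are the Fourier coefficients of a periodization, so Parseval's identity expresses
`∑ k, ⟨f₁ | T g j⟩ ⟨T g j | f₂⟩` as a sum over the dual lattice. Summed over `j`, which the
`α`-local integrability condition justifies because it applies to the indicator functions of
compact subsets of `Ω`, this yields (`hasSum_frameForm`)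
`⟨f₁ | S f₂⟩ = ∫ ξ, conj (ψ₁ ξ) * ∑ α, conj (t_α ξ) * ψ₂ (ξ + α)`.
So `𝓕 S 𝓕⁻¹` is the operator `F ↦ ∑ α, conj t_α · F (· + α)`. Its boundedness gives a Bessel
inequality, hence the unconditional convergence of the frame series.

*Invertibility.* Conjugation with a moderate weight `u` replaces `t_α` by `u / u (· + α) · t_α`,
and moderateness bounds the quotient by `C_v v₀(α)`. The functions `t_α` with `α ≠ 0` contribute at
most `δ < A` to the rows of the kernel; by the symmetry `t_{-α} = conj t_α (· - α)` the columns obey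
the same bound. Moreover `A ≤ t_0 ≤ B`, so `|t_0 - B| ≤ B - A`. By Schur's test the conjugated
operator differs from `B` by an operator of norm at most `B - A + δ < B`, and it is invertible by
the Neumann series (`exists_multiplier`). This is applied with `u = 1`, which is again moderate,
for the operator on `L^2`, and with `u = v` for the operator `K` on the weighted space. Then
`S₀ = Ψ K Ψ⁻¹` is the extension in question, `Ψ K⁻¹ Ψ⁻¹` is its inverse, and the density of the
functions `v ψ` makes it unique.
-/

noncomputable section

namespace GSI

variable {d : ℕ} {Ω : Opens (E d)} {I J : Type*}

/-! ### Distributions given by locally integrable functions -/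

/-- The linear bijection `f ↦ f̂` from Fourier distributions to distributions. -/
def fourierEquiv (Ω : Opens (E d)) : FourierDistr Ω ≃ₗ[ℂ] Distr Ω where
  toFun f := f.fourier
  map_add' _ _ := rfl
  map_smul' _ _ := rfl
  invFun u :=
    { toLinearMap := (u : 𝓓(Ω, ℂ) →ₗ[ℂ] ℂ) ∘ₗ
        (LinearEquiv.ofBijective (fourierTestLM Ω) (fourierTestLM_bijective Ω)).symm.toLinearMap
      cont := continuous_coinduced_dom.2 <| by
        refine u.continuous.congr fun ψ => ?_
        exact congrArg u
          ((LinearEquiv.ofBijective (fourierTestLM Ω) (fourierTestLM_bijective Ω)).symm_apply_apply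
            ψ).symm }
  left_inv f := ContinuousLinearMap.ext fun z => congrArg f
    ((LinearEquiv.ofBijective (fourierTestLM Ω) (fourierTestLM_bijective Ω)).apply_symm_apply z)
  right_inv u := ContinuousLinearMap.ext fun ψ => congrArg u
    ((LinearEquiv.ofBijective (fourierTestLM Ω) (fourierTestLM_bijective Ω)).symm_apply_apply ψ)

@[simp]
theorem fourierEquiv_apply (f : FourierDistr Ω) : fourierEquiv Ω f = f.fourier := rfl

@[simp]
theorem fourier_fourierEquiv_symm (u : Distr Ω) : ((fourierEquiv Ω).symm u).fourier = u :=
  (fourierEquiv Ω).apply_symm_apply u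

theorem setIntegral_test_mul (ψ : 𝓓(Ω, ℂ)) (h : E d → ℂ) :
    ∫ ξ in (Ω : Set (E d)), ψ ξ * h ξ = ∫ ξ, ψ ξ * h ξ := by
  refine setIntegral_eq_integral_of_forall_compl_eq_zero fun x hx => ?_
  rw [image_eq_zero_of_notMem_tsupport fun hx' => hx (ψ.tsupport_subset hx'), zero_mul]

theorem integrable_test_mul (ψ : 𝓓(Ω, ℂ)) {h : E d → ℂ}
    (hh : LocallyIntegrableOn h Ω volume) : Integrable (fun ξ => ψ ξ * h ξ) :=
  TestFunction.integrable_bilin (ContinuousLinearMap.mul ℂ ℂ) hh ψ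

/-- The distribution `ψ ↦ ∫ ψ h` given by a function `h` that is locally integrable on `Ω`. -/
def distrOfFun (Ω : Opens (E d)) (h : E d → ℂ) : Distr Ω :=
  TestFunction.integralAgainstBilinCLM (ContinuousLinearMap.mul ℂ ℂ) volume h

theorem distrOfFun_apply {h : E d → ℂ} (hh : LocallyIntegrableOn h Ω volume) (ψ : 𝓓(Ω, ℂ)) :
    distrOfFun Ω h ψ = ∫ ξ, ψ ξ * h ξ :=
  TestFunction.integralAgainstBilinCLM_eq_integral hh

/-- The test function with real values `g`, regarded as a complex test function. -/
def testOfReal (Ω : Opens (E d)) {g : E d → ℝ} (hg : ContDiff ℝ ∞ g) (hc : HasCompactSupport g)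
    (hs : tsupport g ⊆ Ω) : 𝓓(Ω, ℂ) where
  toFun x := (g x : ℂ)
  contDiff' := Complex.ofRealCLM.contDiff.comp hg
  hasCompactSupport' := hc.comp_left Complex.ofReal_zero
  tsupport_subset' := (tsupport_comp_subset Complex.ofReal_zero g).trans hs

@[simp]
theorem testOfReal_apply {g : E d → ℝ} (hg : ContDiff ℝ ∞ g) (hc : HasCompactSupport g)
    (hs : tsupport g ⊆ Ω) (x : E d) : testOfReal Ω hg hc hs x = g x := rfl

theorem ae_eq_zero_of_forall_test {h : E d → ℂ} (hh : LocallyIntegrableOn h Ω volume)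
    (H : ∀ ψ : 𝓓(Ω, ℂ), ∫ ξ, ψ ξ * h ξ = 0) : ∀ᵐ ξ, ξ ∈ Ω → h ξ = 0 := by
  refine Ω.isOpen.ae_eq_zero_of_integral_contDiff_smul_eq_zero hh fun g hg hc hs => ?_
  simpa using H (testOfReal Ω hg hc hs)

theorem ae_eq_of_forall_test {h h' : E d → ℂ} (hh : LocallyIntegrableOn h Ω volume)
    (hh' : LocallyIntegrableOn h' Ω volume)
    (H : ∀ ψ : 𝓓(Ω, ℂ), ∫ ξ, ψ ξ * h ξ = ∫ ξ, ψ ξ * h' ξ) : ∀ᵐ ξ, ξ ∈ Ω → h ξ = h' ξ := by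
  have := ae_eq_zero_of_forall_test (hh.sub hh') fun ψ => by
    simp only [Pi.sub_apply, mul_sub]
    rw [integral_sub (integrable_test_mul ψ hh) (integrable_test_mul ψ hh'), H, sub_self]
  filter_upwards [this] with ξ h1 h2 using sub_eq_zero.1 (h1 h2)

theorem restrict_eq_self_of_compl_null (hΩ : volume ((Ω : Set (E d))ᶜ) = 0) :
    (volume : Measure (E d)).restrict Ω = volume :=
  Measure.restrict_eq_self_of_ae_mem (by rw [ae_iff]; exact hΩ)

theorem _root_.MeasureTheory.Lp.locallyIntegrableOn (h : Lp ℂ 2 (volume : Measure (E d)))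
    (s : Set (E d)) : LocallyIntegrableOn h s volume :=
  ((Lp.memLp h).locallyIntegrable (by norm_num)).locallyIntegrableOn s

theorem ofL2_fourier_apply (f : Lp ℂ 2 (volume : Measure (E d))) (ψ : 𝓓(Ω, ℂ)) :
    (ofL2 Ω f).fourier ψ = ∫ ξ, ψ ξ * (𝓕 f : Lp ℂ 2 (volume : Measure (E d))) ξ := by
  change 𝓕 (Lp.toTemperedDistribution f) (testToSchwartz Ω ψ) = _
  rw [Lp.fourier_toTemperedDistribution_eq, Lp.toTemperedDistribution_apply]
  rfl

theorem toTemperedDistribution_injective {f g : Lp ℂ 2 (volume : Measure (E d))}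
    (h : Lp.toTemperedDistribution f = Lp.toTemperedDistribution g) : f = g :=
  LinearMap.ker_eq_bot.1 (Lp.ker_toTemperedDistributionCLM_eq_bot (F := ℂ)
    (μ := (volume : Measure (E d))) (p := 2)) h

theorem l2Norm_toTemperedDistribution (f : Lp ℂ 2 (volume : Measure (E d))) :
    l2Norm (Lp.toTemperedDistribution f) = ‖f‖ₑ := by
  refine le_antisymm (iInf₂_le (f := fun (h : Lp ℂ 2 (volume : Measure (E d))) _ => ‖h‖ₑ) f rfl)
    (le_iInf₂ fun g hg => ?_)
  rw [toTemperedDistribution_injective hg]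

/-- Plancherel for a frequency-localized piece: `φ f̂ = H` with `H ∈ L^2`. -/
theorem l2Norm_piece_eq {φ : 𝓓(Ω, ℂ)} {f : FourierDistr Ω}
    {H : Lp ℂ 2 (volume : Measure (E d))}
    (hH : ∀ ψ : 𝓢(E d, ℂ), f.fourier (mulTest φ ψ) = ∫ ξ, ψ ξ * H ξ) :
    l2Norm (piece φ f) = ‖H‖ₑ := by
  have h1 : mulDistr φ f.fourier = Lp.toTemperedDistribution H := by
    ext ψ
    rw [Lp.toTemperedDistribution_apply]
    exact hH ψ
  rw [piece, h1, Lp.fourierInv_toTemperedDistribution_eq, l2Norm_toTemperedDistribution]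
  rw [← ofReal_norm, ← ofReal_norm, ← Lp.norm_fourier_eq, fourier_fourierInv_eq]

theorem exists_l2_of_l2Norm_piece_ne_top {φ : 𝓓(Ω, ℂ)} {f : FourierDistr Ω}
    (h : l2Norm (piece φ f) ≠ ⊤) : ∃ H : Lp ℂ 2 (volume : Measure (E d)),
      ∀ ψ : 𝓢(E d, ℂ), f.fourier (mulTest φ ψ) = ∫ ξ, ψ ξ * H ξ := by
  obtain ⟨g, hg⟩ : ∃ g : Lp ℂ 2 (volume : Measure (E d)),
      Lp.toTemperedDistribution g = piece φ f := by
    by_contra! hne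
    exact h (by simp [l2Norm, hne])
  refine ⟨𝓕 g, fun ψ => ?_⟩
  have h1 : mulDistr φ f.fourier = Lp.toTemperedDistribution (𝓕 g) := by
    rw [← Lp.fourier_toTemperedDistribution_eq, hg, piece, fourier_fourierInv_eq]
  have h2 := congrArg (fun T : 𝓢'(E d, ℂ) => T ψ) h1
  simp only [Lp.toTemperedDistribution_apply, smul_eq_mul] at h2
  exact h2

/-! ### Bounded admissible partitions of unity -/

theorem eLpNorm_two_sq {α : Type*} [MeasurableSpace α] (f : α → ℂ) (μ : Measure α) :
    eLpNorm f 2 μ ^ 2 = ∫⁻ x, ‖f x‖ₑ ^ 2 ∂μ := by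
  have := eLpNorm_nnreal_pow_eq_lintegral (f := f) (μ := μ) (p := 2) (by norm_num)
  simpa using this

theorem enorm_sq_eq_lintegral {α : Type*} [MeasurableSpace α] {μ : Measure α} (H : Lp ℂ 2 μ) :
    ‖H‖ₑ ^ 2 = ∫⁻ x, ‖H x‖ₑ ^ 2 ∂μ := by
  rw [Lp.enorm_def, eLpNorm_two_sq]

/-- Cauchy-Schwarz for a series with at most `N` nonzero terms. -/
theorem tsum_sq_le_of_encard_le {ι : Type*} (a : ι → ℝ≥0∞) (N : ℕ)
    (h : {i | a i ≠ 0}.encard ≤ N) : (∑' i, a i) ^ 2 ≤ N * ∑' i, a i ^ 2 := by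
  have hfin : {i | a i ≠ 0}.Finite := Set.finite_of_encard_le_coe h
  have h0 : ∀ i ∉ hfin.toFinset, a i = 0 := fun i hi => by simpa using hi
  rw [tsum_eq_sum h0, tsum_eq_sum (f := fun i => a i ^ 2) (s := hfin.toFinset)
    fun i hi => by simp [h0 i hi]]
  have hc : (hfin.toFinset.card : ℝ≥0∞) ≤ N := by
    have := h
    rw [hfin.encard_eq_coe_toFinset_card] at this
    exact_mod_cast this
  have key := ENNReal.rpow_sum_le_const_mul_sum_rpow (ι := ι) hfin.toFinset a (p := 2) (by norm_num)
  norm_num at key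
  exact key.trans (mul_le_mul_left hc _)

namespace IsBAPU

variable {Q : I → Set (E d)} {φ : I → 𝓓(Ω, ℂ)}

/-- The functions `φ i` are uniformly bounded, by the bound on `‖𝓕⁻¹ (φ i)‖_{L^1}`. -/
theorem exists_norm_le (hφ : IsBAPU Ω Q φ) : ∃ C : ℝ≥0, ∀ i ξ, ‖φ i ξ‖ₑ ≤ C := by
  obtain ⟨C, hC⟩ := hφ.bounded
  refine ⟨C, fun i ξ => ?_⟩
  refine le_trans ?_ (hC i)
  have h1 : φ i ξ = 𝓕 (𝓕⁻ (φ i : E d → ℂ)) ξ := by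
    have h2 : 𝓕 (𝓕⁻ (testToSchwartz Ω (φ i))) = testToSchwartz Ω (φ i) :=
      fourier_fourierInv_eq _
    have h3 := congrArg (fun S : 𝓢(E d, ℂ) => S ξ) h2
    simp only [SchwartzMap.fourier_coe, SchwartzMap.fourierInv_coe] at h3
    exact h3.symm
  rw [h1, eLpNorm_one_eq_lintegral_enorm, Real.fourier_eq]
  refine (enorm_integral_le_lintegral_enorm _).trans (le_of_eq ?_)
  refine lintegral_congr fun x => ?_
  rw [← ofReal_norm, ← ofReal_norm, Circle.norm_smul]

theorem mem_of_ne_zero (hφ : IsBAPU Ω Q φ) {i : I} {ξ : E d} (h : φ i ξ ≠ 0) : ξ ∈ Q i := by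
  by_contra hQ
  exact h (hφ.eq_zero i ξ ((φ i).tsupport_subset (subset_tsupport _ h)) hQ)

theorem exists_ne_zero (hφ : IsBAPU Ω Q φ) {ξ : E d} (hξ : ξ ∈ Ω) : ∃ i, φ i ξ ≠ 0 := by
  by_contra! h
  have := hφ.sum_eq_one ξ hξ
  simp only [h] at this
  exact zero_ne_one (hasSum_zero.unique this)

theorem exists_encard_le (hφ : IsBAPU Ω Q φ) (hQ : IsAdmissibleCover Ω Q) :
    ∃ N : ℕ, ∀ ξ, {i | φ i ξ ≠ 0}.encard ≤ N := by
  obtain ⟨N, hN⟩ := hQ.overlap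
  refine ⟨N, fun ξ => ?_⟩
  rcases Set.eq_empty_or_nonempty {i | φ i ξ ≠ 0} with h | ⟨i, hi⟩
  · simp [h]
  · refine (Set.encard_le_encard (t := {l | (Q l ∩ Q i).Nonempty}) fun l hl => ?_).trans (hN i)
    exact ⟨ξ, hφ.mem_of_ne_zero hl, hφ.mem_of_ne_zero hi⟩

/-- A partition of unity with finite overlaps is locally finite: near a point where `φ i ≠ 0` only
the neighbours of `i` contribute. -/
theorem exists_mem_nhds_finite (hφ : IsBAPU Ω Q φ) (hQ : IsAdmissibleCover Ω Q) {ξ : E d}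
    (hξ : ξ ∈ Ω) : ∃ U ∈ nhds ξ, {l | ∃ η ∈ U, φ l η ≠ 0}.Finite := by
  obtain ⟨N, hN⟩ := hQ.overlap
  obtain ⟨i, hi⟩ := hφ.exists_ne_zero hξ
  refine ⟨{η | φ i η ≠ 0}, (isOpen_ne_fun (φ i).continuous continuous_const).mem_nhds hi, ?_⟩
  refine Set.finite_of_encard_le_coe ((Set.encard_le_encard ?_).trans (hN i))
  rintro l ⟨η, hη, hl⟩
  exact ⟨η, hφ.mem_of_ne_zero hl, hφ.mem_of_ne_zero hη⟩

theorem finite_of_isCompact (hφ : IsBAPU Ω Q φ) (hQ : IsAdmissibleCover Ω Q) {K : Set (E d)}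
    (hK : IsCompact K) (hKΩ : K ⊆ Ω) : {l | ∃ η ∈ K, φ l η ≠ 0}.Finite := by
  choose! U hU hUf using fun ξ (hξ : ξ ∈ Ω) => hφ.exists_mem_nhds_finite hQ hξ
  obtain ⟨t, ht, htK⟩ := hK.elim_nhds_subcover U fun ξ hξ => hU ξ (hKΩ hξ)
  refine (t.finite_toSet.biUnion fun x hx => hUf x (hKΩ (ht x hx))).subset ?_
  rintro l ⟨η, hη, hl⟩
  obtain ⟨x, hx, hxη⟩ := Set.mem_iUnion₂.1 (htK hη)
  exact Set.mem_biUnion hx ⟨η, hxη, hl⟩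

/-- The index set of an admissible cover is countable: every `Q l` has a neighbour `Q i` such that
`φ i` does not vanish at some point of a countable dense set. -/
theorem countable (hφ : IsBAPU Ω Q φ) (hQ : IsAdmissibleCover Ω Q) : Countable I := by
  obtain ⟨N, hN⟩ := hQ.overlap
  obtain ⟨N', hN'⟩ := hφ.exists_encard_le hQ
  obtain ⟨D, hDc, hD⟩ := exists_countable_dense (E d)
  rw [← Set.countable_univ_iff]
  refine Set.Countable.mono (s₂ := ⋃ x ∈ D, ⋃ i ∈ {i | φ i x ≠ 0}, {l | (Q l ∩ Q i).Nonempty})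
    (fun l _ => ?_) (hDc.biUnion fun x _ =>
      (Set.finite_of_encard_le_coe (hN' x)).countable.biUnion fun i _ =>
        (Set.finite_of_encard_le_coe (hN i)).countable)
  obtain ⟨ξ, hξ⟩ := hQ.nonempty l
  have hξΩ : ξ ∈ Ω := by
    have : ξ ∈ ⋃ i, Q i := Set.mem_iUnion.2 ⟨l, hξ⟩
    rwa [hQ.iUnion_eq] at this
  obtain ⟨i, hi⟩ := hφ.exists_ne_zero hξΩ
  obtain ⟨x, hxD, hx⟩ := hD.exists_mem_open (isOpen_ne_fun (φ i).continuous continuous_const)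
    ⟨ξ, hi⟩
  exact Set.mem_biUnion hxD (Set.mem_biUnion hx ⟨ξ, hξ, hφ.mem_of_ne_zero hi⟩)

/-- A test function is a finite sum of its pieces `φ i ψ`. -/
theorem exists_sum_mulTest (hφ : IsBAPU Ω Q φ) (hQ : IsAdmissibleCover Ω Q) (ψ : 𝓓(Ω, ℂ)) :
    ∃ s : Finset I, (∑ i ∈ s, mulTest (φ i) (testToSchwartz Ω ψ)) = ψ := by
  have hfin := hφ.finite_of_isCompact hQ ψ.hasCompactSupport ψ.tsupport_subset
  refine ⟨hfin.toFinset, TestFunction.ext fun x => ?_⟩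
  have hsum : (∑ i ∈ hfin.toFinset, mulTest (φ i) (testToSchwartz Ω ψ)) x =
      ∑ i ∈ hfin.toFinset, φ i x * ψ x := by
    have := map_sum (TestFunction.toBoundedContinuousFunctionCLM ℂ :
      𝓓(Ω, ℂ) →L[ℂ] BoundedContinuousFunction (E d) ℂ)
      (fun i => mulTest (φ i) (testToSchwartz Ω ψ)) hfin.toFinset
    have h2 := congrArg (fun u : BoundedContinuousFunction (E d) ℂ => u x) this
    simp only [BoundedContinuousFunction.coe_sum, Finset.sum_apply] at h2
    exact h2
  rw [hsum]
  by_cases hx : x ∈ tsupport ψ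
  · rw [← Finset.sum_mul]
    have h1 : HasSum (fun i => φ i x) (∑ i ∈ hfin.toFinset, φ i x) :=
      hasSum_sum_of_ne_finset_zero fun i hi => by
        by_contra hne
        exact hi (hfin.mem_toFinset.2 ⟨x, hx, hne⟩)
    rw [h1.unique (hφ.sum_eq_one x (ψ.tsupport_subset hx)), one_mul]
  · simp [image_eq_zero_of_notMem_tsupport hx]

end IsBAPU

/-! ### Comparison of the decomposition space norm with a weighted `L^2` norm -/

section NormEquivalence

variable {Q : I → Set (E d)} {φ : I → 𝓓(Ω, ℂ)} {w : I → ℝ} {v : E d → ℝ}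

/-- If `f̂` is the function `h`, then the pieces of `f` are controlled by `v h`: at every point at
most `N` of the bounded functions `φ i` contribute, and there `w i` is dominated by `v`. -/
theorem tsum_l2Norm_piece_le (hφ : IsBAPU Ω Q φ) (hQ : IsAdmissibleCover Ω Q)
    (hw : ∀ i, 0 < w i) (hv_meas : Measurable v) (hv_pos : ∀ ξ, 0 < v ξ) {C₀ : ℝ}
    (hvw : ∀ i, ∀ ξ ∈ Q i, w i ≤ C₀ * v ξ) :
    ∃ K : ℝ≥0, ∀ (f : FourierDistr Ω) (h : E d → ℂ), LocallyIntegrableOn h Ω volume →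
      (∀ ψ, f.fourier ψ = ∫ ξ, ψ ξ * h ξ) →
      ∑' i, (ENNReal.ofReal (w i) * l2Norm (piece (φ i) f)) ^ 2 ≤
        K * ∫⁻ ξ in (Ω : Set (E d)), ‖(v ξ : ℂ) * h ξ‖ₑ ^ 2 := by
  obtain ⟨Cφ, hCφ⟩ := hφ.exists_norm_le
  obtain ⟨N, hN⟩ := hφ.exists_encard_le hQ
  have := hφ.countable hQ
  refine ⟨N * (Real.toNNReal C₀ * Cφ) ^ 2 + 1, fun f h hh hf => ?_⟩
  set X := ∫⁻ ξ in (Ω : Set (E d)), ‖(v ξ : ℂ) * h ξ‖ₑ ^ 2 with hX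
  rcases eq_or_ne X ⊤ with hXt | hXt
  · rw [hXt, ENNReal.mul_top (by simp)]
    exact le_top
  have hmeas : AEStronglyMeasurable h (volume.restrict Ω) := hh.aestronglyMeasurable
  have hvh : AEMeasurable (fun ξ => ‖(v ξ : ℂ) * h ξ‖ₑ ^ 2) (volume.restrict Ω) := by
    have : AEStronglyMeasurable (fun ξ => (v ξ : ℂ) * h ξ) (volume.restrict Ω) :=
      (Complex.measurable_ofReal.comp hv_meas).aestronglyMeasurable.mul hmeas
    exact this.enorm.pow_const 2
  set c : ℝ≥0∞ := ((Real.toNNReal C₀ * Cφ : ℝ≥0) : ℝ≥0∞) with hc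
  have hcT : c ≠ ⊤ := ENNReal.coe_ne_top
  -- the pointwise bound `w i |φ i h| ≤ C |v h|` on the set where `φ i ≠ 0`
  have hpt : ∀ i ξ, ENNReal.ofReal (w i) ^ 2 * ‖φ i ξ * h ξ‖ₑ ^ 2 ≤
      {ξ | φ i ξ ≠ 0}.indicator (fun ξ => c ^ 2 * ‖(v ξ : ℂ) * h ξ‖ₑ ^ 2) ξ := by
    intro i ξ
    by_cases h0 : φ i ξ = 0
    · simp [h0]
    rw [Set.indicator_of_mem (by simpa using h0), ← mul_pow, ← mul_pow]
    refine pow_le_pow_left₀ zero_le ?_ 2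
    have h1 : ENNReal.ofReal (w i) ≤ Real.toNNReal C₀ * ‖(v ξ : ℂ)‖ₑ := by
      have h3 : ‖(v ξ : ℂ)‖ₑ = ENNReal.ofReal (v ξ) := by
        rw [← ofReal_norm, Complex.norm_real, Real.norm_of_nonneg (hv_pos ξ).le]
      rw [h3]
      refine (ENNReal.ofReal_le_ofReal (hvw i ξ (hφ.mem_of_ne_zero h0))).trans (le_of_eq ?_)
      exact ENNReal.ofReal_mul' (hv_pos ξ).le
    calc ENNReal.ofReal (w i) * ‖φ i ξ * h ξ‖ₑ
        ≤ (Real.toNNReal C₀ * ‖(v ξ : ℂ)‖ₑ) * (Cφ * ‖h ξ‖ₑ) := by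
          rw [enorm_mul]; gcongr; exact hCφ i ξ
      _ = _ := by rw [enorm_mul, hc]; push_cast; ring
  have hle : ∀ i, ENNReal.ofReal (w i) ^ 2 * ∫⁻ ξ in (Ω : Set (E d)), ‖φ i ξ * h ξ‖ₑ ^ 2 ≤
      ∫⁻ ξ in (Ω : Set (E d)),
        {ξ | φ i ξ ≠ 0}.indicator (fun ξ => c ^ 2 * ‖(v ξ : ℂ) * h ξ‖ₑ ^ 2) ξ := by
    intro i
    rw [← lintegral_const_mul' _ _ (by simp)]
    exact lintegral_mono fun ξ => hpt i ξ
  have hext : ∀ i, (fun ξ => φ i ξ * h ξ) =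
      (Ω : Set (E d)).indicator fun ξ => φ i ξ * h ξ := by
    intro i
    ext ξ
    by_cases hξ : ξ ∈ (Ω : Set (E d))
    · rw [Set.indicator_of_mem hξ]
    · rw [Set.indicator_of_notMem hξ,
        image_eq_zero_of_notMem_tsupport fun hx' => hξ ((φ i).tsupport_subset hx'), zero_mul]
  have hL2 : ∀ i, MemLp (fun ξ => φ i ξ * h ξ) 2 volume := by
    intro i
    rw [hext, memLp_indicator_iff_restrict Ω.isOpen.measurableSet]
    refine ⟨(φ i).aestronglyMeasurable.mul hmeas, ?_⟩
    have h1 : eLpNorm (fun ξ => φ i ξ * h ξ) 2 (volume.restrict Ω) ^ 2 < ⊤ := by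
      rw [eLpNorm_two_sq]
      refine ENNReal.lt_top_of_mul_ne_top_right (a := ENNReal.ofReal (w i) ^ 2) ?_
        (by simpa using hw i)
      refine ne_top_of_le_ne_top ?_ (hle i)
      refine ne_top_of_le_ne_top (ENNReal.mul_ne_top (a := c ^ 2) (ENNReal.pow_ne_top hcT) hXt) ?_
      rw [hX, ← lintegral_const_mul' _ _ (ENNReal.pow_ne_top hcT)]
      exact lintegral_mono fun ξ => Set.indicator_le_self _ _ _
    simpa using h1
  have hpiece : ∀ i, l2Norm (piece (φ i) f) ^ 2 =
      ∫⁻ ξ in (Ω : Set (E d)), ‖φ i ξ * h ξ‖ₑ ^ 2 := by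
    intro i
    have h1 : l2Norm (piece (φ i) f) = ‖(hL2 i).toLp‖ₑ := by
      refine l2Norm_piece_eq fun ψ => ?_
      rw [hf]
      refine integral_congr_ae ?_
      filter_upwards [(hL2 i).coeFn_toLp] with ξ hξ
      rw [hξ, mulTest_apply]; ring
    rw [h1, Lp.enorm_toLp, hext, eLpNorm_indicator_eq_eLpNorm_restrict Ω.isOpen.measurableSet,
      eLpNorm_two_sq]
  calc ∑' i, (ENNReal.ofReal (w i) * l2Norm (piece (φ i) f)) ^ 2
      ≤ ∑' i, ∫⁻ ξ in (Ω : Set (E d)),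
          {ξ | φ i ξ ≠ 0}.indicator (fun ξ => c ^ 2 * ‖(v ξ : ℂ) * h ξ‖ₑ ^ 2) ξ :=
        ENNReal.tsum_le_tsum fun i => by rw [mul_pow, hpiece]; exact hle i
    _ = ∫⁻ ξ in (Ω : Set (E d)), ∑' i,
          {ξ | φ i ξ ≠ 0}.indicator (fun ξ => c ^ 2 * ‖(v ξ : ℂ) * h ξ‖ₑ ^ 2) ξ := by
        refine (lintegral_tsum fun i => ?_).symm
        exact (hvh.const_mul _).indicator
          (isOpen_ne_fun (φ i).continuous continuous_const).measurableSet
    _ ≤ ∫⁻ ξ in (Ω : Set (E d)), (N * c ^ 2) * ‖(v ξ : ℂ) * h ξ‖ₑ ^ 2 := by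
        refine lintegral_mono fun ξ => ?_
        have h1 : ∀ i, {ξ | φ i ξ ≠ 0}.indicator (fun ξ => c ^ 2 * ‖(v ξ : ℂ) * h ξ‖ₑ ^ 2) ξ =
            {i | φ i ξ ≠ 0}.indicator (fun _ => (1 : ℝ≥0∞)) i *
              (c ^ 2 * ‖(v ξ : ℂ) * h ξ‖ₑ ^ 2) := by
          intro i
          by_cases h0 : φ i ξ = 0 <;> simp [Set.indicator, h0]
        simp only [h1]
        rw [ENNReal.tsum_mul_right, ← tsum_subtype, ENNReal.tsum_set_one, mul_assoc]
        gcongr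
        have := ENat.toENNReal_le.2 (hN ξ)
        simpa using this
    _ = N * c ^ 2 * X := by rw [hX, lintegral_const_mul' _ _ (by finiteness)]
    _ ≤ _ := by
        gcongr
        rw [hc]
        push_cast
        exact le_self_add

/-- If the norm of `f` in the decomposition space is finite, then `f̂` is a function: the `L^2`
functions `H i = φ i f̂` are compatible, and `f̂ = ∑ i, H i`. -/
theorem exists_fun_of_tsum_l2Norm_piece (hφ : IsBAPU Ω Q φ) (hQ : IsAdmissibleCover Ω Q)
    (hw : ∀ i, 0 < w i) (hv_pos : ∀ ξ, 0 < v ξ) {C₀ : ℝ}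
    (hvw : ∀ i, ∀ ξ ∈ Q i, v ξ ≤ C₀ * w i) :
    ∃ K : ℝ≥0, ∀ f : FourierDistr Ω,
      ∑' i, (ENNReal.ofReal (w i) * l2Norm (piece (φ i) f)) ^ 2 ≠ ⊤ →
      ∃ h : E d → ℂ, LocallyIntegrableOn h Ω volume ∧ (∀ ψ, f.fourier ψ = ∫ ξ, ψ ξ * h ξ) ∧
        ∫⁻ ξ in (Ω : Set (E d)), ‖(v ξ : ℂ) * h ξ‖ₑ ^ 2 ≤
          K * ∑' i, (ENNReal.ofReal (w i) * l2Norm (piece (φ i) f)) ^ 2 := by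
  obtain ⟨N, hN⟩ := hφ.exists_encard_le hQ
  have := hφ.countable hQ
  refine ⟨N * Real.toNNReal C₀ ^ 2, fun f hf => ?_⟩
  have hfin : ∀ i, l2Norm (piece (φ i) f) ≠ ⊤ := by
    intro i hi
    refine hf (ENNReal.tsum_eq_top_of_eq_top ⟨i, ?_⟩)
    rw [hi, ENNReal.mul_top (by simpa using hw i)]
    rfl
  choose H hH using fun i => exists_l2_of_l2Norm_piece_ne_top (hfin i)
  have hHΩ : ∀ i, LocallyIntegrableOn (H i) Ω volume := fun i => Lp.locallyIntegrableOn _ _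
  -- the pieces are compatible: `φ l H i` and `φ i H l` both represent `φ i φ l f̂`
  have hcomp : ∀ i l, ∀ᵐ ξ, φ l ξ * H i ξ = φ i ξ * H l ξ := by
    intro i l
    have h1 : ∀ i l, LocallyIntegrableOn (fun ξ => φ l ξ * H i ξ) Ω volume := fun i l =>
      (integrable_test_mul (φ l) (hHΩ i)).locallyIntegrable.locallyIntegrableOn _
    have h2 : ∀ i l (ψ : 𝓓(Ω, ℂ)), ∫ ξ, ψ ξ * (φ l ξ * H i ξ) =
        f.fourier (mulTest (φ i) (testToSchwartz Ω (mulTest (φ l) (testToSchwartz Ω ψ)))) := by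
      intro i l ψ
      rw [hH]
      refine integral_congr_ae (Filter.Eventually.of_forall fun ξ => ?_)
      simp only [testToSchwartz_apply, mulTest_apply]
      ring
    have h3 := ae_eq_of_forall_test (h1 i l) (h1 l i) fun ψ => by
      rw [h2, h2]
      congr 1
      refine TestFunction.ext fun ξ => ?_
      simp only [testToSchwartz_apply, mulTest_apply]
      ring
    filter_upwards [h3] with ξ hξ
    by_cases hξΩ : ξ ∈ Ω
    · exact hξ hξΩ
    · have h0 : ∀ i, φ i ξ = 0 := fun i =>
        image_eq_zero_of_notMem_tsupport fun hx' => hξΩ ((φ i).tsupport_subset hx')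
      rw [h0, h0, zero_mul, zero_mul]
  set h : E d → ℂ := fun ξ => ∑' i, {ξ | φ i ξ ≠ 0}.indicator (H i) ξ with hh
  -- `h = ∑ i, H i` glues the quotients `H i / φ i`
  have hglue : ∀ᵐ ξ, ξ ∈ Ω → ∀ i, φ i ξ * h ξ = H i ξ := by
    filter_upwards [ae_all_iff.2 fun i => ae_all_iff.2 (hcomp i)] with ξ hξ hξΩ i
    rw [hh]
    simp only
    rw [← tsum_mul_left]
    have h1 : ∀ l, φ i ξ * {ξ | φ l ξ ≠ 0}.indicator (H l) ξ = φ l ξ * H i ξ := by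
      intro l
      by_cases h0 : φ l ξ = 0
      · simp [Set.indicator, h0]
      · rw [Set.indicator_of_mem (by simpa using h0), hξ]
    simp only [h1]
    rw [tsum_mul_right, (hφ.sum_eq_one ξ hξΩ).tsum_eq, one_mul]
  have hloc : LocallyIntegrableOn h Ω volume := by
    intro ξ₀ hξ₀
    obtain ⟨i, hi⟩ := hφ.exists_ne_zero hξ₀
    obtain ⟨t, ht, htH⟩ := hHΩ i ξ₀ hξ₀
    have hW : {ξ | ‖φ i ξ₀‖ / 2 < ‖φ i ξ‖} ∈ nhds ξ₀ :=
      (isOpen_lt continuous_const (φ i).continuous.norm).mem_nhds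
        (by simpa using half_lt_self (norm_pos_iff.2 hi))
    have hWm : MeasurableSet {ξ | ‖φ i ξ₀‖ / 2 < ‖φ i ξ‖} :=
      (isOpen_lt continuous_const (φ i).continuous.norm).measurableSet
    refine ⟨{ξ | ‖φ i ξ₀‖ / 2 < ‖φ i ξ‖} ∩ ((Ω : Set (E d)) ∩ t),
      Filter.inter_mem (mem_nhdsWithin_of_mem_nhds hW)
        (Filter.inter_mem self_mem_nhdsWithin ht), ?_⟩
    have hint : IntegrableOn (fun ξ => (φ i ξ)⁻¹ * H i ξ)
        ({ξ | ‖φ i ξ₀‖ / 2 < ‖φ i ξ‖} ∩ ((Ω : Set (E d)) ∩ t)) := by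
      refine Integrable.bdd_mul (c := (‖φ i ξ₀‖ / 2)⁻¹)
        (htH.mono_set (Set.inter_subset_right.trans Set.inter_subset_right))
        (φ i).continuous.measurable.inv.aestronglyMeasurable ?_
      refine ae_restrict_of_ae_restrict_of_subset Set.inter_subset_left ?_
      refine (ae_restrict_iff' hWm).2 (Filter.Eventually.of_forall fun ξ hξ => ?_)
      rw [norm_inv]
      have h0 : 0 < ‖φ i ξ₀‖ / 2 := half_pos (norm_pos_iff.2 hi)
      exact inv_anti₀ h0 (le_of_lt hξ)
    refine hint.congr_fun_ae ?_
    have h5 : ∀ᵐ ξ ∂(volume.restrict ({ξ | ‖φ i ξ₀‖ / 2 < ‖φ i ξ‖} ∩ (Ω : Set (E d)))),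
        (φ i ξ)⁻¹ * H i ξ = h ξ := by
      refine (ae_restrict_iff' (hWm.inter Ω.isOpen.measurableSet)).2 ?_
      filter_upwards [hglue] with ξ hξ hξm
      rw [← hξ hξm.2 i, inv_mul_cancel_left₀]
      exact norm_pos_iff.1 (lt_trans (half_pos (norm_pos_iff.2 hi)) hξm.1)
    exact ae_restrict_of_ae_restrict_of_subset
      (Set.inter_subset_inter_right _ Set.inter_subset_left) h5
  refine ⟨h, hloc, fun ψ => ?_, ?_⟩
  · obtain ⟨s, hs⟩ := hφ.exists_sum_mulTest hQ ψ
    have h1 : ∀ ψ : 𝓓(Ω, ℂ), ∀ i, f.fourier (mulTest (φ i) (testToSchwartz Ω ψ)) =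
        distrOfFun Ω h (mulTest (φ i) (testToSchwartz Ω ψ)) := by
      intro ψ i
      rw [hH, distrOfFun_apply hloc]
      refine integral_congr_ae ?_
      filter_upwards [hglue] with ξ hξ
      rw [mulTest_apply, testToSchwartz_apply]
      by_cases hξΩ : ξ ∈ Ω
      · rw [← hξ hξΩ i]; ring
      · have h0 : ψ ξ = 0 :=
          image_eq_zero_of_notMem_tsupport fun hx' => hξΩ (ψ.tsupport_subset hx')
        simp [h0]
    rw [← distrOfFun_apply hloc, ← hs, map_sum, map_sum]
    exact Finset.sum_congr rfl fun i _ => h1 ψ i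
  · have hl2 : ∀ i, l2Norm (piece (φ i) f) ^ 2 = ∫⁻ ξ, ‖H i ξ‖ₑ ^ 2 := fun i => by
      rw [l2Norm_piece_eq (hH i), enorm_sq_eq_lintegral]
    calc ∫⁻ ξ in (Ω : Set (E d)), ‖(v ξ : ℂ) * h ξ‖ₑ ^ 2
        ≤ ∫⁻ ξ in (Ω : Set (E d)), N * ∑' i, (ENNReal.ofReal (C₀ * w i) * ‖H i ξ‖ₑ) ^ 2 := by
          refine lintegral_mono fun ξ => ?_
          have h3 : ‖(v ξ : ℂ)‖ₑ = ENNReal.ofReal (v ξ) := by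
            rw [← ofReal_norm, Complex.norm_real, Real.norm_of_nonneg (hv_pos ξ).le]
          have h4 : ‖(v ξ : ℂ) * h ξ‖ₑ ≤
              ∑' i, ENNReal.ofReal (v ξ) * ‖{ξ | φ i ξ ≠ 0}.indicator (H i) ξ‖ₑ := by
            rw [enorm_mul, h3, ENNReal.tsum_mul_left]
            gcongr
            exact enorm_tsum_le_tsum_enorm
          refine (pow_le_pow_left₀ zero_le h4 2).trans
            ((tsum_sq_le_of_encard_le _ N ?_).trans ?_)
          · refine (Set.encard_le_encard fun i hi => ?_).trans (hN ξ)
            by_contra h0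
            refine hi ?_
            simp [Set.indicator, not_not.1 h0]
          · refine mul_le_mul_right
              (ENNReal.tsum_le_tsum fun i => pow_le_pow_left₀ zero_le ?_ 2) _
            by_cases h0 : φ i ξ = 0
            · simp [Set.indicator, h0]
            · rw [Set.indicator_of_mem (by simpa using h0)]
              refine mul_le_mul_left (ENNReal.ofReal_le_ofReal ?_) _
              exact hvw i ξ (hφ.mem_of_ne_zero h0)
      _ ≤ ∫⁻ ξ, N * ∑' i, (ENNReal.ofReal (C₀ * w i) * ‖H i ξ‖ₑ) ^ 2 :=
          lintegral_mono' Measure.restrict_le_self le_rfl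
      _ = N * ∑' i, (ENNReal.ofReal (C₀ * w i)) ^ 2 * ∫⁻ ξ, ‖H i ξ‖ₑ ^ 2 := by
          rw [lintegral_const_mul' _ _ (by simp), lintegral_tsum fun i =>
            ((Lp.aestronglyMeasurable (H i)).enorm.const_mul _).pow_const 2]
          congr 2 with i
          simp only [mul_pow]
          rw [lintegral_const_mul' _ _ (by simp)]
      _ = _ := by
          have h5 : ∀ i, (ENNReal.ofReal (C₀ * w i)) ^ 2 * ∫⁻ ξ, ‖H i ξ‖ₑ ^ 2 =
              (Real.toNNReal C₀ : ℝ≥0∞) ^ 2 *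
                (ENNReal.ofReal (w i) * l2Norm (piece (φ i) f)) ^ 2 := by
            intro i
            rw [ENNReal.ofReal_mul' (hw i).le, mul_pow, mul_pow, hl2, mul_assoc]
            rfl
          simp only [h5]
          rw [ENNReal.tsum_mul_left]
          push_cast
          ring

theorem weightedL2Norm_eq {u : Distr Ω} {h : E d → ℂ} (hh : LocallyIntegrableOn h Ω volume)
    (hu : ∀ ψ, u ψ = ∫ ξ, ψ ξ * h ξ) :
    weightedL2Norm v u = eLpNorm (fun ξ => (v ξ : ℂ) * h ξ) 2 (volume.restrict Ω) := by
  refine le_antisymm (iInf₂_le (f := fun (h : E d → ℂ) _ =>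
    eLpNorm (fun ξ => (v ξ : ℂ) * h ξ) 2 (volume.restrict Ω)) h
      ⟨hh, fun ψ => by rw [setIntegral_test_mul, hu]⟩) (le_iInf₂ fun k hk => le_of_eq ?_)
  have h1 := ae_eq_of_forall_test hh hk.1 fun ψ => by
    rw [← hu, hk.2, setIntegral_test_mul]
  refine eLpNorm_congr_ae ((ae_restrict_iff' Ω.isOpen.measurableSet).2 ?_)
  filter_upwards [h1] with ξ hξ hξΩ
  rw [hξ hξΩ]

theorem decompNorm_sq (f : FourierDistr Ω) :
    decompNorm φ w f ^ 2 = ∑' i, (ENNReal.ofReal (w i) * l2Norm (piece (φ i) f)) ^ 2 := by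
  rw [decompNorm, ← ENNReal.rpow_natCast, ← ENNReal.rpow_mul]
  norm_num

theorem le_mul_of_sq_le {a b : ℝ≥0∞} {K : ℝ≥0} (h : a ^ 2 ≤ K * b ^ 2) :
    a ≤ NNReal.sqrt K * b := by
  have h1 : (NNReal.sqrt K : ℝ≥0∞) ^ 2 = K := by
    rw [← ENNReal.coe_pow, NNReal.sq_sqrt]
  refine (ENNReal.pow_le_pow_left_iff (n := 2) (by norm_num)).1 ?_
  rwa [mul_pow, h1]

/-- The norm of the decomposition space is equivalent to the norm of `L^2_v(Ω)`. -/
theorem exists_norm_equivalence (hφ : IsBAPU Ω Q φ) (hQ : IsAdmissibleCover Ω Q)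
    (hw : ∀ i, 0 < w i) (hv_meas : Measurable v) (hv_pos : ∀ ξ, 0 < v ξ) {C₀ : ℝ}
    (hvw : ∀ i, ∀ ξ ∈ Q i, v ξ ≤ C₀ * w i ∧ w i ≤ C₀ * v ξ) :
    ∃ C : ℝ≥0, ∀ f : FourierDistr Ω,
      decompNorm φ w f ≤ C * weightedL2Norm v f.fourier ∧
      weightedL2Norm v f.fourier ≤ C * decompNorm φ w f := by
  obtain ⟨K, hK⟩ := tsum_l2Norm_piece_le hφ hQ hw hv_meas hv_pos fun i ξ hξ => (hvw i ξ hξ).2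
  obtain ⟨K', hK'⟩ := exists_fun_of_tsum_l2Norm_piece hφ hQ hw hv_pos fun i ξ hξ =>
    (hvw i ξ hξ).1
  refine ⟨NNReal.sqrt K + NNReal.sqrt K' + 1, fun f => ⟨?_, ?_⟩⟩
  · by_cases hrep : ∃ h : E d → ℂ, LocallyIntegrableOn h Ω volume ∧
        ∀ ψ, f.fourier ψ = ∫ ξ, ψ ξ * h ξ
    · obtain ⟨h, hh, hf⟩ := hrep
      rw [weightedL2Norm_eq hh hf]
      refine (le_mul_of_sq_le (K := K) ?_).trans (mul_le_mul_left ?_ _)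
      · rw [decompNorm_sq, eLpNorm_two_sq]
        exact hK f h hh hf
      · exact_mod_cast (le_self_add.trans le_self_add)
    · have : weightedL2Norm v f.fourier = ⊤ := by
        refine iInf₂_eq_top.2 fun h hh => ?_
        exact absurd ⟨h, hh.1, fun ψ => by rw [hh.2, setIntegral_test_mul]⟩ hrep
      rw [this, ENNReal.mul_top (by simp)]
      exact le_top
  · by_cases htop : decompNorm φ w f = ⊤
    · rw [htop, ENNReal.mul_top (by simp)]
      exact le_top
    obtain ⟨h, hh, hf, hle⟩ := hK' f (by rw [← decompNorm_sq]; exact ENNReal.pow_ne_top htop)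
    rw [weightedL2Norm_eq hh hf]
    refine (le_mul_of_sq_le (K := K') ?_).trans (mul_le_mul_left ?_ _)
    · rw [decompNorm_sq, eLpNorm_two_sq]
      exact hle
    · exact_mod_cast (le_add_self.trans le_self_add)

/-- The weight `v` is bounded above and below on compact subsets of `Ω`. -/
theorem exists_weight_le (hφ : IsBAPU Ω Q φ) (hQ : IsAdmissibleCover Ω Q)
    (hw : ∀ i, 0 < w i) (hv_pos : ∀ ξ, 0 < v ξ) {C₀ : ℝ}
    (hvw : ∀ i, ∀ ξ ∈ Q i, v ξ ≤ C₀ * w i ∧ w i ≤ C₀ * v ξ) {K : Set (E d)}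
    (hK : IsCompact K) (hKΩ : K ⊆ Ω) : ∃ M : ℝ, ∀ ξ ∈ K, v ξ ≤ M ∧ (v ξ)⁻¹ ≤ M := by
  have hfin := hφ.finite_of_isCompact hQ hK hKΩ
  obtain ⟨M₁, hM₁⟩ := (hfin.image fun i => C₀ * w i).bddAbove
  obtain ⟨M₂, hM₂⟩ := (hfin.image fun i => C₀ * (w i)⁻¹).bddAbove
  refine ⟨max M₁ M₂, fun ξ hξ => ?_⟩
  obtain ⟨i, hi⟩ := hφ.exists_ne_zero (hKΩ hξ)
  have hv := hvw i ξ (hφ.mem_of_ne_zero hi)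
  refine ⟨(hv.1.trans (hM₁ ⟨i, ⟨ξ, hξ, hi⟩, rfl⟩)).trans (le_max_left _ _),
    (le_trans ?_ (hM₂ ⟨i, ⟨ξ, hξ, hi⟩, rfl⟩)).trans (le_max_right _ _)⟩
  change (v ξ)⁻¹ ≤ C₀ * (w i)⁻¹
  rw [← div_eq_mul_inv, le_div_iff₀ (hw i), inv_mul_le_iff₀ (hv_pos ξ), mul_comm]
  exact hv.2

end NormEquivalence

/-! ### Weighted test functions -/

section WeightedTest

variable {v : E d → ℝ}

theorem memLp_weight_mul_test (hv_meas : Measurable v) (hv_pos : ∀ ξ, 0 < v ξ)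
    (hvb : ∀ K : Set (E d), IsCompact K → K ⊆ Ω → ∃ M : ℝ, ∀ ξ ∈ K, v ξ ≤ M) (ψ : 𝓓(Ω, ℂ)) :
    MemLp (fun ξ => (v ξ : ℂ) * ψ ξ) 2 volume := by
  obtain ⟨M, hM⟩ := hvb _ ψ.hasCompactSupport ψ.tsupport_subset
  have hψ : MemLp ψ 2 volume := ψ.continuous.memLp_of_hasCompactSupport ψ.hasCompactSupport
  refine hψ.of_le_mul (c := M)
    ((Complex.measurable_ofReal.comp hv_meas).aestronglyMeasurable.mul ψ.aestronglyMeasurable)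
    (Filter.Eventually.of_forall fun ξ => ?_)
  by_cases hξ : ξ ∈ tsupport ψ
  · rw [norm_mul, Complex.norm_real, Real.norm_of_nonneg (hv_pos ξ).le]
    exact mul_le_mul_of_nonneg_right (hM ξ hξ) (norm_nonneg _)
  · simp [image_eq_zero_of_notMem_tsupport hξ]

/-- The map `ψ ↦ v ψ` from test functions to `L^2`. -/
def weightedTest (v : E d → ℝ) (hv : ∀ ψ : 𝓓(Ω, ℂ), MemLp (fun ξ => (v ξ : ℂ) * ψ ξ) 2 volume) :
    𝓓(Ω, ℂ) →ₗ[ℂ] Lp ℂ 2 (volume : Measure (E d)) where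
  toFun ψ := (hv ψ).toLp
  map_add' ψ χ := by
    rw [← MemLp.toLp_add]
    exact MemLp.toLp_congr _ _ (Filter.Eventually.of_forall fun ξ => mul_add _ _ _)
  map_smul' c ψ := by
    rw [← MemLp.toLp_const_smul]
    exact MemLp.toLp_congr _ _ (Filter.Eventually.of_forall fun ξ => mul_left_comm _ _ _)

theorem coeFn_weightedTest (hv : ∀ ψ : 𝓓(Ω, ℂ), MemLp (fun ξ => (v ξ : ℂ) * ψ ξ) 2 volume)
    (ψ : 𝓓(Ω, ℂ)) : weightedTest v hv ψ =ᵐ[volume] fun ξ => (v ξ : ℂ) * ψ ξ :=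
  (hv ψ).coeFn_toLp

theorem locallyIntegrableOn_weight_mul {c : E d → ℝ} (hc : Measurable c) (hc_pos : ∀ ξ, 0 < c ξ)
    (hcb : ∀ K : Set (E d), IsCompact K → K ⊆ Ω → ∃ M : ℝ, ∀ ξ ∈ K, c ξ ≤ M)
    (F : Lp ℂ 2 (volume : Measure (E d))) :
    LocallyIntegrableOn (fun ξ => (c ξ : ℂ) * F ξ) Ω volume := by
  refine (locallyIntegrableOn_iff Ω.isOpen.isLocallyClosed).2 fun K hKΩ hK => ?_
  obtain ⟨M, hM⟩ := hcb K hK hKΩ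
  refine Integrable.bdd_mul (c := M)
    ((Lp.locallyIntegrableOn F Ω).integrableOn_compact_subset hKΩ hK)
    (Complex.measurable_ofReal.comp hc).aestronglyMeasurable ?_
  refine (ae_restrict_iff' hK.measurableSet).2 (Filter.Eventually.of_forall fun ξ hξ => ?_)
  rw [Complex.norm_real, Real.norm_of_nonneg (hc_pos ξ).le]
  exact hM ξ hξ

/-- The functions `v ψ`, with `ψ` a test function on the set `Ω` of full measure, are dense
in `L^2`. -/
theorem dense_range_weightedTest (hΩ : volume ((Ω : Set (E d))ᶜ) = 0) (hv_meas : Measurable v)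
    (hv_pos : ∀ ξ, 0 < v ξ)
    (hvb : ∀ K : Set (E d), IsCompact K → K ⊆ Ω → ∃ M : ℝ, ∀ ξ ∈ K, v ξ ≤ M)
    (hv : ∀ ψ : 𝓓(Ω, ℂ), MemLp (fun ξ => (v ξ : ℂ) * ψ ξ) 2 volume) :
    DenseRange (weightedTest v hv) := by
  have h0 : (LinearMap.range (weightedTest v hv))ᗮ = ⊥ := by
    rw [Submodule.eq_bot_iff]
    intro F hF
    have hF' : ∀ ψ : 𝓓(Ω, ℂ), ∫ ξ, ψ ξ * ((v ξ : ℂ) * (star F) ξ) = 0 := by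
      intro ψ
      have h1 := (Submodule.mem_orthogonal' _ _).1 hF _ (LinearMap.mem_range_self _ ψ)
      rw [L2.inner_def] at h1
      rw [← h1]
      refine integral_congr_ae ?_
      filter_upwards [coeFn_weightedTest hv ψ, Lp.coeFn_star F] with ξ h2 h3
      rw [h2, h3, RCLike.inner_apply, Pi.star_apply, RCLike.star_def]
      ring
    have h4 := ae_eq_zero_of_forall_test
      (locallyIntegrableOn_weight_mul hv_meas hv_pos hvb (star F)) hF'
    have h5 : ∀ᵐ ξ : E d, ξ ∈ Ω := by rw [ae_iff]; exact hΩ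
    refine (Lp.eq_zero_iff_ae_eq_zero).2 ?_
    filter_upwards [h4, h5, Lp.coeFn_star F] with ξ h6 h7 h8
    have h9 := h6 h7
    rw [h8, Pi.star_apply, mul_eq_zero, or_iff_right (by exact_mod_cast (hv_pos ξ).ne')] at h9
    simpa using h9
  have h1 := (Submodule.topologicalClosure_eq_top_iff).2 h0
  rw [← Submodule.dense_iff_topologicalClosure_eq_top] at h1
  exact h1

end WeightedTest

/-! ### The decomposition space as a weighted `L^2` space -/

section Isomorphism

variable {φ : I → 𝓓(Ω, ℂ)} {w : I → ℝ} {v : E d → ℝ}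

theorem locallyIntegrableOn_inv_weight_mul (hv_meas : Measurable v) (hv_pos : ∀ ξ, 0 < v ξ)
    (hvb : ∀ K : Set (E d), IsCompact K → K ⊆ Ω → ∃ M : ℝ, ∀ ξ ∈ K, v ξ ≤ M ∧ (v ξ)⁻¹ ≤ M)
    (F : Lp ℂ 2 (volume : Measure (E d))) :
    LocallyIntegrableOn (fun ξ => (v ξ : ℂ)⁻¹ * F ξ) Ω volume := by
  have := locallyIntegrableOn_weight_mul (Ω := Ω) (c := fun ξ => (v ξ)⁻¹) hv_meas.inv
    (fun ξ => inv_pos.2 (hv_pos ξ)) (fun K hK hKΩ =>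
      (hvb K hK hKΩ).imp fun M hM ξ hξ => (hM ξ hξ).2) F
  simpa using this

/-- The Fourier distribution `𝓕⁻¹ (F / v)` with `F ∈ L^2`, as a linear map. -/
def ofWeighted (hv_meas : Measurable v) (hv_pos : ∀ ξ, 0 < v ξ)
    (hvb : ∀ K : Set (E d), IsCompact K → K ⊆ Ω → ∃ M : ℝ, ∀ ξ ∈ K, v ξ ≤ M ∧ (v ξ)⁻¹ ≤ M) :
    Lp ℂ 2 (volume : Measure (E d)) →ₗ[ℂ] FourierDistr Ω :=
  (fourierEquiv Ω).symm.toLinearMap ∘ₗ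
    { toFun F := distrOfFun Ω fun ξ => (v ξ : ℂ)⁻¹ * F ξ
      map_add' F F' := by
        ext ψ
        have hF := locallyIntegrableOn_inv_weight_mul hv_meas hv_pos hvb
        rw [add_apply, distrOfFun_apply (hF _), distrOfFun_apply (hF _),
          distrOfFun_apply (hF _), ← integral_add (integrable_test_mul ψ (hF _))
            (integrable_test_mul ψ (hF _))]
        refine integral_congr_ae ?_
        filter_upwards [Lp.coeFn_add F F'] with ξ hξ
        rw [hξ, Pi.add_apply]
        ring
      map_smul' c F := by
        ext ψ
        have hF := locallyIntegrableOn_inv_weight_mul hv_meas hv_pos hvb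
        rw [smul_apply, distrOfFun_apply (hF _), distrOfFun_apply (hF _),
          smul_eq_mul, RingHom.id_apply, ← integral_const_mul]
        refine integral_congr_ae ?_
        filter_upwards [Lp.coeFn_smul c F] with ξ hξ
        rw [hξ, Pi.smul_apply, smul_eq_mul]
        ring }

theorem ofWeighted_fourier (hv_meas : Measurable v) (hv_pos : ∀ ξ, 0 < v ξ)
    (hvb : ∀ K : Set (E d), IsCompact K → K ⊆ Ω → ∃ M : ℝ, ∀ ξ ∈ K, v ξ ≤ M ∧ (v ξ)⁻¹ ≤ M)
    (F : Lp ℂ 2 (volume : Measure (E d))) (ψ : 𝓓(Ω, ℂ)) :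
    (ofWeighted hv_meas hv_pos hvb F).fourier ψ = ∫ ξ, ψ ξ * ((v ξ : ℂ)⁻¹ * F ξ) := by
  have h1 : (ofWeighted hv_meas hv_pos hvb F).fourier =
      distrOfFun Ω fun ξ => (v ξ : ℂ)⁻¹ * F ξ := fourier_fourierEquiv_symm _
  rw [h1, distrOfFun_apply (locallyIntegrableOn_inv_weight_mul hv_meas hv_pos hvb F)]

theorem weightedL2Norm_ofWeighted (hΩ : volume ((Ω : Set (E d))ᶜ) = 0)
    (hv_meas : Measurable v) (hv_pos : ∀ ξ, 0 < v ξ)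
    (hvb : ∀ K : Set (E d), IsCompact K → K ⊆ Ω → ∃ M : ℝ, ∀ ξ ∈ K, v ξ ≤ M ∧ (v ξ)⁻¹ ≤ M)
    (F : Lp ℂ 2 (volume : Measure (E d))) :
    weightedL2Norm v (ofWeighted hv_meas hv_pos hvb F).fourier = ‖F‖ₑ := by
  rw [weightedL2Norm_eq (locallyIntegrableOn_inv_weight_mul hv_meas hv_pos hvb F)
    (ofWeighted_fourier hv_meas hv_pos hvb F), restrict_eq_self_of_compl_null hΩ, Lp.enorm_def]
  congr 1
  ext ξ
  rw [mul_inv_cancel_left₀ (by exact_mod_cast (hv_pos ξ).ne')]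

/-- The weighted `L^2` space model: `F ↦ 𝓕⁻¹ (F / v)` is an isomorphism of `L^2` onto the
decomposition space, with equivalence of norms. -/
theorem exists_equiv_decompSpace (hΩ : volume ((Ω : Set (E d))ᶜ) = 0)
    (hv_meas : Measurable v) (hv_pos : ∀ ξ, 0 < v ξ)
    (hvb : ∀ K : Set (E d), IsCompact K → K ⊆ Ω → ∃ M : ℝ, ∀ ξ ∈ K, v ξ ≤ M ∧ (v ξ)⁻¹ ≤ M)
    {C : ℝ≥0} (hC : ∀ f : FourierDistr Ω,
      decompNorm φ w f ≤ C * weightedL2Norm v f.fourier ∧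
      weightedL2Norm v f.fourier ≤ C * decompNorm φ w f) :
    ∃ Ψ : Lp ℂ 2 (volume : Measure (E d)) ≃ₗ[ℂ] DecompSpace φ w,
      (∀ F ψ, (Ψ F : FourierDistr Ω).fourier ψ = ∫ ξ, ψ ξ * ((v ξ : ℂ)⁻¹ * F ξ)) ∧
      ∀ F, decompNorm φ w (Ψ F) ≤ C * ‖F‖ₑ ∧ ‖F‖ₑ ≤ C * decompNorm φ w (Ψ F) := by
  set T := ofWeighted (Ω := Ω) hv_meas hv_pos hvb with hT
  have hmem : ∀ F, T F ∈ DecompSpace φ w := fun F =>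
    (hC (T F)).1.trans_lt (by
      rw [weightedL2Norm_ofWeighted hΩ]
      exact ENNReal.mul_lt_top ENNReal.coe_lt_top enorm_lt_top)
  have hinj : Function.Injective T := by
    rw [injective_iff_map_eq_zero]
    intro F hF
    have h1 := weightedL2Norm_ofWeighted hΩ hv_meas hv_pos hvb F
    rw [← hT, hF] at h1
    have h2 := weightedL2Norm_ofWeighted hΩ hv_meas hv_pos hvb 0
    rw [← hT, map_zero, h1] at h2
    simpa using h2
  refine ⟨LinearEquiv.ofBijective (T.codRestrict (DecompSpace φ w) hmem)
    ⟨fun F F' h => hinj (congrArg Subtype.val h), fun f => ?_⟩, fun F ψ => ?_, fun F => ?_⟩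
  · have h1 : weightedL2Norm v (f : FourierDistr Ω).fourier < ⊤ :=
      (hC f).2.trans_lt (ENNReal.mul_lt_top ENNReal.coe_lt_top f.2)
    obtain ⟨h, hh, hlt⟩ : ∃ h : E d → ℂ, (LocallyIntegrableOn h Ω volume ∧
        ∀ ψ : 𝓓(Ω, ℂ), (f : FourierDistr Ω).fourier ψ = ∫ ξ in (Ω : Set (E d)), ψ ξ * h ξ) ∧
        eLpNorm (fun ξ => (v ξ : ℂ) * h ξ) 2 (volume.restrict Ω) < ⊤ := by
      simpa only [weightedL2Norm, iInf_lt_iff, exists_prop] using h1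
    have hL : MemLp (fun ξ => (v ξ : ℂ) * h ξ) 2 volume := by
      have h2 := hh.1.aestronglyMeasurable
      rw [restrict_eq_self_of_compl_null hΩ] at hlt h2
      exact ⟨(Complex.measurable_ofReal.comp hv_meas).aestronglyMeasurable.mul h2, hlt⟩
    refine ⟨hL.toLp, Subtype.ext ((fourierEquiv Ω).injective ?_)⟩
    refine ContinuousLinearMap.ext fun ψ => ?_
    change (T hL.toLp).fourier ψ = _
    rw [ofWeighted_fourier, fourierEquiv_apply, hh.2, setIntegral_test_mul]
    refine integral_congr_ae ?_
    filter_upwards [hL.coeFn_toLp] with ξ hξ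
    rw [hξ, inv_mul_cancel_left₀ (by exact_mod_cast (hv_pos ξ).ne')]
  · exact ofWeighted_fourier hv_meas hv_pos hvb F ψ
  · have h1 := hC (T F)
    rw [weightedL2Norm_ofWeighted hΩ] at h1
    exact h1

/-- The function `𝓕⁻¹ ψ` in `𝓢_Ω`, as an element of `L^2`. -/
def invFourierTest (ψ : 𝓓(Ω, ℂ)) : Lp ℂ 2 (volume : Measure (E d)) :=
  (𝓕⁻ (testToSchwartz Ω ψ)).toLp 2

theorem exists_invFourierTest_eq {f : 𝓢(E d, ℂ)} (hf : f ∈ SchwartzOn Ω) :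
    ∃ ψ : 𝓓(Ω, ℂ), f.toLp 2 = invFourierTest ψ := by
  obtain ⟨ψ, rfl⟩ := hf
  exact ⟨ψ, rfl⟩

theorem coeFn_invFourierTest (ψ : 𝓓(Ω, ℂ)) :
    invFourierTest ψ =ᵐ[volume] 𝓕⁻ (ψ : E d → ℂ) := by
  filter_upwards [SchwartzMap.coeFn_toLp (𝓕⁻ (testToSchwartz Ω ψ)) 2 volume] with x hx
  rw [invFourierTest, hx, SchwartzMap.fourierInv_coe]
  rfl

theorem coeFn_fourier_invFourierTest (ψ : 𝓓(Ω, ℂ)) :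
    (𝓕 (invFourierTest ψ) : Lp ℂ 2 (volume : Measure (E d))) =ᵐ[volume] ψ := by
  rw [invFourierTest, SchwartzMap.toLp_fourier_eq, fourier_fourierInv_eq]
  exact SchwartzMap.coeFn_toLp _ _ _

/-- Elements of `𝓢_Ω` correspond to the weighted test functions `v ψ`. -/
theorem equiv_weightedTest_eq_ofL2 (hv_pos : ∀ ξ, 0 < v ξ)
    {Ψ : Lp ℂ 2 (volume : Measure (E d)) ≃ₗ[ℂ] DecompSpace φ w}
    (hΨ : ∀ F ψ, (Ψ F : FourierDistr Ω).fourier ψ = ∫ ξ, ψ ξ * ((v ξ : ℂ)⁻¹ * F ξ))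
    (hv : ∀ ψ : 𝓓(Ω, ℂ), MemLp (fun ξ => (v ξ : ℂ) * ψ ξ) 2 volume) (ψ : 𝓓(Ω, ℂ)) :
    (Ψ (weightedTest v hv ψ) : FourierDistr Ω) = ofL2 Ω (invFourierTest ψ) := by
  refine (fourierEquiv Ω).injective (ContinuousLinearMap.ext fun χ => ?_)
  rw [fourierEquiv_apply, fourierEquiv_apply, hΨ, ofL2_fourier_apply]
  refine integral_congr_ae ?_
  filter_upwards [coeFn_weightedTest hv ψ, coeFn_fourier_invFourierTest ψ] with ξ h1 h2
  rw [h1, h2, inv_mul_cancel_left₀ (by exact_mod_cast (hv_pos ξ).ne')]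

end Isomorphism

/-! ### Schur's test for sums of weighted translations -/

section Schur

theorem ae_comp_add {p : E d → Prop} (h : ∀ᵐ ξ, p ξ) (a : E d) : ∀ᵐ ξ : E d, p (ξ + a) :=
  (measurePreserving_add_right volume a).quasiMeasurePreserving.ae h

theorem aestronglyMeasurable_comp_add {F : E d → ℂ} (h : AEStronglyMeasurable F volume)
    (a : E d) : AEStronglyMeasurable (fun ξ => F (ξ + a)) volume :=
  h.comp_quasiMeasurePreserving (measurePreserving_add_right volume a).quasiMeasurePreserving

/-- The Cauchy-Schwarz inequality for series with nonnegative weights. -/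
theorem tsum_mul_sq_le {ι : Type*} (b f : ι → ℝ≥0∞) :
    (∑' i, b i * f i) ^ 2 ≤ (∑' i, b i) * ∑' i, b i * f i ^ 2 := by
  let _ : MeasurableSpace ι := ⊤
  have key := ENNReal.lintegral_mul_norm_pow_le (α := ι) (μ := Measure.count) (f := b)
    (g := fun i => b i * f i ^ 2) measurable_from_top.aemeasurable
    measurable_from_top.aemeasurable (p := 1 / 2) (q := 1 / 2) (by norm_num) (by norm_num)
    (by norm_num)
  simp only [lintegral_count] at key
  have h1 : ∀ i, b i ^ (1 / 2 : ℝ) * (b i * f i ^ 2) ^ (1 / 2 : ℝ) = b i * f i := by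
    intro i
    rw [← ENNReal.mul_rpow_of_nonneg _ _ (by norm_num), ← mul_assoc, ← sq, ← mul_pow,
      ← ENNReal.rpow_natCast, ← ENNReal.rpow_mul]
    norm_num
  simp only [h1] at key
  refine (pow_le_pow_left₀ zero_le key 2).trans (le_of_eq ?_)
  rw [mul_pow, ← ENNReal.rpow_natCast, ← ENNReal.rpow_natCast, ← ENNReal.rpow_mul,
    ← ENNReal.rpow_mul]
  norm_num

variable {ι : Type*} [Countable ι] {a : ι → E d} {k : ι → E d → ℂ} {b : ι → E d → ℝ≥0∞} {δ : ℝ≥0}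

/-- Schur's test: the rows and columns of the kernel `b` are bounded by `δ`. -/
theorem lintegral_tsum_sq_le (hb : ∀ i, AEMeasurable (b i) volume)
    (hrow : ∀ᵐ ξ, ∑' i, b i ξ ≤ δ) (hcol : ∀ᵐ ξ, ∑' i, b i (ξ - a i) ≤ δ)
    {F : E d → ℂ} (hF : AEStronglyMeasurable F volume) :
    ∫⁻ ξ, (∑' i, b i ξ * ‖F (ξ + a i)‖ₑ) ^ 2 ≤ δ ^ 2 * ∫⁻ ξ, ‖F ξ‖ₑ ^ 2 := by
  have hb' : ∀ i, AEMeasurable (fun ξ => b i (ξ - a i)) volume := fun i =>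
    (hb i).comp_quasiMeasurePreserving
      (measurePreserving_sub_right volume (a i)).quasiMeasurePreserving
  calc ∫⁻ ξ, (∑' i, b i ξ * ‖F (ξ + a i)‖ₑ) ^ 2
      ≤ ∫⁻ ξ, δ * ∑' i, b i ξ * ‖F (ξ + a i)‖ₑ ^ 2 := by
        refine lintegral_mono_ae ?_
        filter_upwards [hrow] with ξ hξ
        exact (tsum_mul_sq_le _ _).trans (mul_le_mul_left hξ _)
    _ = δ * ∑' i, ∫⁻ ξ, b i ξ * ‖F (ξ + a i)‖ₑ ^ 2 := by
        rw [lintegral_const_mul' _ _ ENNReal.coe_ne_top, lintegral_tsum]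
        exact fun i => (hb i).mul ((aestronglyMeasurable_comp_add hF (a i)).enorm.pow_const 2)
    _ = δ * ∑' i, ∫⁻ ξ, b i (ξ - a i) * ‖F ξ‖ₑ ^ 2 := by
        congr 2 with i
        rw [← lintegral_add_right_eq_self (μ := volume)
          (fun ξ => b i (ξ - a i) * ‖F ξ‖ₑ ^ 2) (a i)]
        simp
    _ = δ * ∫⁻ ξ, ∑' i, b i (ξ - a i) * ‖F ξ‖ₑ ^ 2 := by
        rw [lintegral_tsum]
        exact fun i => (hb' i).mul (hF.enorm.pow_const 2)
    _ ≤ δ * ∫⁻ ξ, δ * ‖F ξ‖ₑ ^ 2 := by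
        gcongr 1
        refine lintegral_mono_ae ?_
        filter_upwards [hcol] with ξ hξ
        rw [ENNReal.tsum_mul_right]
        exact mul_le_mul_left hξ _
    _ = δ ^ 2 * ∫⁻ ξ, ‖F ξ‖ₑ ^ 2 := by
        rw [lintegral_const_mul' _ _ ENNReal.coe_ne_top, sq, mul_assoc]

theorem ae_summable_kernel (hb : ∀ i, AEMeasurable (b i) volume)
    (hkb : ∀ i ξ, ‖k i ξ‖ₑ ≤ b i ξ)
    (hrow : ∀ᵐ ξ, ∑' i, b i ξ ≤ δ) (hcol : ∀ᵐ ξ, ∑' i, b i (ξ - a i) ≤ δ)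
    (F : Lp ℂ 2 (volume : Measure (E d))) :
    ∀ᵐ ξ, Summable fun i => ‖k i ξ * F (ξ + a i)‖ := by
  have h1 := lintegral_tsum_sq_le hb hrow hcol (Lp.aestronglyMeasurable F)
  have h2 : ∫⁻ ξ, (∑' i, b i ξ * ‖F (ξ + a i)‖ₑ) ^ 2 ≠ ⊤ := by
    refine ne_top_of_le_ne_top ?_ h1
    rw [← enorm_sq_eq_lintegral]
    finiteness
  have h3 : AEMeasurable (fun ξ => (∑' i, b i ξ * ‖F (ξ + a i)‖ₑ) ^ 2) volume :=
    (AEMeasurable.tsum fun i => (hb i).mul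
      (aestronglyMeasurable_comp_add (Lp.aestronglyMeasurable F) (a i)).enorm).pow_const 2
  filter_upwards [ae_lt_top' h3 h2] with ξ hξ
  refine tsum_enorm_ne_top_iff_summable_norm.1 (ne_top_of_le_ne_top
    (b := ∑' i, b i ξ * ‖F (ξ + a i)‖ₑ) ?_ (ENNReal.tsum_le_tsum fun i => ?_))
  · intro h
    rw [h] at hξ
    simp at hξ
  · rw [enorm_mul]
    exact mul_le_mul_left (hkb i ξ) _

/-- The operator `F ↦ ∑ i, k i · F (· + a i)` is bounded on `L^2` if its kernel passes
Schur's test. -/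
theorem exists_schur_operator (hk : ∀ i, AEStronglyMeasurable (k i) volume)
    (hb : ∀ i, AEMeasurable (b i) volume) (hkb : ∀ i ξ, ‖k i ξ‖ₑ ≤ b i ξ)
    (hrow : ∀ᵐ ξ, ∑' i, b i ξ ≤ δ) (hcol : ∀ᵐ ξ, ∑' i, b i (ξ - a i) ≤ δ) :
    ∃ R : Lp ℂ 2 (volume : Measure (E d)) →L[ℂ] Lp ℂ 2 (volume : Measure (E d)),
      ‖R‖ ≤ δ ∧ ∀ F, R F =ᵐ[volume] fun ξ => ∑' i, k i ξ * F (ξ + a i) := by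
  have hsum := ae_summable_kernel hb hkb hrow hcol (k := k)
  have hmeas : ∀ F : Lp ℂ 2 (volume : Measure (E d)),
      AEStronglyMeasurable (fun ξ => ∑' i, k i ξ * F (ξ + a i)) volume := by
    intro F
    refine aestronglyMeasurable_of_tendsto_ae (Filter.atTop : Filter (Finset ι))
      (f := fun s ξ => ∑ i ∈ s, k i ξ * F (ξ + a i)) (fun s => ?_) ?_
    · exact s.aestronglyMeasurable_fun_sum fun i _ =>
        (hk i).mul (aestronglyMeasurable_comp_add (Lp.aestronglyMeasurable F) (a i))
    · filter_upwards [hsum F] with ξ hξ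
      exact hξ.of_norm.hasSum
  have hnorm : ∀ F : Lp ℂ 2 (volume : Measure (E d)),
      eLpNorm (fun ξ => ∑' i, k i ξ * F (ξ + a i)) 2 volume ≤ δ * ‖F‖ₑ := by
    intro F
    refine (ENNReal.pow_le_pow_left_iff (n := 2) (by norm_num)).1 ?_
    rw [eLpNorm_two_sq, mul_pow, enorm_sq_eq_lintegral]
    refine le_trans (lintegral_mono fun ξ => ?_)
      (lintegral_tsum_sq_le hb hrow hcol (Lp.aestronglyMeasurable F))
    refine pow_le_pow_left₀ zero_le (enorm_tsum_le_tsum_enorm.trans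
      (ENNReal.tsum_le_tsum fun i => ?_)) 2
    rw [enorm_mul]
    exact mul_le_mul_left (hkb i ξ) _
  have hL : ∀ F : Lp ℂ 2 (volume : Measure (E d)),
      MemLp (fun ξ => ∑' i, k i ξ * F (ξ + a i)) 2 volume := fun F =>
    ⟨hmeas F, (hnorm F).trans_lt (ENNReal.mul_lt_top ENNReal.coe_lt_top enorm_lt_top)⟩
  let R : Lp ℂ 2 (volume : Measure (E d)) →ₗ[ℂ] Lp ℂ 2 (volume : Measure (E d)) :=
    { toFun F := (hL F).toLp
      map_add' F F' := by
        rw [← MemLp.toLp_add]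
        refine MemLp.toLp_congr _ _ ?_
        filter_upwards [hsum F, hsum F',
          ae_all_iff.2 fun i => ae_comp_add (Lp.coeFn_add F F') (a i)] with ξ h1 h2 h3
        rw [Pi.add_apply, ← h1.of_norm.tsum_add h2.of_norm]
        exact tsum_congr fun i => by rw [h3, Pi.add_apply, mul_add]
      map_smul' c F := by
        rw [RingHom.id_apply, ← MemLp.toLp_const_smul]
        refine MemLp.toLp_congr _ _ ?_
        filter_upwards [ae_all_iff.2 fun i => ae_comp_add (Lp.coeFn_smul c F) (a i)] with ξ h3
        rw [Pi.smul_apply, smul_eq_mul, ← tsum_mul_left]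
        exact tsum_congr fun i => by rw [h3, Pi.smul_apply, smul_eq_mul, mul_left_comm] }
  have hR : ∀ F, ‖R F‖ ≤ δ * ‖F‖ := by
    intro F
    have h1 : ‖R F‖ₑ ≤ δ * ‖F‖ₑ := by
      change ‖(hL F).toLp‖ₑ ≤ _
      rw [Lp.enorm_toLp]
      exact hnorm F
    have h2 := ENNReal.toReal_mono (by finiteness) h1
    simpa using h2
  exact ⟨R.mkContinuous δ hR, R.mkContinuous_norm_le δ.2 hR, fun F => (hL F).coeFn_toLp⟩

end Schur

/-! ### Parseval's identity for a lattice -/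

section Periodization

/-- The integer vector `m` as a point of `ℝ^d`. -/
def intVec (m : Fin d → ℤ) : Fin d → ℝ := fun i => m i

theorem intVec_add (l m : Fin d → ℤ) : intVec (l + m) = intVec l + intVec m := by
  ext i; simp [intVec]

/-- The unit cube `(0, 1]^d`. -/
def unitCube (d : ℕ) : Set (Fin d → ℝ) := {x | ∀ i, x i ∈ Set.Ioc (0 : ℝ) (0 + 1)}

theorem measurableSet_unitCube : MeasurableSet (unitCube d) :=
  MeasurableSet.univ_pi' fun _ => measurableSet_Ioc

theorem norm_le_one_of_mem_unitCube {x : Fin d → ℝ} (hx : x ∈ unitCube d) : ‖x‖ ≤ 1 := by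
  refine (pi_norm_le_iff_of_nonneg zero_le_one).2 fun i => ?_
  have := hx i
  rw [Set.mem_Ioc, zero_add] at this
  rw [Real.norm_of_nonneg this.1.le]
  exact this.2

theorem finite_norm_intVec_le (r : ℝ) : {m : Fin d → ℤ | ‖intVec m‖ ≤ r}.Finite := by
  refine (Set.finite_Icc (fun _ : Fin d => -⌈r⌉) (fun _ => ⌈r⌉)).subset fun m hm => ?_
  have h1 : ∀ i, |(m i : ℝ)| ≤ r := fun i => (norm_le_pi_norm (intVec m) i).trans hm
  refine ⟨fun i => ?_, fun i => ?_⟩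
  · have h2 : (-m i : ℤ) ≤ ⌈r⌉ := by
      have h3 : ((-m i : ℤ) : ℝ) ≤ ⌈r⌉ := by
        push_cast
        exact (neg_le_abs _).trans ((h1 i).trans (Int.le_ceil r))
      exact_mod_cast h3
    change -⌈r⌉ ≤ m i
    omega
  · have h3 : ((m i : ℤ) : ℝ) ≤ ⌈r⌉ := (le_abs_self _).trans ((h1 i).trans (Int.le_ceil r))
    exact_mod_cast h3

theorem exists_finset_forall_add_eq_zero {p : (Fin d → ℝ) → ℂ} (hp : HasCompactSupport p) (r : ℝ) :
    ∃ s : Finset (Fin d → ℤ), ∀ x, ‖x‖ ≤ r → ∀ m ∉ s, p (x + intVec m) = 0 := by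
  obtain ⟨R, hR⟩ := hp.isCompact.isBounded.exists_norm_le
  refine ⟨(finite_norm_intVec_le (r + R)).toFinset, fun x hx m hm => ?_⟩
  by_contra hne
  refine hm ((finite_norm_intVec_le (r + R)).mem_toFinset.2 ?_)
  have h1 := hR _ (subset_tsupport p hne)
  calc ‖intVec m‖ = ‖(x + intVec m) - x‖ := by rw [add_sub_cancel_left]
    _ ≤ ‖x + intVec m‖ + ‖x‖ := norm_sub_le _ _
    _ ≤ r + R := by linarith

theorem iUnion_unitCube : ⋃ m : Fin d → ℤ, (fun x => x + intVec (-m)) ⁻¹' unitCube d =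
    Set.univ := by
  refine Set.eq_univ_of_forall fun x => Set.mem_iUnion.2 ⟨fun i => ⌈x i⌉ - 1, fun i => ?_⟩
  simp only [intVec, Pi.add_apply, Pi.neg_apply, Set.mem_Ioc]
  push_cast
  constructor <;> linarith [Int.ceil_lt_add_one (x i), Int.le_ceil (x i)]

theorem pairwise_disjoint_unitCube :
    Pairwise (Function.onFun Disjoint
      fun m : Fin d → ℤ => (fun x => x + intVec (-m)) ⁻¹' unitCube d) := by
  intro m m' hne
  refine Set.disjoint_left.2 fun x hx hx' => hne (funext fun i => ?_)
  have h1 := hx i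
  have h2 := hx' i
  simp only [intVec, Pi.add_apply, Pi.neg_apply, Set.mem_Ioc] at h1 h2
  push_cast at h1 h2
  have h3 : (m i : ℝ) < m' i + 1 := by linarith
  have h4 : (m' i : ℝ) < m i + 1 := by linarith
  have h5 : m i < m' i + 1 := by exact_mod_cast h3
  have h6 : m' i < m i + 1 := by exact_mod_cast h4
  omega

theorem hasSum_setIntegral_unitCube {f : (Fin d → ℝ) → ℂ} (hf : Integrable f) :
    HasSum (fun m : Fin d → ℤ => ∫ x in unitCube d, f (x + intVec m)) (∫ x, f x) := by
  have h1 := hasSum_integral_iUnion (μ := volume) (f := f)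
    (s := fun m : Fin d → ℤ => (fun x => x + intVec (-m)) ⁻¹' unitCube d)
    (fun m => measurableSet_unitCube.preimage (measurable_add_const _))
    pairwise_disjoint_unitCube hf.integrableOn
  rw [iUnion_unitCube, setIntegral_univ] at h1
  refine h1.congr_fun fun m => ?_
  have h2 := (measurePreserving_add_right volume (intVec (-m))).setIntegral_preimage_emb
    (measurableEmbedding_addRight _) (fun x => f (x + intVec m)) (unitCube d)
  rw [← h2]
  refine integral_congr_ae (Filter.Eventually.of_forall fun x => ?_)
  simp only
  rw [add_assoc, ← intVec_add, neg_add_cancel]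
  congr 1
  ext i; simp [intVec]

-- On `ℝ / ℤ` the volume is the normalized Haar measure, as in the theory of Fourier series on the
-- torus.
attribute [local instance] instMeasureSpaceUnitAddCircle

theorem isProbabilityMeasure_volume_unitAddCircle :
    IsProbabilityMeasure (volume : Measure UnitAddCircle) :=
  inferInstanceAs (IsProbabilityMeasure AddCircle.haarAddCircle)

attribute [local instance] isProbabilityMeasure_volume_unitAddCircle

/-- The point of the torus `ℝ^d / ℤ^d` represented by `x`. -/
def toTorus (x : Fin d → ℝ) : UnitAddTorus (Fin d) := fun i => (x i : UnitAddCircle)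

theorem toTorus_add_intVec (x : Fin d → ℝ) (m : Fin d → ℤ) :
    toTorus (x + intVec m) = toTorus x := by
  ext i
  simp only [toTorus, intVec, Pi.add_apply, AddCircle.coe_add]
  have : ((m i : ℝ) : UnitAddCircle) = 0 := by
    rw [AddCircle.coe_eq_zero_iff]
    exact ⟨m i, by simp⟩
  rw [this, add_zero]

theorem continuous_toTorus : Continuous (toTorus : (Fin d → ℝ) → UnitAddTorus (Fin d)) :=
  continuous_pi fun i => (AddCircle.continuous_mk' 1).comp (continuous_apply i)

/-- The Fourier transform of `p` at the integer point `n`; these are the Fourier coefficients of the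
periodization of `p`. -/
def latticeCoeff (p : (Fin d → ℝ) → ℂ) (n : Fin d → ℤ) : ℂ :=
  ∫ x, UnitAddTorus.mFourier (-n) (toTorus x) * p x

/-- The periodization of `p`, as a function on the torus. It is evaluated at the representative in
the unit cube, so that no invariance is needed for the definition. -/
def periodization (p : (Fin d → ℝ) → ℂ) (t : UnitAddTorus (Fin d)) : ℂ :=
  ∑' m : Fin d → ℤ, p ((UnitAddTorus.measurableEquivPiIoc (fun _ => 0) t).1 + intVec m)

theorem periodization_toTorus (p : (Fin d → ℝ) → ℂ) {x : Fin d → ℝ} (hx : x ∈ unitCube d) :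
    periodization p (toTorus x) = ∑' m : Fin d → ℤ, p (x + intVec m) := by
  have h1 : UnitAddTorus.measurableEquivPiIoc (fun _ => 0) (toTorus x) = ⟨x, hx⟩ :=
    (UnitAddTorus.measurableEquivPiIoc (fun _ : Fin d => (0 : ℝ))).apply_symm_apply ⟨x, hx⟩
  rw [periodization, h1]

theorem memLp_periodization {p : (Fin d → ℝ) → ℂ} (hp : Continuous p) (hpc : HasCompactSupport p) :
    MemLp (periodization p) 2 volume := by
  obtain ⟨s, hs⟩ := exists_finset_forall_add_eq_zero hpc 1
  obtain ⟨M, hM⟩ := hp.bounded_above_of_compact_support hpc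
  have h1 : periodization p = fun t => ∑ m ∈ s,
      p ((UnitAddTorus.measurableEquivPiIoc (fun _ => 0) t).1 + intVec m) := by
    ext t
    exact tsum_eq_sum fun m hm => hs _ (norm_le_one_of_mem_unitCube
      (UnitAddTorus.measurableEquivPiIoc (fun _ => 0) t).2) m hm
  rw [h1]
  refine MemLp.of_bound (C := ∑ m ∈ s, M) ?_ (Filter.Eventually.of_forall fun t =>
    norm_sum_le_of_le _ fun m _ => hM _)
  refine Measurable.aestronglyMeasurable (Finset.measurable_fun_sum _ fun m _ => ?_)
  exact hp.measurable.comp (((measurable_subtype_coe).comp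
    (UnitAddTorus.measurableEquivPiIoc (fun _ : Fin d => (0 : ℝ))).measurable).add_const _)

theorem mFourierCoeff_periodization {p : (Fin d → ℝ) → ℂ} (hp : Continuous p)
    (hpc : HasCompactSupport p) (n : Fin d → ℤ) :
    UnitAddTorus.mFourierCoeff (periodization p) n = latticeCoeff p n := by
  rw [UnitAddTorus.mFourierCoeff_eq_integral _ _ (fun _ => 0)]
  obtain ⟨s, hs⟩ := exists_finset_forall_add_eq_zero hpc 1
  have hcont : Continuous fun x => UnitAddTorus.mFourier (-n) (toTorus x) * p x :=
    ((UnitAddTorus.mFourier (-n)).continuous.comp continuous_toTorus).mul hp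
  have hint : Integrable fun x => UnitAddTorus.mFourier (-n) (toTorus x) * p x :=
    hcont.integrable_of_hasCompactSupport hpc.mul_left
  rw [latticeCoeff, ← (hasSum_setIntegral_unitCube hint).tsum_eq]
  have h2 : ∀ m ∉ s, ∫ x in unitCube d, UnitAddTorus.mFourier (-n) (toTorus (x + intVec m)) *
      p (x + intVec m) = 0 := fun m hm =>
    setIntegral_eq_zero_of_forall_eq_zero fun x hx => by
      rw [hs x (norm_le_one_of_mem_unitCube hx) m hm, mul_zero]
  rw [tsum_eq_sum h2, ← integral_finsetSum]
  · refine setIntegral_congr_fun measurableSet_unitCube fun x hx => ?_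
    change _ • periodization p (toTorus x) = _
    rw [periodization_toTorus p hx,
      tsum_eq_sum fun m hm => hs x (norm_le_one_of_mem_unitCube hx) m hm, smul_eq_mul,
      Finset.mul_sum]
    refine Finset.sum_congr rfl fun m _ => ?_
    rw [toTorus_add_intVec]
    rfl
  · exact fun m _ => (hint.comp_add_right _).integrableOn

/-- Parseval's identity for the periodizations of `p` and `q`. -/
theorem hasSum_latticeCoeff {p q : (Fin d → ℝ) → ℂ} (hp : Continuous p)
    (hpc : HasCompactSupport p) (hq : Continuous q) (hqc : HasCompactSupport q) :
    HasSum (fun n : Fin d → ℤ => starRingEnd ℂ (latticeCoeff p n) * latticeCoeff q n)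
      (∑' m : Fin d → ℤ, ∫ x, starRingEnd ℂ (p x) * q (x + intVec m)) := by
  have hP := memLp_periodization hp hpc
  have hQ := memLp_periodization hq hqc
  have h0 := UnitAddTorus.hasSum_prod_mFourierCoeff hP.toLp hQ.toLp
  have hcoe : ∀ {p : (Fin d → ℝ) → ℂ} (hp : Continuous p) (hpc : HasCompactSupport p)
      (hP : MemLp (periodization p) 2 volume) (n : Fin d → ℤ),
      UnitAddTorus.mFourierCoeff hP.toLp n = latticeCoeff p n := by
    intro p hp hpc hP n
    rw [← mFourierCoeff_periodization hp hpc]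
    refine integral_congr_ae ?_
    filter_upwards [hP.coeFn_toLp] with t ht
    rw [ht]
  simp only [hcoe hp hpc hP, hcoe hq hqc hQ] at h0
  convert! h0 using 1
  obtain ⟨R, hR⟩ := hpc.isCompact.isBounded.exists_norm_le
  obtain ⟨s, hs⟩ := exists_finset_forall_add_eq_zero hqc (max R 1)
  obtain ⟨s', hs'⟩ := exists_finset_forall_add_eq_zero hpc 1
  have hp0 : ∀ x, ¬ ‖x‖ ≤ max R 1 → p x = 0 := fun x hx => by
    by_contra hne
    exact hx ((hR x (subset_tsupport p hne)).trans (le_max_left _ _))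
  have hpc' : HasCompactSupport fun x => starRingEnd ℂ (p x) := hpc.comp_left (map_zero _)
  have hp' : Continuous fun x => starRingEnd ℂ (p x) := Complex.continuous_conj.comp hp
  have hint : ∀ m, Integrable fun x => starRingEnd ℂ (p x) * q (x + intVec m) := fun m =>
    (hp'.mul (hq.comp (continuous_add_const _))).integrable_of_hasCompactSupport hpc'.mul_right
  have hzero : ∀ m ∉ s, ∀ x, starRingEnd ℂ (p x) * q (x + intVec m) = 0 := by
    intro m hm x
    by_cases hx : ‖x‖ ≤ max R 1
    · rw [hs x hx m hm, mul_zero]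
    · rw [hp0 x hx, map_zero, zero_mul]
  have hsum : Integrable fun x => ∑ m ∈ s, starRingEnd ℂ (p x) * q (x + intVec m) :=
    integrable_finsetSum _ fun m _ => hint m
  have hG : ∀ x, ∑ m ∈ s, starRingEnd ℂ (p x) * q (x + intVec m) =
      starRingEnd ℂ (p x) * ∑' m : Fin d → ℤ, q (x + intVec m) := by
    intro x
    rw [← tsum_mul_left, tsum_eq_sum fun m hm => hzero m hm x]
  -- the sum over the lattice is unfolded: the periodization of `q` is invariant under translations
  have hper : ∀ x (l : Fin d → ℤ), ∑' m : Fin d → ℤ, q (x + intVec l + intVec m) =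
      ∑' m : Fin d → ℤ, q (x + intVec m) := by
    intro x l
    rw [← (Equiv.addLeft l).tsum_eq fun m => q (x + intVec m)]
    refine tsum_congr fun m => ?_
    rw [Equiv.coe_addLeft, intVec_add, add_assoc]
  calc ∑' m : Fin d → ℤ, ∫ x, starRingEnd ℂ (p x) * q (x + intVec m)
      = ∫ x, ∑ m ∈ s, starRingEnd ℂ (p x) * q (x + intVec m) := by
        rw [tsum_eq_sum (s := s) fun m hm => by simp [hzero m hm],
          integral_finsetSum _ fun m _ => hint m]
    _ = ∑' l : Fin d → ℤ, ∫ x in unitCube d,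
          ∑ m ∈ s, starRingEnd ℂ (p (x + intVec l)) * q (x + intVec l + intVec m) :=
        (hasSum_setIntegral_unitCube hsum).tsum_eq.symm
    _ = ∑ l ∈ s', ∫ x in unitCube d,
          ∑ m ∈ s, starRingEnd ℂ (p (x + intVec l)) * q (x + intVec l + intVec m) := by
        refine tsum_eq_sum fun l hl => ?_
        refine setIntegral_eq_zero_of_forall_eq_zero fun x hx => ?_
        rw [hs' x (norm_le_one_of_mem_unitCube hx) l hl]
        simp
    _ = ∫ x in unitCube d, ∑ l ∈ s',
          ∑ m ∈ s, starRingEnd ℂ (p (x + intVec l)) * q (x + intVec l + intVec m) :=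
        (integral_finsetSum _ fun l _ => (hsum.comp_add_right (intVec l)).integrableOn).symm
    _ = ∫ x in unitCube d, starRingEnd ℂ (periodization p (toTorus x)) *
          periodization q (toTorus x) := by
        refine setIntegral_congr_fun measurableSet_unitCube fun x hx => ?_
        simp only [hG, hper]
        rw [← Finset.sum_mul, ← map_sum, periodization_toTorus p hx, periodization_toTorus q hx,
          tsum_eq_sum (s := s') fun m hm => hs' x (norm_le_one_of_mem_unitCube hx) m hm]
    _ = ∫ t, starRingEnd ℂ (periodization p t) * periodization q t :=
        (UnitAddTorus.integral_preimage
          (fun t => starRingEnd ℂ (periodization p t) * periodization q t) fun _ => 0).symm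
    _ = _ := by
        refine integral_congr_ae ?_
        filter_upwards [hP.coeFn_toLp, hQ.coeFn_toLp] with t h1 h2
        rw [h1, h2]

end Periodization

namespace System

variable (G : System d J)

/-! ### The frame coefficients on the Fourier side -/

/-- The linear map `C j^{-t}`, which sends `ℤ^d` onto the dual lattice. -/
def dualMap (j : J) (x : Fin d → ℝ) : E d :=
  WithLp.toLp 2 (((G.C j)⁻¹ : GL (Fin d) ℝ).val.transpose.mulVec x)

theorem dualMap_intVec (j : J) (m : Fin d → ℤ) : G.dualMap j (intVec m) = G.dualPt j m := rfl

theorem dualMap_add (j : J) (x y : Fin d → ℝ) :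
    G.dualMap j (x + y) = G.dualMap j x + G.dualMap j y := by
  simp only [dualMap, Matrix.mulVec_add, WithLp.toLp_add]

theorem continuous_dualMap (j : J) : Continuous (G.dualMap j) :=
  (PiLp.continuous_toLp 2 _).comp (Continuous.matrix_mulVec continuous_const continuous_id)

theorem inv_mul_self (j : J) : ((G.C j)⁻¹ : GL (Fin d) ℝ).val * (G.C j).val = 1 :=
  Units.inv_mul (G.C j)

theorem inner_latticePt_dualMap (j : J) (k : Fin d → ℤ) (x : Fin d → ℝ) :
    inner ℝ (G.latticePt j k) (G.dualMap j x) = ∑ i, (k i : ℝ) * x i := by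
  have h1 : inner ℝ (G.latticePt j k) (G.dualMap j x) =
      dotProduct (((G.C j)⁻¹ : GL (Fin d) ℝ).val.transpose.mulVec x)
        ((G.C j).val.mulVec fun i => (k i : ℝ)) := by
    rw [EuclideanSpace.inner_eq_star_dotProduct]
    simp [latticePt, dualMap]
  rw [h1, Matrix.mulVec_transpose, ← Matrix.dotProduct_mulVec, Matrix.mulVec_mulVec,
    inv_mul_self, Matrix.one_mulVec, dotProduct_comm]
  rfl

theorem transpose_mulVec_dualMap (j : J) (x : Fin d → ℝ) :
    (G.C j).val.transpose.mulVec (G.dualMap j x).ofLp = x := by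
  rw [dualMap, Matrix.mulVec_mulVec, ← Matrix.transpose_mul, inv_mul_self, Matrix.transpose_one,
    Matrix.one_mulVec]

theorem dualMap_injective (j : J) : Function.Injective (G.dualMap j) := by
  intro x y hxy
  rw [← G.transpose_mulVec_dualMap j x, hxy, transpose_mulVec_dualMap]

theorem intVec_injective : Function.Injective (intVec : (Fin d → ℤ) → Fin d → ℝ) :=
  fun _ _ h => funext fun i => Int.cast_injective (congrFun h i)

theorem dualPt_injective (j : J) : Function.Injective (G.dualPt j) :=
  (G.dualMap_injective j).comp intVec_injective

theorem absDet_pos (j : J) : 0 < G.absDet j :=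
  abs_pos.2 ((Matrix.isUnit_iff_isUnit_det _).1 (G.C j).isUnit).ne_zero

theorem integral_comp_dualMap (j : J) {f : E d → ℂ} (hf : Continuous f) :
    ∫ x, f (G.dualMap j x) = (G.absDet j : ℂ) * ∫ ξ, f ξ := by
  set M := ((G.C j)⁻¹ : GL (Fin d) ℝ).val.transpose with hM
  have hdet : M.det * (G.C j).val.det = 1 := by
    rw [hM, Matrix.det_transpose, ← Matrix.det_mul, inv_mul_self, Matrix.det_one]
  have hM0 : M.det ≠ 0 := left_ne_zero_of_mul_eq_one hdet
  have hinv : M.det⁻¹ = (G.C j).val.det := by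
    rw [inv_eq_iff_eq_inv, eq_inv_of_mul_eq_one_left hdet]
  have h1 := Real.map_matrix_volume_pi_eq_smul_volume_pi hM0
  have hc : Continuous (Matrix.toLin' M) := LinearMap.continuous_of_finiteDimensional _
  have hcf : Continuous fun y : Fin d → ℝ => f (WithLp.toLp 2 y) :=
    hf.comp (PiLp.continuous_toLp 2 _)
  have h2 := integral_map (μ := volume) hc.measurable.aemeasurable
    (f := fun y : Fin d → ℝ => f (WithLp.toLp 2 y)) hcf.aestronglyMeasurable
  rw [h1, integral_smul_measure] at h2
  have h3 := (PiLp.volume_preserving_toLp (Fin d)).integral_comp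
    (MeasurableEquiv.toLp 2 (Fin d → ℝ)).measurableEmbedding f
  rw [h3, hinv, ENNReal.toReal_ofReal (abs_nonneg _)] at h2
  exact h2.symm

theorem continuous_fourier (j : J) : Continuous (𝓕 (G.g j)) := (G.contDiff_fourier j).continuous

theorem integrable_translate (j : J) (k : Fin d → ℤ) :
    Integrable fun x => G.g j (x - G.latticePt j k) :=
  (G.integrable j).comp_sub_right _

theorem fourier_translate (j : J) (k : Fin d → ℤ) (ξ : E d) :
    𝓕 (fun x => G.g j (x - G.latticePt j k)) ξ =
      Real.fourierChar (-inner ℝ (G.latticePt j k) ξ) • 𝓕 (G.g j) ξ := by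
  have h1 := congrFun (VectorFourier.fourierIntegral_comp_add_right Real.fourierChar
    (volume : Measure (E d)) (innerₗ (E d)) (G.g j) (-G.latticePt j k)) ξ
  have h2 : innerₗ (E d) (-G.latticePt j k) ξ = -inner ℝ (G.latticePt j k) ξ := by
    simp
  rw [h2] at h1
  exact h1

/-- The frame coefficient `⟨f | T_{C j k} g j⟩`. -/
def coeff (f : Lp ℂ 2 (volume : Measure (E d))) (j : J) (k : Fin d → ℤ) : ℂ :=
  inner ℂ (G.atom j k) f

/-- The frame coefficients of `𝓕⁻¹ ψ`, computed on the Fourier side. -/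
theorem coeff_eq_integral (ψ : 𝓓(Ω, ℂ)) (j : J) (k : Fin d → ℤ) :
    G.coeff (invFourierTest ψ) j k =
      ∫ ξ, (Real.fourierChar (inner ℝ (G.latticePt j k) ξ) : ℂ) *
        (starRingEnd ℂ (𝓕 (G.g j) ξ) * ψ ξ) := by
  have h1 : G.coeff (invFourierTest ψ) j k =
      ∫ x, inner ℂ (G.g j (x - G.latticePt j k)) (𝓕⁻ (ψ : E d → ℂ) x) := by
    rw [coeff, L2.inner_def]
    refine integral_congr_ae ?_
    filter_upwards [MemLp.coeFn_toLp ((G.memLp j).comp_measurePreserving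
      (measurePreserving_sub_right volume (G.latticePt j k))),
      coeFn_invFourierTest ψ] with x h2 h3
    rw [atom, h2, h3, Function.comp_apply]
  have hψ : Integrable (ψ : E d → ℂ) :=
    ψ.continuous.integrable_of_hasCompactSupport ψ.hasCompactSupport
  have h2 := VectorFourier.integral_sesq_fourierIntegral_eq_neg_flip (μ := volume) (ν := volume)
    (e := Real.fourierChar) (L := innerₗ (E d)) (innerSL ℂ (E := ℂ)) Real.continuous_fourierChar
    (by simpa using continuous_inner) (G.integrable_translate j k) hψ
  rw [flip_innerₗ] at h2
  rw [h1]
  refine h2.symm.trans (integral_congr_ae (Filter.Eventually.of_forall fun ξ => ?_))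
  change inner ℂ (𝓕 (fun x => G.g j (x - G.latticePt j k)) ξ) (ψ ξ) = _
  rw [fourier_translate, RCLike.inner_apply, Circle.smul_def, smul_eq_mul, map_mul,
    AddChar.map_neg_eq_inv, ← Circle.coe_inv_eq_conj, inv_inv]
  ring

/-- The change of variables `ξ = C j^{-t} x` turns the lattice `C j ℤ^d` into `ℤ^d`. -/
theorem coeff_eq_latticeCoeff (ψ : 𝓓(Ω, ℂ)) (j : J) (k : Fin d → ℤ) :
    (G.absDet j : ℂ) * G.coeff (invFourierTest ψ) j (-k) =
      latticeCoeff (fun x => starRingEnd ℂ (𝓕 (G.g j) (G.dualMap j x)) * ψ (G.dualMap j x)) k := by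
  have hcont : Continuous fun ξ => (Real.fourierChar (inner ℝ (G.latticePt j (-k)) ξ) : ℂ) *
      (starRingEnd ℂ (𝓕 (G.g j) ξ) * ψ ξ) := by
    have h1 : Continuous fun ξ : E d => (Real.fourierChar (inner ℝ (G.latticePt j (-k)) ξ) : ℂ) :=
      continuous_induced_dom.comp (Real.continuous_fourierChar.comp
        (continuous_const.inner continuous_id))
    exact h1.mul ((Complex.continuous_conj.comp (G.continuous_fourier j)).mul ψ.continuous)
  rw [coeff_eq_integral G, ← integral_comp_dualMap G j hcont, latticeCoeff]
  refine integral_congr_ae (Filter.Eventually.of_forall fun x => ?_)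
  simp only [inner_latticePt_dualMap]
  congr 1
  rw [Real.fourierChar_apply]
  change _ = ∏ i, fourier ((-k) i) (x i : UnitAddCircle)
  simp only [fourier_coe_apply]
  rw [← Complex.exp_sum]
  congr 1
  push_cast
  rw [Finset.mul_sum, Finset.sum_mul]
  refine Finset.sum_congr rfl fun i _ => ?_
  simp only [Pi.neg_apply, Int.cast_neg, div_one]
  ring

/-- Parseval's identity for the orbit of one generator. -/
theorem hasSum_coeff (ψ₁ ψ₂ : 𝓓(Ω, ℂ)) (j : J) :
    HasSum (fun k =>
        starRingEnd ℂ (G.coeff (invFourierTest ψ₁) j k) * G.coeff (invFourierTest ψ₂) j k)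
      (∑' m, ((G.absDet j)⁻¹ : ℂ) * ∫ ξ, starRingEnd ℂ (ψ₁ ξ) * ψ₂ (ξ + G.dualPt j m) *
        (𝓕 (G.g j) ξ * starRingEnd ℂ (𝓕 (G.g j) (ξ + G.dualPt j m)))) := by
  have hp : ∀ ψ : 𝓓(Ω, ℂ), Continuous fun x =>
      starRingEnd ℂ (𝓕 (G.g j) (G.dualMap j x)) * ψ (G.dualMap j x) := fun ψ =>
    ((Complex.continuous_conj.comp (G.continuous_fourier j)).mul ψ.continuous).comp
      (G.continuous_dualMap j)
  have hpc : ∀ ψ : 𝓓(Ω, ℂ), HasCompactSupport fun x =>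
      starRingEnd ℂ (𝓕 (G.g j) (G.dualMap j x)) * ψ (G.dualMap j x) := by
    intro ψ
    have hc : Continuous fun ξ : E d => (G.C j).val.transpose.mulVec ξ.ofLp :=
      Continuous.matrix_mulVec continuous_const (PiLp.continuous_ofLp 2 _)
    refine HasCompactSupport.intro (ψ.hasCompactSupport.isCompact.image hc) fun x hx => ?_
    rw [image_eq_zero_of_notMem_tsupport (f := ψ) fun h =>
      hx ⟨_, h, transpose_mulVec_dualMap G j x⟩, mul_zero]
  have h0 := hasSum_latticeCoeff (hp ψ₁) (hpc ψ₁) (hp ψ₂) (hpc ψ₂)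
  have hne : (G.absDet j : ℂ) ≠ 0 := by exact_mod_cast (G.absDet_pos j).ne'
  -- one factor `|det C j|⁻¹` per coefficient; the change of variables on the other side takes one
  -- of them back
  have h1 := (h0.mul_left ((G.absDet j : ℂ)⁻¹ ^ 2))
  rw [← (Equiv.neg (Fin d → ℤ)).hasSum_iff]
  convert! h1 using 1
  · ext k
    simp only [Function.comp_apply, Equiv.neg_apply]
    rw [← coeff_eq_latticeCoeff G, ← coeff_eq_latticeCoeff G, map_mul,
      Complex.conj_ofReal]
    field_simp
  · rw [← tsum_mul_left]
    refine tsum_congr fun m => ?_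
    have hcont : Continuous fun ξ => starRingEnd ℂ (ψ₁ ξ) * ψ₂ (ξ + G.dualPt j m) *
        (𝓕 (G.g j) ξ * starRingEnd ℂ (𝓕 (G.g j) (ξ + G.dualPt j m))) := by
      have h2 := G.continuous_fourier j
      have h3 := ψ₁.continuous
      have h4 := ψ₂.continuous
      fun_prop
    have h5 := integral_comp_dualMap G j hcont
    refine Eq.trans ?_ (congrArg _ (h5.symm.trans (integral_congr_ae
      (Filter.Eventually.of_forall fun x => ?_))))
    · field_simp
    · simp only [map_mul, Complex.conj_conj, dualMap_add, dualMap_intVec]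
      ring

/-! ### The fiberization of the frame operator -/

/-- The local integrability condition for the inverse Fourier transform of an indicator function.
It dominates the condition for all pairs of test functions supported in `K`. -/
theorem AlphaLIC.indicator {G : System d J} (h : G.AlphaLIC Ω) {K : Set (E d)} (hK : IsCompact K)
    (hKΩ : K ⊆ Ω) :
    ∑' j, ENNReal.ofReal (G.absDet j)⁻¹ * ∑' α : G.dualLattice j,
      ∫⁻ ξ, ‖K.indicator (1 : E d → ℂ) ξ * K.indicator (1 : E d → ℂ) (ξ + α) *
        𝓕 (G.g j) ξ * 𝓕 (G.g j) (ξ + α)‖ₑ < ⊤ := by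
  set H : Lp ℂ 2 (volume : Measure (E d)) :=
    indicatorConstLp 2 hK.measurableSet hK.measure_lt_top.ne (1 : ℂ) with hH
  have hcoe : fourierL2 (𝓕⁻ H : Lp ℂ 2 (volume : Measure (E d))) =ᵐ[volume]
      K.indicator (1 : E d → ℂ) := by
    rw [fourierL2, fourier_fourierInv_eq]
    exact indicatorConstLp_coeFn
  have hmem : (𝓕⁻ H : Lp ℂ 2 (volume : Measure (E d))) ∈ BSpace Ω := by
    refine ⟨(memLp_congr_ae hcoe).2 ?_, K, hK, hKΩ, ?_⟩
    · exact (memLp_top_const (1 : ℂ)).indicator hK.measurableSet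
    · filter_upwards [hcoe] with ξ hξ hξK
      rw [hξ, Set.indicator_of_notMem hξK]
  refine lt_of_eq_of_lt ?_ (h _ hmem)
  refine tsum_congr fun j => congrArg _ (tsum_congr fun α => lintegral_congr_ae ?_)
  filter_upwards [hcoe, ae_comp_add hcoe (α : E d)] with ξ h1 h2
  rw [h1, h2]

/-- The terms of the fiberized frame form of `𝓕⁻¹ ψ₁` and `𝓕⁻¹ ψ₂`. -/
def fiberTerm (ψ₁ ψ₂ : 𝓓(Ω, ℂ)) (j : J) (α ξ : E d) : ℂ :=
  ((G.absDet j)⁻¹ : ℂ) * (starRingEnd ℂ (ψ₁ ξ) * ψ₂ (ξ + α) *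
    (𝓕 (G.g j) ξ * starRingEnd ℂ (𝓕 (G.g j) (ξ + α))))

theorem continuous_fiberTerm (ψ₁ ψ₂ : 𝓓(Ω, ℂ)) (j : J) (α : E d) :
    Continuous (G.fiberTerm ψ₁ ψ₂ j α) := by
  have h2 := G.continuous_fourier j
  exact continuous_const.mul (((Complex.continuous_conj.comp ψ₁.continuous).mul
    (ψ₂.continuous.comp (continuous_add_const α))).mul
      (h2.mul (Complex.continuous_conj.comp (h2.comp (continuous_add_const α)))))

theorem tsum_lintegral_fiberTerm_lt_top {G : System d J} (h : G.AlphaLIC Ω) (ψ₁ ψ₂ : 𝓓(Ω, ℂ)) :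
    ∑' p : J × (Fin d → ℤ), ∫⁻ ξ, ‖G.fiberTerm ψ₁ ψ₂ p.1 (G.dualPt p.1 p.2) ξ‖ₑ < ⊤ := by
  set K := tsupport ψ₁ ∪ tsupport ψ₂ with hKdef
  have hK : IsCompact K := ψ₁.hasCompactSupport.isCompact.union ψ₂.hasCompactSupport.isCompact
  have hbound : ∀ ψ : 𝓓(Ω, ℂ), tsupport ψ ⊆ K → ∃ M : ℝ≥0, ∀ ξ,
      ‖ψ ξ‖ₑ ≤ M * ‖K.indicator (1 : E d → ℂ) ξ‖ₑ := by
    intro ψ hψ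
    obtain ⟨M, hM⟩ := ψ.continuous.bounded_above_of_compact_support ψ.hasCompactSupport
    refine ⟨M.toNNReal, fun ξ => ?_⟩
    by_cases hξ : ξ ∈ tsupport ψ
    · rw [Set.indicator_of_mem (hψ hξ), Pi.one_apply, enorm_one, mul_one, ← ofReal_norm]
      exact ENNReal.ofReal_le_ofReal (hM ξ)
    · rw [image_eq_zero_of_notMem_tsupport hξ, enorm_zero]
      exact zero_le
  obtain ⟨M₁, hM₁⟩ := hbound ψ₁ Set.subset_union_left
  obtain ⟨M₂, hM₂⟩ := hbound ψ₂ Set.subset_union_right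
  have h0 := h.indicator hK (Set.union_subset ψ₁.tsupport_subset ψ₂.tsupport_subset)
  rw [ENNReal.tsum_prod (f := fun j m => ∫⁻ ξ, ‖G.fiberTerm ψ₁ ψ₂ j (G.dualPt j m) ξ‖ₑ)]
  have hle : ∀ j (m : Fin d → ℤ), ∫⁻ ξ, ‖G.fiberTerm ψ₁ ψ₂ j (G.dualPt j m) ξ‖ₑ ≤
      ENNReal.ofReal (G.absDet j)⁻¹ * ((M₁ * M₂) *
        ∫⁻ ξ, ‖K.indicator (1 : E d → ℂ) ξ * K.indicator (1 : E d → ℂ) (ξ + G.dualPt j m) *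
          𝓕 (G.g j) ξ * 𝓕 (G.g j) (ξ + G.dualPt j m)‖ₑ) := by
    intro j m
    rw [← lintegral_const_mul' _ _ (by finiteness), ← lintegral_const_mul' _ _ (by finiteness)]
    refine lintegral_mono fun ξ => ?_
    have h1 : ‖((G.absDet j)⁻¹ : ℂ)‖ₑ = ENNReal.ofReal (G.absDet j)⁻¹ := by
      rw [← ofReal_norm, norm_inv, Complex.norm_real, Real.norm_of_nonneg (G.absDet_pos j).le]
    simp only [fiberTerm, enorm_mul, RCLike.enorm_conj]
    rw [h1]
    refine mul_le_mul_right ?_ _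
    calc ‖ψ₁ ξ‖ₑ * ‖ψ₂ (ξ + G.dualPt j m)‖ₑ *
          (‖𝓕 (G.g j) ξ‖ₑ * ‖𝓕 (G.g j) (ξ + G.dualPt j m)‖ₑ)
        ≤ (M₁ * ‖K.indicator (1 : E d → ℂ) ξ‖ₑ) *
          (M₂ * ‖K.indicator (1 : E d → ℂ) (ξ + G.dualPt j m)‖ₑ) *
          (‖𝓕 (G.g j) ξ‖ₑ * ‖𝓕 (G.g j) (ξ + G.dualPt j m)‖ₑ) :=
          mul_le_mul_left (mul_le_mul' (hM₁ _) (hM₂ _)) _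
      _ = _ := by ring
  refine lt_of_le_of_lt (ENNReal.tsum_le_tsum fun j => ENNReal.tsum_le_tsum fun m => hle j m) ?_
  simp only [ENNReal.tsum_mul_left]
  simp only [mul_left_comm (ENNReal.ofReal _) ((M₁ : ℝ≥0∞) * M₂), ENNReal.tsum_mul_left]
  refine ENNReal.mul_lt_top (by finiteness) (lt_of_eq_of_lt ?_ h0)
  refine tsum_congr fun j => congrArg _ ?_
  exact (Equiv.ofInjective _ (G.dualPt_injective j)).tsum_eq fun α : G.dualLattice j =>
    ∫⁻ ξ, ‖K.indicator (1 : E d → ℂ) ξ * K.indicator (1 : E d → ℂ) (ξ + α) *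
        𝓕 (G.g j) ξ * 𝓕 (G.g j) (ξ + α)‖ₑ

/-- The pairs `(j, k)` correspond to the pairs `(α, j)` with `α ∈ Λ` and `j ∈ κ(α)`. -/
def latticeEquiv : J × (Fin d → ℤ) ≃ Σ α : G.Lam, G.kappa α :=
  Equiv.ofBijective
    (fun p => ⟨⟨G.dualPt p.1 p.2, Set.mem_iUnion.2 ⟨p.1, p.2, rfl⟩⟩, ⟨p.1, p.2, rfl⟩⟩) <| by
    constructor
    · rintro ⟨j, m⟩ ⟨j', m'⟩ h
      have h1 : j = j' := congrArg (fun x : Σ α : G.Lam, G.kappa α => (x.2 : J)) h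
      subst h1
      have h2 : G.dualPt j m = G.dualPt j m' :=
        congrArg (fun x : Σ α : G.Lam, G.kappa α => (x.1 : E d)) h
      rw [G.dualPt_injective j h2]
    · rintro ⟨⟨α, hα⟩, ⟨j, hj⟩⟩
      obtain ⟨m, hm⟩ : ∃ m, G.dualPt j m = α := hj
      subst hm
      exact ⟨(j, m), rfl⟩

instance [Countable J] : Countable G.Lam :=
  (Set.countable_iUnion fun j => Set.countable_range (G.dualPt j)).to_subtype

/-- The sum of the fiberized frame form, in terms of the functions `t_α`. -/
theorem tsum_integral_fiberTerm [Countable J] {G : System d J} (h : G.AlphaLIC Ω)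
    (ψ₁ ψ₂ : 𝓓(Ω, ℂ)) :
    ∑' p : J × (Fin d → ℤ), ∫ ξ, G.fiberTerm ψ₁ ψ₂ p.1 (G.dualPt p.1 p.2) ξ =
      ∫ ξ, starRingEnd ℂ (ψ₁ ξ) * ∑' α : G.Lam, starRingEnd ℂ (G.t α ξ) * ψ₂ (ξ + α) := by
  have hlt := tsum_lintegral_fiberTerm_lt_top h ψ₁ ψ₂
  have hmeas : ∀ p : J × (Fin d → ℤ), AEStronglyMeasurable
      (G.fiberTerm ψ₁ ψ₂ p.1 (G.dualPt p.1 p.2)) volume := fun p =>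
    (G.continuous_fiberTerm ψ₁ ψ₂ _ _).aestronglyMeasurable
  rw [← integral_tsum hmeas hlt.ne]
  refine integral_congr_ae ?_
  have hsum : ∀ᵐ ξ, ∑' p : J × (Fin d → ℤ), ‖G.fiberTerm ψ₁ ψ₂ p.1 (G.dualPt p.1 p.2) ξ‖ₑ < ⊤ := by
    refine ae_lt_top' (AEMeasurable.tsum fun p => (hmeas p).enorm) ?_
    rw [lintegral_tsum fun p => (hmeas p).enorm]
    exact hlt.ne
  filter_upwards [hsum] with ξ hξ
  have h1 : Summable fun p : J × (Fin d → ℤ) => G.fiberTerm ψ₁ ψ₂ p.1 (G.dualPt p.1 p.2) ξ :=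
    (tsum_enorm_ne_top_iff_summable_norm.1 hξ.ne).of_norm
  have h2 : (fun p : J × (Fin d → ℤ) => G.fiberTerm ψ₁ ψ₂ p.1 (G.dualPt p.1 p.2) ξ) =
      (fun x : Σ α : G.Lam, G.kappa α => G.fiberTerm ψ₁ ψ₂ x.2 x.1 ξ) ∘ G.latticeEquiv := rfl
  rw [h2] at h1 ⊢
  rw [Equiv.summable_iff] at h1
  refine (G.latticeEquiv.tsum_eq
    fun x : Σ α : G.Lam, G.kappa α => G.fiberTerm ψ₁ ψ₂ x.2 x.1 ξ).trans ?_
  rw [h1.tsum_sigma, ← tsum_mul_left]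
  refine tsum_congr fun α => ?_
  rw [t, Complex.conj_tsum, ← tsum_mul_right, ← tsum_mul_left]
  refine tsum_congr fun j => ?_
  simp only [fiberTerm, map_mul, map_inv₀, Complex.conj_ofReal, Complex.conj_conj]
  ring

/-- The fiberization of the frame operator: for `f₁ = 𝓕⁻¹ ψ₁` and `f₂ = 𝓕⁻¹ ψ₂` in `𝓢_Ω`,
the form `⟨f₁ | S f₂⟩` is given by the functions `t_α`. -/
theorem hasSum_frameForm [Countable J] {G : System d J} (h : G.AlphaLIC Ω) (ψ₁ ψ₂ : 𝓓(Ω, ℂ)) :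
    HasSum (fun p : J × (Fin d → ℤ) => starRingEnd ℂ (G.coeff (invFourierTest ψ₁) p.1 p.2) *
        G.coeff (invFourierTest ψ₂) p.1 p.2)
      (∫ ξ, starRingEnd ℂ (ψ₁ ξ) * ∑' α : G.Lam, starRingEnd ℂ (G.t α ξ) * ψ₂ (ξ + α)) := by
  have hsumm : ∀ ψ₁ ψ₂ : 𝓓(Ω, ℂ), Summable fun p : J × (Fin d → ℤ) =>
      ‖∫ ξ, G.fiberTerm ψ₁ ψ₂ p.1 (G.dualPt p.1 p.2) ξ‖ := fun ψ₁ ψ₂ => by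
    refine tsum_enorm_ne_top_iff_summable_norm.1 ?_
    exact ne_top_of_le_ne_top (tsum_lintegral_fiberTerm_lt_top h ψ₁ ψ₂).ne
      (ENNReal.tsum_le_tsum fun p => enorm_integral_le_lintegral_enorm _)
  have hrow : ∀ (ψ₁ ψ₂ : 𝓓(Ω, ℂ)) j,
      HasSum (fun k => starRingEnd ℂ (G.coeff (invFourierTest ψ₁) j k) *
        G.coeff (invFourierTest ψ₂) j k)
      (∑' m, ∫ ξ, G.fiberTerm ψ₁ ψ₂ j (G.dualPt j m) ξ) := by
    intro ψ₁ ψ₂ j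
    have h1 := G.hasSum_coeff ψ₁ ψ₂ j
    simp only [← integral_const_mul] at h1
    exact h1
  -- in the diagonal case all terms are nonnegative, so that summability can be tested iteratedly
  have hdiag : ∀ ψ : 𝓓(Ω, ℂ), Summable fun p : J × (Fin d → ℤ) =>
      ‖G.coeff (invFourierTest ψ) p.1 p.2‖ ^ 2 := by
    intro ψ
    have h1 : ∀ z : ℂ, ((‖z‖ ^ 2 : ℝ) : ℂ) = starRingEnd ℂ z * z := fun z => by
      rw [Complex.conj_mul', Complex.ofReal_pow]
    have h2 : ∀ j, HasSum (fun k => ((‖G.coeff (invFourierTest ψ) j k‖ ^ 2 : ℝ) : ℂ))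
        (∑' m, ∫ ξ, G.fiberTerm ψ ψ j (G.dualPt j m) ξ) := by
      intro j
      simp only [h1]
      exact hrow ψ ψ j
    refine (summable_prod_of_nonneg fun p => by positivity).2 ⟨fun j =>
      Complex.summable_ofReal.1 (h2 j).summable, ?_⟩
    rw [← Complex.summable_ofReal]
    simp only [Complex.ofReal_tsum]
    simp only [(h2 _).tsum_eq]
    exact ((hsumm ψ ψ).of_norm).prod
  have hs : Summable fun p : J × (Fin d → ℤ) =>
      starRingEnd ℂ (G.coeff (invFourierTest ψ₁) p.1 p.2) *
        G.coeff (invFourierTest ψ₂) p.1 p.2 := by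
    refine Summable.of_norm_bounded (((hdiag ψ₁).add (hdiag ψ₂))) fun p => ?_
    rw [norm_mul, RCLike.norm_conj]
    nlinarith [sq_nonneg (‖G.coeff (invFourierTest ψ₁) p.1 p.2‖ -
      ‖G.coeff (invFourierTest ψ₂) p.1 p.2‖),
      sq_nonneg (‖G.coeff (invFourierTest ψ₁) p.1 p.2‖ +
      ‖G.coeff (invFourierTest ψ₂) p.1 p.2‖)]
  refine hs.hasSum_iff.2 ?_
  rw [hs.tsum_prod, ← tsum_integral_fiberTerm h, (hsumm ψ₁ ψ₂).of_norm.tsum_prod]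
  exact tsum_congr fun j => (hrow ψ₁ ψ₂ j).tsum_eq

end System

/-! ### Bessel sequences -/

section Bessel

variable {H ι : Type*} [NormedAddCommGroup H] [InnerProductSpace ℂ H]

/-- The synthesis bound dual to a Bessel inequality. -/
theorem norm_sum_smul_sq_le {a : ι → H} {M : ℝ} (hM0 : 0 ≤ M)
    (hM : ∀ f, ∀ s : Finset ι, ∑ i ∈ s, ‖inner ℂ (a i) f‖ ^ 2 ≤ M * ‖f‖ ^ 2)
    (c : ι → ℂ) (s : Finset ι) : ‖∑ i ∈ s, c i • a i‖ ^ 2 ≤ M * ∑ i ∈ s, ‖c i‖ ^ 2 := by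
  set y := ∑ i ∈ s, c i • a i with hy
  have h1 : ‖y‖ ^ 2 ≤ ∑ i ∈ s, ‖c i‖ * ‖inner ℂ (a i) y‖ := by
    have h2 : inner ℂ y y = ∑ i ∈ s, starRingEnd ℂ (c i) * inner ℂ (a i) y := by
      conv_lhs => rw [hy, sum_inner]
      exact Finset.sum_congr rfl fun i _ => inner_smul_left _ _ _
    have h3 : ‖y‖ ^ 2 = ‖inner ℂ y y‖ := by
      rw [inner_self_eq_norm_sq_to_K, norm_pow, RCLike.norm_ofReal, abs_norm]
    rw [h3, h2]
    refine norm_sum_le_of_le _ fun i _ => ?_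
    rw [norm_mul, RCLike.norm_conj]
  have h4 := Finset.sum_mul_sq_le_sq_mul_sq s (fun i => ‖c i‖) fun i => ‖inner ℂ (a i) y‖
  have h5 : (‖y‖ ^ 2) ^ 2 ≤ (∑ i ∈ s, ‖c i‖ ^ 2) * (M * ‖y‖ ^ 2) :=
    (pow_le_pow_left₀ (by positivity) h1 2).trans (h4.trans
      (mul_le_mul_of_nonneg_left (hM y s) (Finset.sum_nonneg fun i _ => by positivity)))
  rcases eq_or_lt_of_le (sq_nonneg ‖y‖) with h0 | h0
  · rw [← h0]
    positivity
  · nlinarith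

/-- If `a` satisfies a Bessel inequality on a dense set, then the series `∑ i, ⟨a i, f⟩ a i`
converges unconditionally for every `f`. -/
theorem summable_inner_smul_of_bessel [CompleteSpace H] {a : ι → H} {M : ℝ} (hM0 : 0 ≤ M)
    {D : Set H} (hD : Dense D)
    (hM : ∀ f ∈ D, ∀ s : Finset ι, ∑ i ∈ s, ‖inner ℂ (a i) f‖ ^ 2 ≤ M * ‖f‖ ^ 2) (f : H) :
    Summable fun i => inner ℂ (a i) f • a i := by
  have hM' : ∀ f, ∀ s : Finset ι, ∑ i ∈ s, ‖inner ℂ (a i) f‖ ^ 2 ≤ M * ‖f‖ ^ 2 := fun f s =>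
    hD.induction (P := fun f => ∑ i ∈ s, ‖inner ℂ (a i) f‖ ^ 2 ≤ M * ‖f‖ ^ 2)
      (fun f hf => hM f hf s)
      (isClosed_le (continuous_finsetSum _ fun i _ =>
        ((continuous_const.inner continuous_id).norm.pow 2))
        (continuous_const.mul (continuous_norm.pow 2))) f
  have hsum : Summable fun i => ‖inner ℂ (a i) f‖ ^ 2 :=
    summable_of_sum_le (fun i => by positivity) (hM' f)
  rw [summable_iff_vanishing_norm] at hsum ⊢
  intro ε hε
  obtain ⟨s, hs⟩ := hsum (ε ^ 2 / (M + 1)) (by positivity)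
  refine ⟨s, fun t ht => ?_⟩
  have h1 := norm_sum_smul_sq_le hM0 hM' (fun i => inner ℂ (a i) f) t
  have h2 := hs t ht
  rw [Real.norm_of_nonneg (Finset.sum_nonneg fun i _ => by positivity), lt_div_iff₀ (by positivity)]
    at h2
  have h3 : 0 ≤ ∑ i ∈ t, ‖inner ℂ (a i) f‖ ^ 2 := Finset.sum_nonneg fun i _ => by positivity
  refine lt_of_pow_lt_pow_left₀ 2 hε.le (lt_of_le_of_lt h1 ?_)
  nlinarith

end Bessel

namespace System

variable (G : System d J)

/-! ### The functions `t_α` and the multiplier form of the frame operator -/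

theorem dualPt_neg (j : J) (m : Fin d → ℤ) : G.dualPt j (-m) = -G.dualPt j m := by
  have h1 : intVec (-m) = -intVec m := by ext i; simp [intVec]
  rw [← dualMap_intVec, ← dualMap_intVec, h1]
  simp only [dualMap, Matrix.mulVec_neg, WithLp.toLp_neg]

theorem neg_mem_dualLattice {j : J} {α : E d} : -α ∈ G.dualLattice j ↔ α ∈ G.dualLattice j := by
  have h : ∀ α, α ∈ G.dualLattice j → -α ∈ G.dualLattice j := by
    rintro _ ⟨m, rfl⟩
    exact ⟨-m, G.dualPt_neg j m⟩
  exact ⟨fun hα => by simpa using h _ hα, h α⟩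

theorem kappa_neg (α : E d) : G.kappa (-α) = G.kappa α :=
  Set.ext fun _ => G.neg_mem_dualLattice

theorem neg_mem_Lam {α : E d} : -α ∈ G.Lam ↔ α ∈ G.Lam := by
  simp only [Lam, Set.mem_iUnion, neg_mem_dualLattice]

theorem dualPt_zero (j : J) : G.dualPt j 0 = 0 := by
  have h1 : intVec (0 : Fin d → ℤ) = 0 := by ext i; simp [intVec]
  rw [← dualMap_intVec, h1]
  simp [dualMap]

theorem zero_mem_Lam [Nonempty J] : (0 : E d) ∈ G.Lam :=
  Set.mem_iUnion.2 ⟨Classical.arbitrary J, 0, G.dualPt_zero _⟩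

theorem kappa_zero : G.kappa 0 = Set.univ :=
  Set.eq_univ_of_forall fun j => ⟨0, G.dualPt_zero j⟩

/-- The symmetry `t_{-α}(ξ) = conj t_α(ξ - α)` of the family of functions `t_α`. -/
theorem t_neg (α ξ : E d) : G.t (-α) ξ = starRingEnd ℂ (G.t α (ξ - α)) := by
  rw [t, t, kappa_neg, Complex.conj_tsum]
  refine tsum_congr fun j => ?_
  simp only [map_mul, map_inv₀, Complex.conj_ofReal, Complex.conj_conj, sub_add_cancel,
    ← sub_eq_add_neg]
  ring

theorem summable_of_calderonSum_ne_top {ξ : E d} (h : G.calderonSum ξ ≠ ⊤) :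
    Summable fun j => (G.absDet j)⁻¹ * ‖𝓕 (G.g j) ξ‖ ^ 2 := by
  have h0 : ∀ j, 0 ≤ (G.absDet j)⁻¹ * ‖𝓕 (G.g j) ξ‖ ^ 2 := fun j =>
    mul_nonneg (inv_nonneg.2 (G.absDet_pos j).le) (sq_nonneg _)
  exact (ENNReal.summable_toReal h).congr fun j => ENNReal.toReal_ofReal (h0 j)

theorem t_zero_eq {ξ : E d} :
    G.t 0 ξ = ((∑' j, (G.absDet j)⁻¹ * ‖𝓕 (G.g j) ξ‖ ^ 2 : ℝ) : ℂ) := by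
  rw [t, kappa_zero, Complex.ofReal_tsum, ← tsum_univ fun j : J =>
    (((G.absDet j)⁻¹ * ‖𝓕 (G.g j) ξ‖ ^ 2 : ℝ) : ℂ)]
  refine tsum_congr fun j => ?_
  rw [add_zero, Complex.conj_mul']
  push_cast
  rfl

/-- If the Calderón sum lies in `[A, B]`, then `|t_0 - B| ≤ B - A`. -/
theorem norm_t_zero_sub_le {ξ : E d} {A B : ℝ} (hA : 0 < A)
    (h1 : ENNReal.ofReal A ≤ G.calderonSum ξ) (h2 : G.calderonSum ξ ≤ ENNReal.ofReal B) :
    ‖G.t 0 ξ - B‖ₑ ≤ ENNReal.ofReal (B - A) := by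
  have hs := G.summable_of_calderonSum_ne_top (ne_top_of_le_ne_top ENNReal.ofReal_ne_top h2)
  have h0 : ∀ j, 0 ≤ (G.absDet j)⁻¹ * ‖𝓕 (G.g j) ξ‖ ^ 2 := fun j =>
    mul_nonneg (inv_nonneg.2 (G.absDet_pos j).le) (sq_nonneg _)
  have hc : G.calderonSum ξ = ENNReal.ofReal (∑' j, (G.absDet j)⁻¹ * ‖𝓕 (G.g j) ξ‖ ^ 2) :=
    (ENNReal.ofReal_tsum_of_nonneg h0 hs).symm
  set X := ∑' j, (G.absDet j)⁻¹ * ‖𝓕 (G.g j) ξ‖ ^ 2 with hX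
  have hX0 : 0 ≤ X := tsum_nonneg h0
  rw [hc] at h1 h2
  have h3 : A ≤ X := (ENNReal.ofReal_le_ofReal_iff hX0).1 h1
  have h4 : X ≤ B := by
    rcases ENNReal.ofReal_le_ofReal_iff'.1 h2 with h | h
    · exact h
    · linarith
  rw [t_zero_eq, ← hX, ← Complex.ofReal_sub, ← ofReal_norm, Complex.norm_real, Real.norm_eq_abs,
    abs_sub_comm, abs_of_nonneg (by linarith)]
  exact ENNReal.ofReal_le_ofReal (by linarith)

theorem aestronglyMeasurable_t [Countable J] (h : ∀ᵐ ξ, G.calderonSum ξ ≠ ⊤) (α : E d) :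
    AEStronglyMeasurable (G.t α) volume := by
  refine aestronglyMeasurable_of_tendsto_ae (Filter.atTop : Filter (Finset (G.kappa α)))
    (f := fun s ξ => ∑ j ∈ s, ((G.absDet j)⁻¹ : ℂ) *
      (starRingEnd ℂ (𝓕 (G.g j) ξ) * 𝓕 (G.g j) (ξ + α))) (fun s => ?_) ?_
  · refine Continuous.aestronglyMeasurable (continuous_finsetSum _ fun j _ => ?_)
    have h2 := G.continuous_fourier j
    exact continuous_const.mul ((Complex.continuous_conj.comp h2).mul
      (h2.comp (continuous_add_const α)))
  · filter_upwards [h, ae_comp_add h α] with ξ h1 h2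
    have h3 := (G.summable_of_calderonSum_ne_top h1).add (G.summable_of_calderonSum_ne_top h2)
    refine Summable.hasSum (Summable.of_norm_bounded (h3.subtype (G.kappa α)) fun j => ?_)
    have h4 : 0 ≤ (G.absDet j)⁻¹ := inv_nonneg.2 (G.absDet_pos j).le
    rw [norm_mul, norm_mul, RCLike.norm_conj, norm_inv, Complex.norm_real,
      Real.norm_of_nonneg (G.absDet_pos j).le, Function.comp_apply, ← mul_add]
    refine mul_le_mul_of_nonneg_left ?_ h4
    nlinarith [sq_nonneg (‖𝓕 (G.g j) ξ‖ - ‖𝓕 (G.g j) (ξ + α)‖),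
      sq_nonneg (‖𝓕 (G.g j) ξ‖ + ‖𝓕 (G.g j) (ξ + α)‖)]

end System

/-! ### The frame operator as an invertible multiplier -/

section Neumann

variable {H : Type*} [NormedAddCommGroup H] [NormedSpace ℂ H]

theorem isUnit_smul_one_add_of_norm_lt [CompleteSpace H] {c : ℂ} (R : H →L[ℂ] H)
    (h : ‖R‖ < ‖c‖) : IsUnit (c • (1 : H →L[ℂ] H) + R) := by
  have hc : 0 < ‖c‖ := (norm_nonneg R).trans_lt h
  have h1 : ‖-c⁻¹ • R‖ < 1 := by
    rw [norm_smul, norm_neg, norm_inv, inv_mul_lt_iff₀ hc, mul_one]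
    exact h
  have h3 : IsUnit (1 - (-c⁻¹ • R)) := isUnit_one_sub_of_norm_lt_one h1
  have h4 : c • (1 - (-c⁻¹ • R)) = c • (1 : H →L[ℂ] H) + R := by
    rw [smul_sub, smul_smul, mul_neg, mul_inv_cancel₀ (norm_pos_iff.1 hc), neg_one_smul,
      sub_neg_eq_add]
  rw [← h4]
  exact h3.smul (Units.mk0 c (norm_pos_iff.1 hc))

theorem smul_one_add_apply (c : ℂ) (R : H →L[ℂ] H) (F : H) :
    (c • (1 : H →L[ℂ] H) + R) F = c • F + R F := rfl

end Neumann

namespace System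

variable (G : System d J)

/-- The kernel bounding the off-diagonal functions `t_α` and the deviation `t_0 - B`. -/
def schurBound (B Cv : ℝ) (v₀ : E d → ℝ) (α ξ : E d) : ℝ≥0∞ :=
  open scoped Classical in
  if α = 0 then ‖G.t 0 ξ - B‖ₑ else ENNReal.ofReal Cv * (‖G.t α ξ‖ₑ * ENNReal.ofReal (v₀ α))

/-- The symmetry of the functions `t_α` turns column sums into row sums. -/
theorem schurBound_sub (B Cv : ℝ) {v₀ : E d → ℝ} (hv₀ : ∀ ξ, v₀ (-ξ) = v₀ ξ) (α ξ : E d) :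
    G.schurBound B Cv v₀ α (ξ - α) = G.schurBound B Cv v₀ (-α) ξ := by
  by_cases hα : α = 0
  · simp [schurBound, hα]
  · rw [schurBound, schurBound, if_neg hα, if_neg (neg_ne_zero.2 hα), t_neg, RCLike.enorm_conj, hv₀]

theorem tsum_schurBound_le [Nonempty J] {B Cv : ℝ} {v₀ : E d → ℝ} {ξ : E d} {a b : ℝ≥0∞}
    (h0 : ‖G.t 0 ξ - B‖ₑ ≤ a)
    (h1 : ENNReal.ofReal Cv * ∑' α : (G.Lam \ {0} : Set (E d)),
      ‖G.t α ξ‖ₑ * ENNReal.ofReal (v₀ α) ≤ b) :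
    ∑' α : G.Lam, G.schurBound B Cv v₀ α ξ ≤ a + b := by
  have hsub : G.Lam ⊆ {0} ∪ (G.Lam \ {0}) := fun α hα => by
    by_cases h : α = 0
    · exact Or.inl h
    · exact Or.inr ⟨hα, h⟩
  refine (ENNReal.tsum_mono_subtype (fun α => G.schurBound B Cv v₀ α ξ) hsub).trans
    ((ENNReal.tsum_union_le (fun α => G.schurBound B Cv v₀ α ξ) {0} (G.Lam \ {0})).trans
      (add_le_add ?_ ?_))
  · rw [tsum_singleton (0 : E d) (fun α => G.schurBound B Cv v₀ α ξ), schurBound, if_pos rfl]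
    exact h0
  · refine le_trans (le_of_eq ?_) h1
    rw [← ENNReal.tsum_mul_left]
    exact tsum_congr fun α => if_neg α.2.2

/-- The frame operator, conjugated with the Fourier transform and with a moderate weight `u`, is a
small perturbation of `B`; hence it is bounded and boundedly invertible on `L^2`. -/
theorem exists_multiplier [Countable J] {A B : ℝ} (hA : 0 < A)
    (hAB : ∀ᵐ ξ : E d,
      ENNReal.ofReal A ≤ G.calderonSum ξ ∧ G.calderonSum ξ ≤ ENNReal.ofReal B)
    {v₀ : E d → ℝ} (hv₀_symm : ∀ ξ, v₀ (-ξ) = v₀ ξ) {Cv : ℝ} (hCv : 0 ≤ Cv)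
    {δ : ℝ≥0} (hδA : δ < A)
    (hδ : ∀ᵐ ξ : E d, ENNReal.ofReal Cv * ∑' α : (G.Lam \ {0} : Set (E d)),
      ‖G.t α ξ‖ₑ * ENNReal.ofReal (v₀ α) ≤ δ)
    {u : E d → ℝ} (hu_meas : Measurable u) (hu_pos : ∀ ξ, 0 < u ξ)
    (hu_mod : ∀ ξ η, u (ξ + η) ≤ Cv * u ξ * v₀ η) :
    ∃ K : Lp ℂ 2 (volume : Measure (E d)) →L[ℂ] Lp ℂ 2 (volume : Measure (E d)),
      IsUnit K ∧ ∀ F, K F =ᵐ[volume] fun ξ =>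
        ∑' α : G.Lam, ((u ξ / u (ξ + α) : ℝ) : ℂ) * starRingEnd ℂ (G.t α ξ) * F (ξ + α) := by
  classical
  have hne : Nonempty J := by
    by_contra h
    rw [not_nonempty_iff] at h
    obtain ⟨ξ, hξ⟩ := hAB.exists
    have : G.calderonSum ξ = 0 := by simp [calderonSum]
    rw [this] at hξ
    exact absurd hξ.1 (by simpa using hA)
  have hB : A ≤ B := by
    obtain ⟨ξ, hξ⟩ := hAB.exists
    rcases ENNReal.ofReal_le_ofReal_iff'.1 (hξ.1.trans hξ.2) with h | h <;> linarith
  set k : G.Lam → E d → ℂ := fun α ξ =>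
    ((u ξ / u (ξ + α) : ℝ) : ℂ) * starRingEnd ℂ (G.t α ξ) - if (α : E d) = 0 then (B : ℂ) else 0
    with hk
  set b : G.Lam → E d → ℝ≥0∞ := fun α => G.schurBound B Cv v₀ α with hb
  have hcal : ∀ᵐ ξ, G.calderonSum ξ ≠ ⊤ := by
    filter_upwards [hAB] with ξ hξ using ne_top_of_le_ne_top ENNReal.ofReal_ne_top hξ.2
  have hk_meas : ∀ α, AEStronglyMeasurable (k α) volume := by
    intro α
    have h1 : Measurable fun ξ => ((u ξ / u (ξ + α) : ℝ) : ℂ) :=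
      Complex.measurable_ofReal.comp (hu_meas.div (hu_meas.comp (measurable_add_const _)))
    exact (h1.aestronglyMeasurable.mul (Complex.continuous_conj.comp_aestronglyMeasurable
      (G.aestronglyMeasurable_t hcal α))).sub aestronglyMeasurable_const
  have hb_meas : ∀ α, AEMeasurable (b α) volume := by
    intro α
    have h1 := G.aestronglyMeasurable_t hcal
    by_cases h0 : (α : E d) = 0
    · have : b α = fun ξ => ‖G.t 0 ξ - B‖ₑ := funext fun ξ => if_pos h0
      rw [this]
      exact ((h1 0).sub aestronglyMeasurable_const).enorm
    · have : b α = fun ξ => ENNReal.ofReal Cv * (‖G.t α ξ‖ₑ * ENNReal.ofReal (v₀ α)) :=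
        funext fun ξ => if_neg h0
      rw [this]
      exact ((h1 α).enorm.mul_const _).const_mul _
  have hkb : ∀ α ξ, ‖k α ξ‖ₑ ≤ b α ξ := by
    intro α ξ
    by_cases h0 : (α : E d) = 0
    · have h1 : k α ξ = starRingEnd ℂ (G.t 0 ξ - B) := by
        simp [hk, h0, (hu_pos ξ).ne']
      rw [h1, RCLike.enorm_conj]
      exact (if_pos h0).ge
    · have h1 : k α ξ = ((u ξ / u (ξ + α) : ℝ) : ℂ) * starRingEnd ℂ (G.t α ξ) := by
        simp [hk, h0]
      have h2 : ‖((u ξ / u (ξ + α) : ℝ) : ℂ)‖ₑ ≤ ENNReal.ofReal Cv * ENNReal.ofReal (v₀ α) := by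
        have h3 := hu_mod (ξ + α) (-α)
        rw [add_neg_cancel_right, hv₀_symm] at h3
        rw [← ofReal_norm, Complex.norm_real,
          Real.norm_of_nonneg (div_pos (hu_pos _) (hu_pos _)).le, ← ENNReal.ofReal_mul hCv]
        refine ENNReal.ofReal_le_ofReal ((div_le_iff₀ (hu_pos _)).2 ?_)
        linarith
      rw [h1, enorm_mul, RCLike.enorm_conj]
      refine (mul_le_mul_left h2 _).trans (le_of_eq ?_)
      refine Eq.trans ?_ (if_neg h0).symm
      ring
  set δ' : ℝ≥0 := Real.toNNReal (B - A) + δ with hδ'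
  have hrow : ∀ᵐ ξ, ∑' α, b α ξ ≤ δ' := by
    filter_upwards [hAB, hδ] with ξ h1 h2
    rw [hδ', ENNReal.coe_add]
    exact G.tsum_schurBound_le (G.norm_t_zero_sub_le hA h1.1 h1.2) h2
  have hcol : ∀ᵐ ξ, ∑' α : G.Lam, b α (ξ - α) ≤ δ' := by
    filter_upwards [hrow] with ξ h1
    let e : G.Lam ≃ G.Lam := (Equiv.neg (E d)).subtypeEquiv fun α => G.neg_mem_Lam.symm
    have h2 : ∀ α : G.Lam, b α (ξ - α) = b (e α) ξ := fun α => G.schurBound_sub B Cv hv₀_symm α ξ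
    rw [tsum_congr h2, e.tsum_eq fun α => b α ξ]
    exact h1
  obtain ⟨R, hR, hRF⟩ := exists_schur_operator hk_meas hb_meas hkb hrow hcol
  have hsum := ae_summable_kernel hb_meas hkb hrow hcol
  -- the kernel `k` omits `B` at `α = 0`, so `R` is the deviation of the operator from `B`
  refine ⟨(B : ℂ) • 1 + R, isUnit_smul_one_add_of_norm_lt R ?_, fun F => ?_⟩
  · refine hR.trans_lt ?_
    rw [hδ', NNReal.coe_add, Real.coe_toNNReal _ (by linarith), Complex.norm_real,
      Real.norm_of_nonneg (by linarith)]
    linarith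
  · rw [smul_one_add_apply]
    filter_upwards [Lp.coeFn_add ((B : ℂ) • F) (R F), Lp.coeFn_smul (B : ℂ) F, hRF F, hsum F]
      with ξ h2 h3 h4 h5
    rw [h2, Pi.add_apply, h3, Pi.smul_apply, smul_eq_mul, h4]
    set z : G.Lam := ⟨0, G.zero_mem_Lam⟩ with hz
    have h6 : HasSum (fun α : G.Lam => if α = z then (B : ℂ) * F ξ else 0) ((B : ℂ) * F ξ) :=
      hasSum_ite_eq z _
    refine (h6.add h5.of_norm.hasSum).tsum_eq.symm.trans (tsum_congr fun α => ?_)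
    by_cases h0 : α = z
    · have h7 : (α : E d) = 0 := congrArg Subtype.val h0
      simp only [hk, if_pos h0, if_pos h7]
      rw [h7, add_zero]
      ring
    · have h7 : ¬ (α : E d) = 0 := fun h => h0 (Subtype.ext h)
      simp only [hk, if_neg h0, if_neg h7, sub_zero, zero_add]

end System

/-! ### The frame operator on band-limited functions -/

theorem dense_range_invFourierTest (hΩ : volume ((Ω : Set (E d))ᶜ) = 0) :
    DenseRange (invFourierTest : 𝓓(Ω, ℂ) → Lp ℂ 2 (volume : Measure (E d))) := by
  have hb : ∀ K : Set (E d), IsCompact K → K ⊆ Ω → ∃ M : ℝ, ∀ ξ ∈ K, (1 : ℝ) ≤ M :=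
    fun _ _ _ => ⟨1, fun _ _ => le_rfl⟩
  have hv := memLp_weight_mul_test (Ω := Ω) measurable_const (fun _ => one_pos) hb
  have h1 := dense_range_weightedTest hΩ measurable_const (fun _ => one_pos) hb hv
  have h2 : (invFourierTest : 𝓓(Ω, ℂ) → Lp ℂ 2 (volume : Measure (E d))) =
      (Lp.fourierTransformₗᵢ (E d) ℂ).symm ∘ weightedTest (fun _ => 1) hv := by
    funext ψ
    rw [Function.comp_apply, LinearIsometryEquiv.eq_symm_apply]
    change 𝓕 (invFourierTest ψ) = _
    refine Lp.ext ?_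
    filter_upwards [coeFn_fourier_invFourierTest ψ, coeFn_weightedTest hv ψ] with ξ h3 h4
    rw [h3, h4, Complex.ofReal_one, one_mul]
  rw [h2]
  exact (Lp.fourierTransformₗᵢ (E d) ℂ).symm.surjective.denseRange.comp h1
    (LinearIsometryEquiv.continuous _)

namespace System

variable {G : System d J}

theorem inner_fourier_multiplier [Countable J]
    {K : Lp ℂ 2 (volume : Measure (E d)) →L[ℂ] Lp ℂ 2 (volume : Measure (E d))}
    (hK : ∀ F, K F =ᵐ[volume] fun ξ =>
      ∑' α : G.Lam, starRingEnd ℂ (G.t α ξ) * F (ξ + α)) (ψ₁ ψ₂ : 𝓓(Ω, ℂ)) :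
    inner ℂ (𝓕 (invFourierTest ψ₁) : Lp ℂ 2 (volume : Measure (E d)))
        (K (𝓕 (invFourierTest ψ₂))) =
      ∫ ξ, starRingEnd ℂ (ψ₁ ξ) * ∑' α : G.Lam, starRingEnd ℂ (G.t α ξ) * ψ₂ (ξ + α) := by
  rw [L2.inner_def]
  refine integral_congr_ae ?_
  filter_upwards [coeFn_fourier_invFourierTest ψ₁, hK (𝓕 (invFourierTest ψ₂)),
    ae_all_iff.2 fun α : G.Lam => ae_comp_add (coeFn_fourier_invFourierTest ψ₂) α] with ξ h1 h2 h3
  rw [h1, h2, RCLike.inner_apply, mul_comm]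
  simp only [h3]

/-- The frame coefficients of `𝓕⁻¹ ψ₁` and `𝓕⁻¹ ψ₂` pair to the form of the multiplier. -/
theorem hasSum_conj_coeff_mul_coeff [Countable J] (h : G.AlphaLIC Ω)
    {K : Lp ℂ 2 (volume : Measure (E d)) →L[ℂ] Lp ℂ 2 (volume : Measure (E d))}
    (hK : ∀ F, K F =ᵐ[volume] fun ξ =>
      ∑' α : G.Lam, starRingEnd ℂ (G.t α ξ) * F (ξ + α)) (ψ₁ ψ₂ : 𝓓(Ω, ℂ)) :
    HasSum (fun p : J × (Fin d → ℤ) => starRingEnd ℂ (G.coeff (invFourierTest ψ₁) p.1 p.2) *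
        G.coeff (invFourierTest ψ₂) p.1 p.2)
      (inner ℂ (𝓕 (invFourierTest ψ₁) : Lp ℂ 2 (volume : Measure (E d)))
        (K (𝓕 (invFourierTest ψ₂)))) := by
  rw [inner_fourier_multiplier hK]
  exact hasSum_frameForm h ψ₁ ψ₂

/-- The Bessel inequality on `𝓢_Ω`. -/
theorem sum_norm_coeff_sq_le [Countable J] (h : G.AlphaLIC Ω)
    {K : Lp ℂ 2 (volume : Measure (E d)) →L[ℂ] Lp ℂ 2 (volume : Measure (E d))}
    (hK : ∀ F, K F =ᵐ[volume] fun ξ =>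
      ∑' α : G.Lam, starRingEnd ℂ (G.t α ξ) * F (ξ + α)) (ψ : 𝓓(Ω, ℂ))
    (s : Finset (J × (Fin d → ℤ))) :
    ∑ p ∈ s, ‖G.coeff (invFourierTest ψ) p.1 p.2‖ ^ 2 ≤ ‖K‖ * ‖invFourierTest ψ‖ ^ 2 := by
  set f := invFourierTest ψ with hf
  have h1 : HasSum (fun p : J × (Fin d → ℤ) => ‖G.coeff f p.1 p.2‖ ^ 2)
      (inner ℂ (𝓕 f : Lp ℂ 2 (volume : Measure (E d))) (K (𝓕 f))).re := by
    refine (Complex.hasSum_re (hasSum_conj_coeff_mul_coeff h hK ψ ψ)).congr_fun fun p => ?_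
    rw [Complex.conj_mul', ← Complex.ofReal_pow, Complex.ofReal_re]
  refine (sum_le_hasSum s (fun _ _ => sq_nonneg _) h1).trans ((Complex.re_le_norm _).trans ?_)
  refine (norm_inner_le_norm _ _).trans ?_
  have h2 := K.le_opNorm (𝓕 f)
  rw [Lp.norm_fourier_eq] at h2 ⊢
  calc ‖f‖ * ‖K (𝓕 f)‖ ≤ ‖f‖ * (‖K‖ * ‖f‖) := mul_le_mul_of_nonneg_left h2 (norm_nonneg _)
    _ = ‖K‖ * ‖f‖ ^ 2 := by ring

theorem summable_frameTerm [Countable J] (hΩ : volume ((Ω : Set (E d))ᶜ) = 0)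
    (h : G.AlphaLIC Ω)
    {K : Lp ℂ 2 (volume : Measure (E d)) →L[ℂ] Lp ℂ 2 (volume : Measure (E d))}
    (hK : ∀ F, K F =ᵐ[volume] fun ξ =>
      ∑' α : G.Lam, starRingEnd ℂ (G.t α ξ) * F (ξ + α))
    (f : Lp ℂ 2 (volume : Measure (E d))) : Summable (G.frameTerm f) := by
  refine summable_inner_smul_of_bessel (a := fun p : J × (Fin d → ℤ) => G.atom p.1 p.2)
    (norm_nonneg K) (dense_range_invFourierTest hΩ) ?_ f
  rintro _ ⟨ψ, rfl⟩ s
  exact sum_norm_coeff_sq_le h hK ψ s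

/-- The Fourier transform turns the frame operator into the multiplier
`F ↦ ∑ α, conj t_α · F (· + α)`. -/
theorem fourier_frameOperator [Countable J] (hΩ : volume ((Ω : Set (E d))ᶜ) = 0)
    (h : G.AlphaLIC Ω)
    {K : Lp ℂ 2 (volume : Measure (E d)) →L[ℂ] Lp ℂ 2 (volume : Measure (E d))}
    (hK : ∀ F, K F =ᵐ[volume] fun ξ =>
      ∑' α : G.Lam, starRingEnd ℂ (G.t α ξ) * F (ξ + α)) (ψ : 𝓓(Ω, ℂ)) :
    𝓕 (G.frameOperator (invFourierTest ψ)) = K (𝓕 (invFourierTest ψ)) := by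
  have h1 : ∀ χ : 𝓓(Ω, ℂ), inner ℂ (invFourierTest χ) (G.frameOperator (invFourierTest ψ)) =
      inner ℂ (invFourierTest χ) (𝓕⁻ (K (𝓕 (invFourierTest ψ)))) := by
    intro χ
    have h2 := (summable_frameTerm hΩ h hK (invFourierTest ψ)).hasSum
    have h3 := h2.mapL (innerSL ℂ (invFourierTest χ))
    have h4 := hasSum_conj_coeff_mul_coeff h hK χ ψ
    have h5 : ∀ p, innerSL ℂ (invFourierTest χ) (G.frameTerm (invFourierTest ψ) p) =
        starRingEnd ℂ (G.coeff (invFourierTest χ) p.1 p.2) *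
          G.coeff (invFourierTest ψ) p.1 p.2 := by
      intro p
      rw [innerSL_apply_apply, frameTerm, inner_smul_right, mul_comm, coeff, inner_conj_symm]
      rfl
    simp only [h5] at h3
    rw [← Lp.inner_fourier_eq (invFourierTest χ) (𝓕⁻ _), fourier_fourierInv_eq]
    exact h3.unique h4
  have h2 : G.frameOperator (invFourierTest ψ) = 𝓕⁻ (K (𝓕 (invFourierTest ψ))) :=
    (dense_range_invFourierTest hΩ).eq_of_inner_right ℂ h1
  rw [h2, fourier_fourierInv_eq]

end System

/-! ### Operators on the decomposition space -/

section Operators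

variable {φ : I → 𝓓(Ω, ℂ)} {w : I → ℝ}

/-- A bounded operator on `L^2`, transported to the decomposition space. -/
def transportOp (Ψ : Lp ℂ 2 (volume : Measure (E d)) ≃ₗ[ℂ] DecompSpace φ w)
    (K : Lp ℂ 2 (volume : Measure (E d)) →L[ℂ] Lp ℂ 2 (volume : Measure (E d))) :
    DecompSpace φ w →ₗ[ℂ] DecompSpace φ w :=
  Ψ.toLinearMap ∘ₗ K.toLinearMap ∘ₗ Ψ.symm.toLinearMap

theorem transportOp_apply (Ψ : Lp ℂ 2 (volume : Measure (E d)) ≃ₗ[ℂ] DecompSpace φ w)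
    (K : Lp ℂ 2 (volume : Measure (E d)) →L[ℂ] Lp ℂ 2 (volume : Measure (E d)))
    (F : Lp ℂ 2 (volume : Measure (E d))) : transportOp Ψ K (Ψ F) = Ψ (K F) := by
  simp [transportOp]

theorem transportOp_comp_of_mul_eq_one
    (Ψ : Lp ℂ 2 (volume : Measure (E d)) ≃ₗ[ℂ] DecompSpace φ w)
    {K L : Lp ℂ 2 (volume : Measure (E d)) →L[ℂ] Lp ℂ 2 (volume : Measure (E d))}
    (h : K * L = 1) : transportOp Ψ K ∘ₗ transportOp Ψ L = LinearMap.id := by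
  ext f : 1
  obtain ⟨F, rfl⟩ := Ψ.surjective f
  have h1 : K (L F) = F := congrArg (fun T => T F) h
  rw [LinearMap.comp_apply, transportOp_apply, transportOp_apply, h1, LinearMap.id_apply]

variable {Ψ : Lp ℂ 2 (volume : Measure (E d)) ≃ₗ[ℂ] DecompSpace φ w}

theorem isBoundedOp_transportOp {C : ℝ≥0}
    (hC : ∀ F, decompNorm φ w (Ψ F) ≤ C * ‖F‖ₑ ∧ ‖F‖ₑ ≤ C * decompNorm φ w (Ψ F))
    (K : Lp ℂ 2 (volume : Measure (E d)) →L[ℂ] Lp ℂ 2 (volume : Measure (E d))) :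
    IsBoundedOp φ w (transportOp Ψ K) := by
  refine ⟨C * ‖K‖₊ * C, fun f => ?_⟩
  obtain ⟨F, rfl⟩ := Ψ.surjective f
  rw [transportOp_apply]
  have h1 : ‖K F‖ₑ ≤ ‖K‖₊ * ‖F‖ₑ := K.le_opENorm F
  calc decompNorm φ w (Ψ (K F)) ≤ C * ‖K F‖ₑ := (hC _).1
    _ ≤ C * (‖K‖₊ * (C * decompNorm φ w (Ψ F))) := by
      gcongr
      exact h1.trans (by gcongr; exact (hC F).2)
    _ = _ := by push_cast; ring

/-- A bounded operator on the decomposition space becomes continuous on `L^2`. -/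
theorem IsBoundedOp.continuous_conj {C : ℝ≥0}
    (hC : ∀ F, decompNorm φ w (Ψ F) ≤ C * ‖F‖ₑ ∧ ‖F‖ₑ ≤ C * decompNorm φ w (Ψ F))
    {S : DecompSpace φ w →ₗ[ℂ] DecompSpace φ w}
    (hS : IsBoundedOp φ w S) : Continuous fun F => Ψ.symm (S (Ψ F)) := by
  obtain ⟨M, hM⟩ := hS
  refine (AddMonoidHomClass.continuous_of_bound
    (Ψ.symm.toLinearMap ∘ₗ S ∘ₗ Ψ.toLinearMap) (C * M * C : ℝ≥0) fun F => ?_)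
  have h1 := (hC (Ψ.symm (S (Ψ F)))).2
  rw [Ψ.apply_symm_apply] at h1
  have h2 : ‖Ψ.symm (S (Ψ F))‖ₑ ≤ (C * M * C : ℝ≥0) * ‖F‖ₑ :=
    calc _ ≤ C * decompNorm φ w (S (Ψ F)) := h1
      _ ≤ C * (M * (C * ‖F‖ₑ)) := by
        gcongr
        exact (hM _).trans (by gcongr; exact (hC F).1)
      _ = _ := by push_cast; ring
  rw [enorm_eq_nnnorm, enorm_eq_nnnorm, ← ENNReal.coe_mul, ENNReal.coe_le_coe] at h2
  exact_mod_cast h2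

/-- If the weighted operator `K` extends the conjugated frame operator on the functions `v ψ`, then
its transport extends the frame operator. -/
theorem extends_transportOp {v : E d → ℝ} (hv_pos : ∀ ξ, 0 < v ξ)
    (hΨ : ∀ F ψ, (Ψ F : FourierDistr Ω).fourier ψ = ∫ ξ, ψ ξ * ((v ξ : ℂ)⁻¹ * F ξ))
    (hv : ∀ ψ : 𝓓(Ω, ℂ), MemLp (fun ξ => (v ξ : ℂ) * ψ ξ) 2 volume) (G : System d J)
    {K : Lp ℂ 2 (volume : Measure (E d)) →L[ℂ] Lp ℂ 2 (volume : Measure (E d))}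
    (hK : ∀ ψ : 𝓓(Ω, ℂ), K (weightedTest v hv ψ) =ᵐ[volume] fun ξ => (v ξ : ℂ) *
      (𝓕 (G.frameOperator (invFourierTest ψ)) : Lp ℂ 2 (volume : Measure (E d))) ξ) :
    Extends G (transportOp Ψ K) := by
  intro f hf F hF
  obtain ⟨ψ, hψ⟩ := exists_invFourierTest_eq hf
  rw [hψ] at hF ⊢
  have h1 : F = Ψ (weightedTest v hv ψ) :=
    Subtype.ext (hF.trans (equiv_weightedTest_eq_ofL2 hv_pos hΨ hv ψ).symm)
  rw [h1, transportOp_apply]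
  refine (fourierEquiv Ω).injective (ContinuousLinearMap.ext fun χ => ?_)
  rw [fourierEquiv_apply, fourierEquiv_apply, hΨ, ofL2_fourier_apply]
  refine integral_congr_ae ?_
  filter_upwards [hK ψ] with ξ h2
  rw [h2, inv_mul_cancel_left₀ (by exact_mod_cast (hv_pos ξ).ne')]

/-- Two bounded extensions of the frame operator agree, since the functions `v ψ` are dense. -/
theorem eq_of_extends {C : ℝ≥0}
    (hC : ∀ F, decompNorm φ w (Ψ F) ≤ C * ‖F‖ₑ ∧ ‖F‖ₑ ≤ C * decompNorm φ w (Ψ F))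
    {v : E d → ℝ} (hv_pos : ∀ ξ, 0 < v ξ)
    (hΨ : ∀ F ψ, (Ψ F : FourierDistr Ω).fourier ψ = ∫ ξ, ψ ξ * ((v ξ : ℂ)⁻¹ * F ξ))
    (hv : ∀ ψ : 𝓓(Ω, ℂ), MemLp (fun ξ => (v ξ : ℂ) * ψ ξ) 2 volume)
    (hdense : DenseRange (weightedTest v hv)) {G : System d J}
    {S S' : DecompSpace φ w →ₗ[ℂ] DecompSpace φ w} (hS : IsBoundedOp φ w S)
    (hS' : IsBoundedOp φ w S') (hE : Extends G S) (hE' : Extends G S') : S = S' := by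
  have h1 : (fun F => Ψ.symm (S (Ψ F))) = fun F => Ψ.symm (S' (Ψ F)) := by
    refine hdense.equalizer (hS.continuous_conj hC) (hS'.continuous_conj hC) ?_
    funext ψ
    have h2 := equiv_weightedTest_eq_ofL2 hv_pos hΨ hv ψ
    have hmem : 𝓕⁻ (testToSchwartz Ω ψ) ∈ SchwartzOn Ω := ⟨ψ, rfl⟩
    exact congrArg Ψ.symm (Subtype.ext ((hE _ hmem _ h2).trans (hE' _ hmem _ h2).symm))
  ext f : 1
  obtain ⟨F, rfl⟩ := Ψ.surjective f
  exact Ψ.symm.injective (congrFun h1 F)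

end Operators

end GSI

end

theorem mainTheorem3 {d : ℕ} {I J : Type*} [Countable J]
    (Ω : TopologicalSpace.Opens (GSI.E d))
    (hΩ : MeasureTheory.volume ((Ω : Set (GSI.E d))ᶜ) = 0)
    (Q : I → Set (GSI.E d)) (hQ : GSI.IsAdmissibleCover Ω Q)
    (φ : I → 𝓓(Ω, ℂ)) (hφ : GSI.IsBAPU Ω Q φ)
    (w : I → ℝ) (hw : GSI.IsModerateWeight Q w)
    (G : GSI.System d J)
    (A B : ℝ) (hA : 0 < A)
    (hAB : ∀ᵐ ξ : GSI.E d,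
      ENNReal.ofReal A ≤ G.calderonSum ξ ∧ G.calderonSum ξ ≤ ENNReal.ofReal B)
    (hLIC : G.AlphaLIC Ω)
    (v : GSI.E d → ℝ) (hv_meas : Measurable v) (hv_pos : ∀ ξ, 0 < v ξ)
    (hvw : ∃ C : ℝ, ∀ i, ∀ ξ ∈ Q i, v ξ ≤ C * w i ∧ w i ≤ C * v ξ)
    (v₀ : GSI.E d → ℝ) (hv₀_pos : ∀ ξ, 0 < v₀ ξ) (hv₀_symm : ∀ ξ, v₀ (-ξ) = v₀ ξ)
    (Cv : ℝ) (hv_mod : ∀ ξ η, v (ξ + η) ≤ Cv * v ξ * v₀ η)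
    (hsmall : ENNReal.ofReal Cv *
        essSup (fun ξ => ∑' α : (G.Lam \ {0} : Set (GSI.E d)),
          ‖G.t α ξ‖ₑ * ENNReal.ofReal (v₀ α)) (MeasureTheory.volume.restrict Ω)
      < ENNReal.ofReal A) :
    -- the series of the frame operator `S : 𝓢_Ω → L^2` converges unconditionally
    (∀ f ∈ GSI.SchwartzOn Ω, Summable (G.frameTerm (f.toLp 2))) ∧
    -- `𝓢_Ω` is contained in `D(Q, L^2, ℓ^2_w)`
    (∀ f ∈ GSI.SchwartzOn Ω, GSI.ofL2 Ω (f.toLp 2) ∈ GSI.DecompSpace φ w) ∧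
    -- `D(Q, L^2, ℓ^2_w)` is `𝓕⁻¹ (L^2_v(Ω))`, with equivalent norms
    (∃ C : ℝ≥0, ∀ f : GSI.FourierDistr Ω,
      GSI.decompNorm φ w f ≤ C * GSI.weightedL2Norm v f.fourier ∧
      GSI.weightedL2Norm v f.fourier ≤ C * GSI.decompNorm φ w f) ∧
    -- there is a unique bounded extension of `S`, and it is boundedly invertible
    ∃ S₀ : GSI.DecompSpace φ w →ₗ[ℂ] GSI.DecompSpace φ w,
      (GSI.IsBoundedOp φ w S₀ ∧ GSI.Extends G S₀) ∧
      (∀ S₁ : GSI.DecompSpace φ w →ₗ[ℂ] GSI.DecompSpace φ w,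
        GSI.IsBoundedOp φ w S₁ → GSI.Extends G S₁ → S₁ = S₀) ∧
      ∃ T : GSI.DecompSpace φ w →ₗ[ℂ] GSI.DecompSpace φ w,
        GSI.IsBoundedOp φ w T ∧ S₀ ∘ₗ T = LinearMap.id ∧ T ∘ₗ S₀ = LinearMap.id := by
  have h_supp : ∀ᵐ ξ : GSI.E d, ENNReal.ofReal Cv *
      ∑' α : (G.Lam \ {0} : Set (GSI.E d)), ‖G.t α ξ‖ₑ * ENNReal.ofReal (v₀ α) ≤
        ENNReal.ofReal Cv * essSup (fun ξ => ∑' α : (G.Lam \ {0} : Set (GSI.E d)),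
          ‖G.t α ξ‖ₑ * ENNReal.ofReal (v₀ α)) (volume.restrict Ω) := by
    rw [GSI.restrict_eq_self_of_compl_null hΩ]
    filter_upwards [ENNReal.ae_le_essSup fun ξ => ∑' α : (G.Lam \ {0} : Set (GSI.E d)),
      ‖G.t α ξ‖ₑ * ENNReal.ofReal (v₀ α)] with ξ hξ
    gcongr
  lift ENNReal.ofReal Cv * essSup (fun ξ => ∑' α : (G.Lam \ {0} : Set (GSI.E d)),
      ‖G.t α ξ‖ₑ * ENNReal.ofReal (v₀ α)) (volume.restrict Ω) to ℝ≥0 using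
    (hsmall.trans ENNReal.ofReal_lt_top).ne with δ hδ
  have hδA : (δ : ℝ) < A := by
    rw [ENNReal.ofReal, ENNReal.coe_lt_coe] at hsmall
    exact Real.lt_toNNReal_iff_coe_lt.1 hsmall
  have hCv : 0 ≤ Cv := by
    have h1 := hv_mod 0 0
    rw [add_zero] at h1
    have h2 := mul_pos (hv_pos 0) (hv₀_pos 0)
    nlinarith [hv_pos 0]
  -- moderateness applied to `ξ = 0` and back shows that the constant weight is moderate, too
  have h_one_mod : ∀ ξ η : GSI.E d, (1 : ℝ) ≤ Cv * 1 * v₀ η := by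
    intro _ η
    have h1 := hv_mod 0 η
    have h2 := hv_mod (0 + η) (-η)
    rw [add_neg_cancel_right, hv₀_symm] at h2
    have h3 : 0 ≤ Cv * v₀ η := mul_nonneg hCv (hv₀_pos η).le
    have h4 : v 0 * 1 ≤ v 0 * (Cv * v₀ η) ^ 2 := by nlinarith
    have h5 := le_of_mul_le_mul_left h4 (hv_pos 0)
    nlinarith
  obtain ⟨C₀, hvw⟩ := hvw
  have hvb : ∀ K : Set (GSI.E d), IsCompact K → K ⊆ Ω →
      ∃ M : ℝ, ∀ ξ ∈ K, v ξ ≤ M ∧ (v ξ)⁻¹ ≤ M := fun K hK hKΩ =>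
    GSI.exists_weight_le hφ hQ hw.pos hv_pos hvw hK hKΩ
  have hvb' : ∀ K : Set (GSI.E d), IsCompact K → K ⊆ Ω → ∃ M : ℝ, ∀ ξ ∈ K, v ξ ≤ M :=
    fun K hK hKΩ => (hvb K hK hKΩ).imp fun M hM ξ hξ => (hM ξ hξ).1
  have hv := GSI.memLp_weight_mul_test (Ω := Ω) hv_meas hv_pos hvb'
  have hdense := GSI.dense_range_weightedTest hΩ hv_meas hv_pos hvb' hv
  obtain ⟨K₁, -, hK₁⟩ := G.exists_multiplier hA hAB hv₀_symm hCv hδA h_supp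
    measurable_const (fun _ => one_pos) h_one_mod
  replace hK₁ : ∀ F, K₁ F =ᵐ[volume] fun ξ =>
      ∑' α : G.Lam, starRingEnd ℂ (G.t α ξ) * F (ξ + α) := fun F => by
    simpa using hK₁ F
  obtain ⟨K, hKu, hK⟩ := G.exists_multiplier hA hAB hv₀_symm hCv hδA h_supp
    hv_meas hv_pos hv_mod
  have hKK₁ : ∀ ψ : 𝓓(Ω, ℂ), K (GSI.weightedTest v hv ψ) =ᵐ[volume] fun ξ => (v ξ : ℂ) *
      (𝓕 (G.frameOperator (GSI.invFourierTest ψ)) : Lp ℂ 2 (volume : Measure (GSI.E d))) ξ := by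
    intro ψ
    rw [GSI.System.fourier_frameOperator hΩ hLIC hK₁]
    filter_upwards [hK (GSI.weightedTest v hv ψ), hK₁ (𝓕 (GSI.invFourierTest ψ)),
      ae_all_iff.2 fun α : G.Lam => GSI.ae_comp_add (GSI.coeFn_fourier_invFourierTest ψ) α,
      ae_all_iff.2 fun α : G.Lam => GSI.ae_comp_add (GSI.coeFn_weightedTest hv ψ) α]
      with ξ h1 h2 h3 h4
    rw [h1, h2, ← tsum_mul_left]
    refine tsum_congr fun α => ?_
    have h5 : (v (ξ + α) : ℂ) ≠ 0 := by exact_mod_cast (hv_pos _).ne'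
    rw [h3, h4]
    push_cast
    field_simp
  obtain ⟨C, hC⟩ := GSI.exists_norm_equivalence hφ hQ hw.pos hv_meas hv_pos hvw
  obtain ⟨Ψ, hΨ, hΨC⟩ := GSI.exists_equiv_decompSpace hΩ hv_meas hv_pos hvb hC
  refine ⟨fun f _ => GSI.System.summable_frameTerm hΩ hLIC hK₁ _, fun f hf => ?_, ⟨C, hC⟩,
    GSI.transportOp Ψ K, ⟨GSI.isBoundedOp_transportOp hΨC K,
      GSI.extends_transportOp hv_pos hΨ hv G hKK₁⟩, fun S₁ hS₁ hE =>
    GSI.eq_of_extends hΨC hv_pos hΨ hv hdense hS₁ (GSI.isBoundedOp_transportOp hΨC K) hE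
      (GSI.extends_transportOp hv_pos hΨ hv G hKK₁), ?_⟩
  · obtain ⟨ψ, hψ⟩ := GSI.exists_invFourierTest_eq hf
    rw [hψ, ← GSI.equiv_weightedTest_eq_ofL2 hv_pos hΨ hv ψ]
    exact (Ψ (GSI.weightedTest v hv ψ)).2
  · obtain ⟨U, rfl⟩ := hKu
    exact ⟨GSI.transportOp Ψ (U⁻¹ : Units _), GSI.isBoundedOp_transportOp hΨC _,
      GSI.transportOp_comp_of_mul_eq_one Ψ U.mul_inv,
      GSI.transportOp_comp_of_mul_eq_one Ψ U.inv_mul⟩
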